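/- Let $n\ge 1$ and $N=2n$. A link pattern is a fixed-point-free involution $\pi$ of $\{1,\dots,N\}$; let $V$ be the vector space with basis the link patterns. For $1\le i\le N-1$ and a scalar $\beta$, let $f_i$ act on $V$ by conjugating link patterns by the transposition $(i,i+1)$, and let $e_i$ act by $e_i\pi=\beta\pi$ if $\pi(i)=i+1$, and otherwise $e_i\pi=\pi'$, where $\pi'$ has the cycles $(i,i+1)$ and $(\pi(i),\pi(i+1))$ and agrees with $\pi$ at all other points. Let $r$ act by conjugation by the cycle $(1\,2\cdots N)$. Put $$\check R_i(u)=\frac{A(A-u)+A\,u\,e_i+(1-\beta/2)\,u\,(A-u)\,f_i}{(A+u)\,(A-(1-\beta/2)u)}.$$ The Brauer qKZ equations for $\Psi(z_1,\dots,z_N)=\sum_\pi \Psi_\pi\,\pi$ with $\Psi_\pi\in\mathbb C[A,\epsilon,z_1,\dots,z_N]$ are $$\check R_i(z_i-z_{i+1})\,\Psi(z_1,\dots,z_N)=\Psi(z_1,\dots,z_{i+1},z_i,\dots,z_N)\quad(1\le i\le N-1),$$ $$r^{-1}\,\Psi(z_1,\dots,z_N)=\Psi(z_2,\dots,z_N,z_1+\epsilon),$$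 where the first equation is read over the field $\mathbb C(A,\epsilon,z_1,\dots,z_N)$. Theorem. Let $\beta=\dfrac{2(A-\epsilon)}{2A-\epsilon}$. Then the Brauer qKZ equations have a solution $\Psi$ all of whose components $\Psi_\pi$ are nonzero homogeneous polynomials in $\mathbb Z[A,\epsilon,z_1,\dots,z_N]$ of degree $2n(n-1)$. This solution is unique up to numerical normalization: every solution whose components are homogeneous polynomials of degree $2n(n-1)$ in $\mathbb C[A,\epsilon,z_1,\dots,z_N]$ (or zero) is of the form $c\,\Psi$ with $c\in\mathbb C$. -/

import Mathlib

namespace BrauerQKZ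

/-- Link patterns of size `N`: involutions of `N` points without fixed points. -/
def LinkPattern (N : ℕ) : Type :=
  {π : Equiv.Perm (Fin N) // (∀ k, π (π k) = k) ∧ ∀ k, π k ≠ k}

namespace LinkPattern

/-- A permutation `s` acts on link patterns by conjugation, `π ↦ s π s⁻¹`. -/
def conj {N : ℕ} (s : Equiv.Perm (Fin N)) : LinkPattern N ≃ LinkPattern N where
  toFun π := ⟨s * π.1 * s⁻¹, fun k => by simp [π.2.1], fun k h => by
    apply π.2.2 (s⁻¹ k)
    apply s.injective
    simpa using h⟩
  invFun π := ⟨s⁻¹ * π.1 * s, fun k => by simp [π.2.1], fun k h => by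
    apply π.2.2 (s k)
    apply s⁻¹.injective
    simpa using h⟩
  left_inv π := by
    apply Subtype.ext
    simp [mul_assoc]
  right_inv π := by
    apply Subtype.ext
    simp [mul_assoc]

theorem conj_apply {N : ℕ} (s : Equiv.Perm (Fin N)) (π : LinkPattern N) (k : Fin N) :
    (conj s π).1 k = s (π.1 (s⁻¹ k)) := rfl

/-- The link pattern with cycles `(i, j)` and `(π i, π j)` and the rest as in `π`
(see `join_left`, `join_apply_left` and `join_of_ne`); it is `π` itself if `π i = j`.
It is obtained from `π` by exchanging the points `j` and `π i`. -/
def join {N : ℕ} (i j : Fin N) (π : LinkPattern N) : LinkPattern N :=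
  conj (Equiv.swap j (π.1 i)) π

theorem join_left {N : ℕ} {i j : Fin N} (hij : i ≠ j) (π : LinkPattern N) :
    (join i j π).1 i = j := by
  have h1 : i ≠ π.1 i := fun h => π.2.2 i h.symm
  simp [join, conj_apply, Equiv.swap_apply_of_ne_of_ne hij h1]

theorem join_apply_left {N : ℕ} {i j : Fin N} (hij : i ≠ j) (π : LinkPattern N) :
    (join i j π).1 (π.1 i) = π.1 j := by
  have h1 : π.1 j ≠ j := π.2.2 j
  have h2 : π.1 j ≠ π.1 i := fun e => hij (π.1.injective e).symm
  simp [join, conj_apply, Equiv.swap_apply_of_ne_of_ne h1 h2]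

theorem join_of_ne {N : ℕ} {i j : Fin N} (π : LinkPattern N) {k : Fin N}
    (h1 : k ≠ i) (h2 : k ≠ j) (h3 : k ≠ π.1 i) (h4 : k ≠ π.1 j) :
    (join i j π).1 k = π.1 k := by
  have h5 : π.1 k ≠ j := fun e => h4 (by rw [← e, π.2.1])
  have h6 : π.1 k ≠ π.1 i := fun e => h1 (π.1.injective e)
  simp [join, conj_apply, Equiv.swap_apply_of_ne_of_ne h2 h3, Equiv.swap_apply_of_ne_of_ne h5 h6]

end LinkPattern

/-- The Brauer generator `f_i` (with `j = i + 1`) on the free module on link patterns: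
conjugation by the transposition `(i, j)`. -/
noncomputable def fOp {N : ℕ} (K : Type) [CommRing K] (i j : Fin N) :
    (LinkPattern N →₀ K) →ₗ[K] (LinkPattern N →₀ K) :=
  (Finsupp.domLCongr (LinkPattern.conj (Equiv.swap i j))).toLinearMap

/-- The Brauer generator `e_i` (with `j = i + 1`) with loop parameter `β`: it multiplies `π` by `β`
if `π` pairs `i` with `j`, and otherwise joins `i` with `j` and `π i` with `π j`. -/
noncomputable def eOp {N : ℕ} {K : Type} [CommRing K] (β : K) (i j : Fin N) :
    (LinkPattern N →₀ K) →ₗ[K] (LinkPattern N →₀ K) :=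
  Finsupp.linearCombination K fun π : LinkPattern N =>
    if π.1 i = j then Finsupp.single π β else Finsupp.single (LinkPattern.join i j π) 1

/-- The rotation `r`: conjugation by the cycle `(1 2 ⋯ N)`. -/
noncomputable def rot (N : ℕ) (K : Type) [CommRing K] :
    (LinkPattern N →₀ K) ≃ₗ[K] (LinkPattern N →₀ K) :=
  Finsupp.domLCongr (LinkPattern.conj (finRotate N))

/-- The `R`-matrix `Ř_i(u)` (with `j = i + 1`) acting on the span of link patterns. -/
noncomputable def Rcheck {N : ℕ} {K : Type} [Field K] (A β u : K) (i j : Fin N) :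
    (LinkPattern N →₀ K) →ₗ[K] (LinkPattern N →₀ K) :=
  ((A + u) * (A - (1 - β / 2) * u))⁻¹ •
    ((A * (A - u)) • LinearMap.id + (A * u) • eOp β i j
      + ((1 - β / 2) * u * (A - u)) • fOp K i j)

/-- The variables `A`, `ε`, `z_1, …, z_N` (the latter indexed from `0`). -/
inductive Var (N : ℕ) : Type
  | A : Var N
  | eps : Var N
  | z : Fin N → Var N

/-- `ℂ[A, ε, z_1, …, z_N]`. -/
abbrev Poly (N : ℕ) : Type := MvPolynomial (Var N) ℂ

/-- `ℂ(A, ε, z_1, …, z_N)`. -/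
abbrev RatFun (N : ℕ) : Type := FractionRing (Poly N)

/-- A variable as an element of the field of rational functions. -/
noncomputable def ratVar {N : ℕ} (v : Var N) : RatFun N :=
  algebraMap (Poly N) (RatFun N) (MvPolynomial.X v)

/-- The substitution `p(A, ε, z_1, …, z_N) ↦ p(A, ε, w_1, …, w_N)`. -/
noncomputable def substZ {N : ℕ} (w : Fin N → Poly N) : Poly N →ₐ[ℂ] Poly N :=
  MvPolynomial.aeval fun v => match v with
    | Var.A => MvPolynomial.X Var.A
    | Var.eps => MvPolynomial.X Var.eps
    | Var.z k => w k

/-- The exchange of `z_i` and `z_j`. -/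
noncomputable def tau {N : ℕ} (i j : Fin N) : Poly N →ₐ[ℂ] Poly N :=
  substZ fun k => MvPolynomial.X (Var.z (Equiv.swap i j k))

/-- The substitution `p(z_1, …, z_N) ↦ p(z_2, …, z_N, z_1 + ε)`. -/
noncomputable def shift (N : ℕ) : Poly N →ₐ[ℂ] Poly N :=
  substZ fun k => MvPolynomial.X (Var.z (finRotate N k)) +
    if (k : ℕ) + 1 = N then MvPolynomial.X Var.eps else 0

/-- The Brauer qKZ equations with loop parameter `β` for a vector `Ψ = ∑ Ψ_π π` with polynomial
components. The exchange equation takes place over the field of rational functions. -/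
structure IsQKZSolution {N : ℕ} (β : RatFun N) (Ψ : LinkPattern N →₀ Poly N) : Prop where
  exchange : ∀ i j : Fin N, (i : ℕ) + 1 = j →
    Rcheck (ratVar Var.A) β (ratVar (Var.z i) - ratVar (Var.z j)) i j
        (Ψ.mapRange (algebraMap (Poly N) (RatFun N)) (map_zero _)) =
      (Ψ.mapRange (tau i j) (map_zero _)).mapRange (algebraMap (Poly N) (RatFun N)) (map_zero _)
  cyclic : (rot N (Poly N)).symm Ψ = Ψ.mapRange (shift N) (map_zero _)

/-- The special value `β = 2(A - ε)/(2A - ε)`. -/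
noncomputable def betaSpecial (N : ℕ) : RatFun N :=
  2 * (ratVar Var.A - ratVar Var.eps) / (2 * ratVar Var.A - ratVar Var.eps)

/-- Integer polynomial components regarded as complex ones. -/
noncomputable def ofInt {N : ℕ} (Ψ : LinkPattern N →₀ MvPolynomial (Var N) ℤ) :
    LinkPattern N →₀ Poly N :=
  Ψ.mapRange (MvPolynomial.map (Int.castRingHom ℂ)) (map_zero _)

end BrauerQKZ

/-! Put c = 2A − ε. Then 1 − β/2 = A/c, and after cancelling A/c the matrix Ř_i(u) becomes
R_i(u)/g(u), where R_i(u) = c(A−u) + u(A−u) f_i + u c e_i is `rOp` and g(u) = (A+u)(c−u) is `gFun`.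
The Brauer relations give R unitarity (`rOp_unitarity`) and the Yang–Baxter equation
(`rOp_yangBaxter`). On patterns that contain a suitable arc, R also has the crossing symmetry u ↔
A−u (`rOp_crossing`). The argument concerns polynomial functions on K^N for an infinite field K
containing A and c; in the end K = ℂ(A, ε, z). Places are numbered from 0.

Existence is an induction on the number of places, in steps of two. A solution should reduce at z_0
= z_1 − A to g-factors times the solution on two fewer places, with an arc (0,1) in front. The
exchange relations then force its values at all nodes z_0 = z_j − A (`chain`, `nodeVec`). For N + 2
places there are N + 1 nodes, which suits degree N in z_0, so the solution is defined by Lagrange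
interpolation. The interpolant satisfies the exchange relations among the places ≥ 1 because R
permutes the node values. It is polynomial because the numerator, multiplied by the Vandermonde
product, vanishes on all diagonals (`exists_interpolation`). The one missing relation, at the places
(0,1), is obtained from the invariance under reflecting the places and negating the variables
(`IsExchPair.mirror_interpolation`), since this reflection carries it to the relation at the last
two places.

Cyclicity needs the value at z_last = z_0 + A − c, where the solution reduces to a smaller one
surrounded by an arc (`IsExchPair.outerNode_next`). With this, the solution and its rotation agree
at z_0 = z_1 − A, hence at all nodes, hence everywhere (`IsExchPair.cyclic`).

Uniqueness, nonvanishing and integrality all come from one component, that of the pattern pairing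
opposite places. For components π with π(i) ≠ i+1 the generator e_i drops out, and the exchange
relation expresses Ψ at the conjugate of π through Ψ_π (`IsWeakSolution`). Hence a component
vanishes at z_j = z_i + A if its pattern has no arc within [i, j]. By rotation invariance this gives
the antipodal component 2n(n−1) distinct linear factors, which exhaust the degree, so it is their
product up to a constant. Adjacent transpositions act transitively on link patterns, and solving for
the next component only requires division by u(A−u). So the antipodal component determines all
others, no component of a nonzero solution vanishes, and integer coefficients and homogeneity pass
from the explicit product to every component. -/

namespace BrauerQKZ

open Equiv

/-! ### Conjugating and joining link patterns -/

namespace LinkPattern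

variable {N : ℕ}

theorem ext_apply {π σ : LinkPattern N} (h : ∀ k, π.1 k = σ.1 k) : π = σ :=
  Subtype.ext (Equiv.ext h)

theorem apply_eq_iff (π : LinkPattern N) {i j : Fin N} : π.1 i = j ↔ π.1 j = i :=
  ⟨fun h => by rw [← h, π.2.1], fun h => by rw [← h, π.2.1]⟩

theorem conj_conj (s t : Perm (Fin N)) (π : LinkPattern N) :
    conj s (conj t π) = conj (s * t) π :=
  ext_apply fun k => by simp [conj_apply]

theorem conj_one (π : LinkPattern N) : conj 1 π = π :=
  ext_apply fun k => by simp [conj_apply]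

theorem conj_apply_apply (s : Perm (Fin N)) (π : LinkPattern N) (k : Fin N) :
    (conj s π).1 (s k) = s (π.1 k) := by simp [conj_apply]

theorem conj_join (s : Perm (Fin N)) (i j : Fin N) (π : LinkPattern N) :
    conj s (join i j π) = join (s i) (s j) (conj s π) := by
  unfold join
  rw [conj_conj, conj_apply_apply, conj_conj, Equiv.mul_swap_eq_swap_mul]

theorem conj_swap_of_apply {i j : Fin N} {π : LinkPattern N} (h : π.1 i = j) :
    conj (swap i j) π = π := by
  apply ext_apply
  intro k
  rw [conj_apply, swap_inv]
  have h' := π.apply_eq_iff.1 h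
  rcases eq_or_ne k i with rfl | h1
  · rw [swap_apply_left, h', swap_apply_left, h]
  rcases eq_or_ne k j with rfl | h2
  · rw [swap_apply_right, h, swap_apply_right, h']
  rw [swap_apply_of_ne_of_ne h1 h2, swap_apply_of_ne_of_ne]
  · intro e; exact h2 (by rw [← h, ← e, π.2.1])
  · intro e; exact h1 (by rw [← h', ← e, π.2.1])

theorem join_of_apply {i j : Fin N} {π : LinkPattern N} (h : π.1 i = j) : join i j π = π := by
  unfold join
  rw [h, swap_self]
  exact conj_one π

theorem join_right {i j : Fin N} (hij : i ≠ j) (π : LinkPattern N) : (join i j π).1 j = i :=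
  (apply_eq_iff _).1 (join_left hij π)

theorem join_comm {i j : Fin N} (hij : i ≠ j) (π : LinkPattern N) : join i j π = join j i π := by
  apply ext_apply
  intro k
  rcases eq_or_ne k i with rfl | h1
  · rw [join_left hij, join_right hij.symm]
  rcases eq_or_ne k j with rfl | h2
  · rw [join_left hij.symm, join_right hij]
  rcases eq_or_ne k (π.1 i) with rfl | h3
  · rw [join_apply_left hij]; exact ((apply_eq_iff _).1 (join_apply_left hij.symm π)).symm
  rcases eq_or_ne k (π.1 j) with rfl | h4
  · rw [join_apply_left hij.symm]; exact (apply_eq_iff _).1 (join_apply_left hij π)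
  rw [join_of_ne π h1 h2 h3 h4, join_of_ne π h2 h1 h4 h3]

theorem join_eq_conj {i j : Fin N} {σ : LinkPattern N} (h : σ.1 i = j) (k : Fin N) :
    join j k σ = conj (swap i k) σ := by
  unfold join
  rw [σ.apply_eq_iff.1 h, swap_comm]

theorem conj_swap_join {i j : Fin N} (hij : i ≠ j) (π : LinkPattern N) :
    conj (swap i j) (join i j π) = join i j π :=
  conj_swap_of_apply (join_left hij π)

theorem join_join_of_ne {i j k l : Fin N} (hik : i ≠ k) (hil : i ≠ l) (hjk : j ≠ k) (hjl : j ≠ l)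
    {π : LinkPattern N} (h1 : k ≠ π.1 i) (h2 : k ≠ π.1 j) :
    join i j (join k l π) = join k l (join i j π) := by
  have h1' : i ≠ π.1 k := fun e => h1 (by rw [e, π.2.1])
  have h2' : j ≠ π.1 k := fun e => h2 (by rw [e, π.2.1])
  have e1 : join k l (join i j π) = conj (swap l (π.1 k)) (join i j π) := by
    rw [← join_of_ne π hik.symm hjk.symm h1 h2]
    rfl
  rw [e1, conj_join, swap_apply_of_ne_of_ne hil h1', swap_apply_of_ne_of_ne hjl h2']
  rfl

theorem join_eq_join {i j k l : Fin N} (hij : i ≠ j) (hkl : k ≠ l) {π : LinkPattern N}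
    (h1 : π.1 i = k) (h2 : π.1 j = l) : join i j π = join k l π := by
  subst h1 h2
  apply ext_apply
  intro m
  have e1 := join_apply_left hij π
  have e2 := join_apply_left hkl π
  simp only [π.2.1] at e2
  by_cases h1 : m = i
  · rw [h1, join_left hij, e2]
  by_cases h2 : m = j
  · rw [h2, join_right hij, (apply_eq_iff _).1 e2]
  by_cases h3 : m = π.1 i
  · rw [h3, join_left hkl, e1]
  by_cases h4 : m = π.1 j
  · rw [h4, join_right hkl, (apply_eq_iff _).1 e1]
  rw [join_of_ne π h1 h2 h3 h4, join_of_ne π h3 h4 (by rwa [π.2.1]) (by rwa [π.2.1])]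

/-- If k or l lies off the arcs through i and j, joining it is conjugation by a transposition that
fixes i and j. Otherwise k and l are the partners of i and j, and both orders give the single join.
-/
theorem join_join_disjoint {i j k l : Fin N} (hij : i ≠ j) (hkl : k ≠ l) (hik : i ≠ k)
    (hil : i ≠ l) (hjk : j ≠ k) (hjl : j ≠ l) (π : LinkPattern N) :
    join i j (join k l π) = join k l (join i j π) := by
  by_cases h : k ≠ π.1 i ∧ k ≠ π.1 j
  · exact join_join_of_ne hik hil hjk hjl h.1 h.2
  by_cases h' : l ≠ π.1 i ∧ l ≠ π.1 j
  · rw [join_comm hkl, join_comm hkl]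
    exact join_join_of_ne hil hik hjl hjk h'.1 h'.2
  have key : ∀ {i j : Fin N}, i ≠ j → π.1 i = k → π.1 j = l →
      join i j (join k l π) = join k l (join i j π) := by
    intro i j hij h1 h2
    rw [← join_eq_join hij hkl h1 h2, join_of_apply (join_left hij π),
      join_of_apply (i := k) (j := l)]
    rw [← h1, join_apply_left hij, h2]
  by_cases h1 : k = π.1 i
  · have h2 : l = π.1 j := by
      by_contra h2
      exact h' ⟨fun e => hkl (h1.trans e.symm), h2⟩
    exact key hij h1.symm h2.symm
  · have h3 : k = π.1 j := by
      by_contra h3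
      exact h ⟨h1, h3⟩
    have h2 : l = π.1 i := by
      by_contra h2
      exact h' ⟨h2, fun e => hkl (h3.trans e.symm)⟩
    rw [join_comm hij, join_comm hij]
    exact key hij.symm h3.symm h2.symm

/-- Tells when a second join closes a loop, which is what the weights in `eOp_commute` depend on. -/
theorem join_apply_iff {i j k l : Fin N} (hkl : k ≠ l) (hik : i ≠ k) (hil : i ≠ l)
    (π : LinkPattern N) : (join k l π).1 i = j ↔
      (π.1 i = j ∧ j ≠ k ∧ j ≠ l) ∨ (π.1 i = k ∧ π.1 j = l) ∨ (π.1 i = l ∧ π.1 j = k) := by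
  by_cases h1 : π.1 i = k
  · have h := join_apply_left hkl π
    rw [π.apply_eq_iff.1 h1] at h
    rw [h, π.apply_eq_iff (i := l)]
    have : k ≠ l := hkl
    grind
  by_cases h2 : π.1 i = l
  · have h := join_apply_left hkl.symm π
    rw [π.apply_eq_iff.1 h2] at h
    rw [join_comm hkl, h, π.apply_eq_iff (i := k)]
    grind
  rw [join_of_ne π hik hil (fun e => h1 (by rw [e, π.2.1])) (fun e => h2 (by rw [e, π.2.1]))]
  grind

end LinkPattern

/-! ### Brauer operators on the span of link patterns -/

section Operators

open LinkPattern

variable {N : ℕ} {K : Type} [CommRing K]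

/-- Conjugation of link patterns by a permutation, extended linearly. -/
noncomputable def conjOp (K : Type) [CommRing K] (s : Perm (Fin N)) :
    Module.End K (LinkPattern N →₀ K) :=
  (Finsupp.domLCongr (LinkPattern.conj s)).toLinearMap

theorem conjOp_single (s : Perm (Fin N)) (π : LinkPattern N) (x : K) :
    conjOp K s (Finsupp.single π x) = Finsupp.single (conj s π) x := by
  simp [conjOp]

theorem conjOp_mul (s t : Perm (Fin N)) : conjOp K (s * t) = conjOp K s * conjOp K t := by
  refine Finsupp.lhom_ext fun π x => ?_
  rw [Module.End.mul_apply, conjOp_single, conjOp_single, conjOp_single, conj_conj]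

theorem conjOp_one : conjOp K (1 : Perm (Fin N)) = 1 := by
  refine Finsupp.lhom_ext fun π x => ?_
  rw [conjOp_single, conj_one, Module.End.one_apply]

theorem fOp_eq (i j : Fin N) : fOp K i j = conjOp K (swap i j) := rfl

/-- Joining a pair that is already joined changes nothing, so the two branches of the definition
differ only in the weight. -/
theorem eOp_single (β : K) (i j : Fin N) (π : LinkPattern N) (x : K) :
    eOp β i j (Finsupp.single π x) =
      Finsupp.single (join i j π) (x * if π.1 i = j then β else 1) := by
  unfold eOp
  rw [Finsupp.linearCombination_single]
  split_ifs with h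
  · rw [join_of_apply h]; simp
  · simp

theorem conjOp_eOp (β : K) (s : Perm (Fin N)) (i j : Fin N) :
    conjOp K s * eOp β i j = eOp β (s i) (s j) * conjOp K s := by
  refine Finsupp.lhom_ext fun π x => ?_
  rw [Module.End.mul_apply, Module.End.mul_apply, eOp_single, conjOp_single, conjOp_single,
    eOp_single, conj_join, conj_apply_apply]
  simp

theorem eOp_comm (β : K) {i j : Fin N} (hij : i ≠ j) : eOp β i j = eOp β j i := by
  refine Finsupp.lhom_ext fun π x => ?_
  rw [eOp_single, eOp_single, join_comm hij]
  simp only [π.apply_eq_iff (i := i)]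

theorem conjOp_swap_mul_eOp (β : K) {i j : Fin N} (hij : i ≠ j) :
    conjOp K (swap i j) * eOp β i j = eOp β i j := by
  refine Finsupp.lhom_ext fun π x => ?_
  rw [Module.End.mul_apply, eOp_single, conjOp_single, conj_swap_join hij]

theorem eOp_mul_conjOp_swap (β : K) {i j : Fin N} (hij : i ≠ j) :
    eOp β i j * conjOp K (swap i j) = eOp β i j := by
  have := conjOp_eOp β (swap i j) i j
  rw [conjOp_swap_mul_eOp β hij, swap_apply_left, swap_apply_right, ← eOp_comm β hij] at this
  exact this.symm

theorem eOp_mul_self (β : K) {i j : Fin N} (hij : i ≠ j) :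
    eOp β i j * eOp β i j = β • eOp β i j := by
  refine Finsupp.lhom_ext fun π x => ?_
  rw [Module.End.mul_apply, eOp_single, eOp_single, join_of_apply (join_left hij π),
    if_pos (join_left hij π), LinearMap.smul_apply, eOp_single, Finsupp.smul_single, smul_eq_mul,
    mul_comm]

theorem eOp_single_of_apply (β : K) {i j k : Fin N} (hik : i ≠ k) {σ : LinkPattern N}
    (h : σ.1 i = j) (x : K) :
    eOp β j k (Finsupp.single σ x) = conjOp K (swap i k) (Finsupp.single σ x) := by
  rw [eOp_single, conjOp_single, join_eq_conj h, if_neg, mul_one]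
  rw [σ.apply_eq_iff.1 h]; exact hik

/-- Every pattern in the image of e_ij has the arc (i, j), and then joining j to k amounts to
exchanging i and k. Together with the conjugation rule `conjOp_eOp` and the absorption of f_ij by
e_ij, this yields the mixed Brauer relations on three places. -/
theorem eOp_mul_eOp (β : K) {i j k : Fin N} (hij : i ≠ j) (hik : i ≠ k) :
    eOp β j k * eOp β i j = conjOp K (swap i k) * eOp β i j := by
  refine Finsupp.lhom_ext fun π x => ?_
  rw [Module.End.mul_apply, Module.End.mul_apply, eOp_single,
    eOp_single_of_apply β hik (join_left hij π)]

theorem eOp_commute (β : K) {i j k l : Fin N} (hij : i ≠ j) (hkl : k ≠ l) (hik : i ≠ k)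
    (hil : i ≠ l) (hjk : j ≠ k) (hjl : j ≠ l) : Commute (eOp β i j) (eOp β k l) := by
  rw [commute_iff_eq]
  refine Finsupp.lhom_ext fun π x => ?_
  rw [Module.End.mul_apply, Module.End.mul_apply, eOp_single, eOp_single, eOp_single, eOp_single,
    join_join_disjoint hij hkl hik hil hjk hjl]
  have e1 := join_apply_iff hkl hik hil π (j := j)
  have e2 := join_apply_iff hij hik.symm hjk.symm π (j := l)
  by_cases h1 : π.1 i = j
  · rw [join_of_apply h1, if_pos h1, if_pos (e1.2 (Or.inl ⟨h1, hjk, hjl⟩))]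
    exact congrArg _ (mul_right_comm _ _ _)
  by_cases h2 : π.1 k = l
  · rw [join_of_apply h2, if_pos h2, if_pos (e2.2 (Or.inl ⟨h2, hil.symm, hjl.symm⟩))]
    exact congrArg _ (mul_right_comm _ _ _)
  rw [if_neg h1, if_neg h2]
  refine congrArg (fun t => Finsupp.single _ (x * 1 * t)) (if_congr ?_ rfl rfl)
  -- If neither arc is present, either second join closes a loop exactly when {π i, π j} = {k, l}, a
  -- condition symmetric in the two pairs.
  rw [e1, e2, π.apply_eq_iff (i := k) (j := i), π.apply_eq_iff (i := k) (j := j),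
    π.apply_eq_iff (i := l) (j := i), π.apply_eq_iff (i := l) (j := j)]
  grind

end Operators
end BrauerQKZ


namespace BrauerQKZ

open Equiv

/-! ### Unitarity and Yang–Baxter from abstract relations -/

section BrauerAlgebra

variable {K B : Type*} [CommRing K] [Ring B] [Algebra K B]

/-- Here `e` stands for c times the Brauer generator; since c β = 2 (c − A), the relations and the
R-matrix then contain no division. -/
theorem unitarity_of_relations {A c : K} {f e : B} (hff : f * f = 1) (hfe : f * e = e)
    (hef : e * f = e) (hee : e * e = (2 * (c - A)) • e) (u : K) :
    ((c * (A - u)) • (1 : B) + (u * (A - u)) • f + u • e) *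
      ((c * (A + u)) • (1 : B) + (-u * (A + u)) • f + (-u) • e) =
      ((A + u) * (c - u) * ((A - u) * (c + u))) • (1 : B) := by
  simp only [add_mul, mul_add, smul_mul_smul_comm, one_mul, mul_one, hff, hfe, hef, hee]
  module

/-- The relations are oriented so that they reduce all words in the two expanded products to common
normal forms. What remains is a comparison of polynomial coefficients. -/
theorem yangBaxter_of_relations {A c : K} {f₁ f₂ e₁ e₂ : B}
    (h1 : f₁ * f₁ = 1) (h2 : f₂ * f₂ = 1)
    (h3 : f₁ * e₁ = e₁) (h4 : f₂ * e₂ = e₂) (h5 : e₁ * f₁ = e₁) (h6 : e₂ * f₂ = e₂)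
    (h7 : e₁ * e₁ = (2 * (c - A)) • e₁) (h8 : e₂ * e₂ = (2 * (c - A)) • e₂)
    (h9 : f₂ * (f₁ * f₂) = f₁ * (f₂ * f₁))
    (h10 : e₂ * e₁ = c • (f₁ * (f₂ * e₁))) (h11 : e₁ * e₂ = c • (f₂ * (f₁ * e₂)))
    (h12 : e₁ * (f₂ * f₁) = f₂ * (f₁ * e₂)) (h13 : e₂ * (f₁ * f₂) = f₁ * (f₂ * e₁))
    (h14 : f₂ * (e₁ * f₂) = f₁ * (e₂ * f₁))
    (h15 : e₁ * (f₂ * e₁) = c • e₁) (h16 : e₂ * (f₁ * e₂) = c • e₂)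
    (h17 : e₁ * (e₂ * f₁) = c • (e₁ * f₂)) (h18 : e₂ * (e₁ * f₂) = c • (e₂ * f₁))
    (u v : K) :
    ((c * (A - u)) • (1 : B) + (u * (A - u)) • f₁ + u • e₁) *
      (((c * (A - (u + v))) • (1 : B) + ((u + v) * (A - (u + v))) • f₂ + (u + v) • e₂) *
      ((c * (A - v)) • (1 : B) + (v * (A - v)) • f₁ + v • e₁)) =
    ((c * (A - v)) • (1 : B) + (v * (A - v)) • f₂ + v • e₂) *
      (((c * (A - (u + v))) • (1 : B) + ((u + v) * (A - (u + v))) • f₁ + (u + v) • e₁) *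
      ((c * (A - u)) • (1 : B) + (u * (A - u)) • f₂ + u • e₂)) := by
  have h1' : ∀ x, f₁ * (f₁ * x) = x := fun x => by rw [← mul_assoc, h1, one_mul]
  have h2' : ∀ x, f₂ * (f₂ * x) = x := fun x => by rw [← mul_assoc, h2, one_mul]
  have h5' : ∀ x, e₁ * (f₁ * x) = e₁ * x := fun x => by rw [← mul_assoc, h5]
  have h6' : ∀ x, e₂ * (f₂ * x) = e₂ * x := fun x => by rw [← mul_assoc, h6]
  simp only [add_mul, mul_add, one_mul, mul_one, mul_smul_comm, smul_mul_assoc,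
    h1, h2, h3, h4, h5, h6, h7, h8, h9, h10, h11, h12, h13, h14, h15, h16, h17, h18,
    h1', h2', h5', h6']
  module

end BrauerAlgebra

/-! ### Brauer relations for three places -/

section Relations

variable {N : ℕ} {K : Type} [CommRing K]

theorem conjOp_swap_mul_self (i j : Fin N) : conjOp K (swap i j) * conjOp K (swap i j) = 1 := by
  rw [← conjOp_mul, swap_mul_self, conjOp_one]

theorem swap_braid {i j k : Fin N} (hik : i ≠ k) (hjk : j ≠ k) :
    swap i j * swap j k * swap i j = swap i k := by
  rw [swap_comm i j, swap_comm j k, swap_mul_swap_mul_swap hjk.symm hik.symm]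

theorem conjOp_braid {i j k : Fin N} (hik : i ≠ k) (hjk : j ≠ k) :
    conjOp K (swap i j) * (conjOp K (swap j k) * conjOp K (swap i j)) = conjOp K (swap i k) := by
  rw [← conjOp_mul, ← conjOp_mul, ← mul_assoc, swap_braid hik hjk]

theorem eOp_mul_eOp_eq (β : K) {i j k : Fin N} (hij : i ≠ j) (hik : i ≠ k) (hjk : j ≠ k) :
    eOp β j k * eOp β i j = conjOp K (swap i j) * (conjOp K (swap j k) * eOp β i j) := by
  rw [eOp_mul_eOp β hij hik, ← conjOp_braid hik hjk, mul_assoc, mul_assoc,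
    conjOp_swap_mul_eOp β hij]

theorem eOp_mul_conjOp_conjOp (β : K) {i j k : Fin N} (hij : i ≠ j) (hik : i ≠ k) (hjk : j ≠ k) :
    eOp β i j * (conjOp K (swap j k) * conjOp K (swap i j)) =
      conjOp K (swap j k) * (conjOp K (swap i j) * eOp β j k) := by
  rw [← mul_assoc (conjOp K (swap j k)), ← conjOp_mul, conjOp_eOp]
  simp [swap_apply_of_ne_of_ne hij hik, swap_apply_of_ne_of_ne hik.symm hjk.symm]

theorem conjOp_eOp_conjOp (β : K) {i j k : Fin N} (hij : i ≠ j) (hik : i ≠ k) :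
    conjOp K (swap j k) * (eOp β i j * conjOp K (swap j k)) = eOp β i k := by
  rw [← mul_assoc, conjOp_eOp, mul_assoc, conjOp_swap_mul_self, mul_one,
    swap_apply_of_ne_of_ne hij hik, swap_apply_left]

theorem eOp_conjOp_eOp (β : K) {i j k : Fin N} (hij : i ≠ j) (hik : i ≠ k) (hjk : j ≠ k) :
    eOp β i j * (conjOp K (swap j k) * eOp β i j) = eOp β i j := by
  have h := conjOp_eOp β (swap j k) i k
  rw [swap_apply_of_ne_of_ne hij hik, swap_apply_right] at h
  rw [← mul_assoc, ← h, mul_assoc, eOp_comm β hij, eOp_mul_eOp β hij.symm hjk, ← mul_assoc,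
    conjOp_swap_mul_self, one_mul]

theorem eOp_eOp_conjOp (β : K) {i j k : Fin N} (hij : i ≠ j) (hik : i ≠ k) (hjk : j ≠ k) :
    eOp β i j * (eOp β j k * conjOp K (swap i j)) = eOp β i j * conjOp K (swap j k) := by
  have h := conjOp_eOp β (swap i j) i k
  rw [swap_apply_left, swap_apply_of_ne_of_ne hik.symm hjk.symm] at h
  rw [← h, ← mul_assoc, eOp_mul_conjOp_swap β hij, eOp_comm β hik,
    eOp_mul_eOp β hik.symm hjk.symm, conjOp_eOp, swap_apply_left, swap_comm k j,
    swap_apply_of_ne_of_ne hij hik, eOp_comm β hij.symm]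

end Relations

/-! ### The polynomial R-matrix -/

section RMatrix

variable {N : ℕ} {K : Type} [Field K]

/-- The loop weight for which `A / c = 1 - β / 2`. -/
def loopWeight (A c : K) : K := 2 * (c - A) / c

/-- The polynomial form of the `R`-matrix. -/
noncomputable def rOp (A c : K) (i j : Fin N) (u : K) : Module.End K (LinkPattern N →₀ K) :=
  (c * (A - u)) • 1 + (u * (A - u)) • conjOp K (swap i j) + u • (c • eOp (loopWeight A c) i j)

/-- The common denominator of the `R`-matrix. -/
def gFun (A c u : K) : K := (A + u) * (c - u)

theorem rOp_comm (A c : K) {i j : Fin N} (hij : i ≠ j) (u : K) :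
    rOp A c i j u = rOp A c j i u := by
  unfold rOp
  rw [eOp_comm _ hij, swap_comm]

theorem rOp_zero (A c : K) (i j : Fin N) : rOp A c i j 0 = (c * A) • 1 := by
  simp [rOp]

theorem loop_relation {A c : K} (hc : c ≠ 0) {i j : Fin N} (hij : i ≠ j) :
    (c • eOp (loopWeight A c) i j) * (c • eOp (loopWeight A c) i j) =
      (2 * (c - A)) • (c • eOp (loopWeight A c) i j) := by
  rw [smul_mul_smul_comm, eOp_mul_self _ hij, smul_smul, smul_smul]
  congr 1
  unfold loopWeight
  field_simp

theorem rOp_unitarity {A c : K} (hc : c ≠ 0) {i j : Fin N} (hij : i ≠ j) (u : K) :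
    rOp A c i j u * rOp A c i j (-u) = (gFun A c u * gFun A c (-u)) • 1 := by
  have := unitarity_of_relations (A := A) (conjOp_swap_mul_self (K := K) i j)
    (e := c • eOp (loopWeight A c) i j)
    (by rw [mul_smul_comm, conjOp_swap_mul_eOp _ hij])
    (by rw [smul_mul_assoc, eOp_mul_conjOp_swap _ hij]) (loop_relation hc hij) u
  unfold rOp gFun
  simpa only [sub_neg_eq_add, ← sub_eq_add_neg] using this

theorem rOp_yangBaxter {A c : K} (hc : c ≠ 0) {i j k : Fin N} (hij : i ≠ j) (hik : i ≠ k)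
    (hjk : j ≠ k) (u v : K) :
    rOp A c i j u * (rOp A c j k (u + v) * rOp A c i j v) =
      rOp A c j k v * (rOp A c i j (u + v) * rOp A c j k u) := by
  have ekj : swap k j = swap j k := swap_comm k j
  have eji : swap j i = swap i j := swap_comm j i
  have fkj : ∀ β : K, eOp β k j = eOp β j k := fun β => eOp_comm β hjk.symm
  have fji : ∀ β : K, eOp β j i = eOp β i j := fun β => eOp_comm β hij.symm
  unfold rOp
  apply yangBaxter_of_relations (K := K) (B := Module.End K (LinkPattern N →₀ K))
    (conjOp_swap_mul_self i j) (conjOp_swap_mul_self j k)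
  · rw [mul_smul_comm, conjOp_swap_mul_eOp _ hij]
  · rw [mul_smul_comm, conjOp_swap_mul_eOp _ hjk]
  · rw [smul_mul_assoc, eOp_mul_conjOp_swap _ hij]
  · rw [smul_mul_assoc, eOp_mul_conjOp_swap _ hjk]
  · exact loop_relation hc hij
  · exact loop_relation hc hjk
  · have := conjOp_braid (K := K) hik.symm hij.symm
    rw [ekj, eji] at this
    rw [this, conjOp_braid hik hjk, swap_comm]
  · rw [smul_mul_smul_comm, eOp_mul_eOp_eq _ hij hik hjk, mul_smul_comm, mul_smul_comm, smul_smul]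
  · have := eOp_mul_eOp_eq (loopWeight A c) hjk.symm hik.symm hij.symm
    rw [fji, fkj, ekj, eji] at this
    rw [smul_mul_smul_comm, this, mul_smul_comm, mul_smul_comm, smul_smul]
  · rw [smul_mul_assoc, eOp_mul_conjOp_conjOp _ hij hik hjk, mul_smul_comm, mul_smul_comm]
  · have := eOp_mul_conjOp_conjOp (loopWeight A c) hjk.symm hik.symm hij.symm
    rw [fji, fkj, ekj, eji] at this
    rw [smul_mul_assoc, this, mul_smul_comm, mul_smul_comm]
  · have := conjOp_eOp_conjOp (loopWeight A c) hjk.symm hik.symm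
    rw [fkj, eji, eOp_comm _ hik.symm] at this
    rw [smul_mul_assoc, smul_mul_assoc, mul_smul_comm, mul_smul_comm, this,
      conjOp_eOp_conjOp _ hij hik]
  · rw [mul_smul_comm, smul_mul_smul_comm, eOp_conjOp_eOp _ hij hik hjk, smul_smul]
  · have := eOp_conjOp_eOp (loopWeight A c) hjk.symm hik.symm hij.symm
    rw [fkj, eji] at this
    rw [mul_smul_comm, smul_mul_smul_comm, this, smul_smul]
  · simp only [smul_mul_assoc, mul_smul_comm, eOp_eOp_conjOp _ hij hik hjk]
  · have := eOp_eOp_conjOp (loopWeight A c) hjk.symm hik.symm hij.symm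
    rw [fkj, fji, eji, ekj] at this
    simp only [smul_mul_assoc, mul_smul_comm, this]

theorem conjOp_rOp (A c : K) (s : Perm (Fin N)) (i j : Fin N) (u : K) :
    conjOp K s * rOp A c i j u = rOp A c (s i) (s j) u * conjOp K s := by
  unfold rOp
  simp only [mul_add, add_mul, mul_smul_comm, smul_mul_assoc, mul_one, one_mul, conjOp_eOp,
    ← conjOp_mul, Equiv.mul_swap_eq_swap_mul]

theorem rOp_commute (A c : K) {i j k l : Fin N} (hij : i ≠ j) (hkl : k ≠ l) (hik : i ≠ k)
    (hil : i ≠ l) (hjk : j ≠ k) (hjl : j ≠ l) (u v : K) :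
    Commute (rOp A c i j u) (rOp A c k l v) := by
  have h1 : Commute (conjOp K (swap i j)) (rOp A c k l v) := by
    rw [commute_iff_eq, conjOp_rOp, swap_apply_of_ne_of_ne hik.symm hjk.symm,
      swap_apply_of_ne_of_ne hil.symm hjl.symm]
  have h2 : Commute (eOp (loopWeight A c) i j) (conjOp K (swap k l)) := by
    rw [commute_iff_eq, conjOp_eOp, swap_apply_of_ne_of_ne hik hil, swap_apply_of_ne_of_ne hjk hjl]
  have h3 : Commute (eOp (loopWeight A c) i j) (rOp A c k l v) :=
    (((Commute.one_right _).smul_right _).add_right (h2.smul_right _)).add_right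
      (((eOp_commute _ hij hkl hik hil hjk hjl).smul_right _).smul_right _)
  exact (((Commute.one_left _).smul_left _).add_left (h1.smul_left _)).add_left
      ((h3.smul_left _).smul_left _)

end RMatrix
end BrauerQKZ


namespace BrauerQKZ

open Equiv

/-! ### Adding an arc in front of a link pattern -/

namespace LinkPattern

variable {N : ℕ}

/-- The involution `0 ↔ 1`, `k + 2 ↦ π k + 2`. -/
def consArcFun (π : LinkPattern N) : Fin (N + 2) → Fin (N + 2) :=
  Fin.cases 1 (Fin.cases 0 fun k => (π.1 k).succ.succ)

theorem consArcFun_involutive (π : LinkPattern N) : Function.Involutive (consArcFun π) := by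
  intro k
  refine Fin.cases rfl (fun k => ?_) k
  refine Fin.cases rfl (fun k => ?_) k
  simp [consArcFun, π.2.1]

/-- The link pattern `π` moved two places to the right, with an arc added in front. -/
def consArc (π : LinkPattern N) : LinkPattern (N + 2) :=
  ⟨(consArcFun_involutive π).toPerm, consArcFun_involutive π, fun k => by
    change consArcFun π k ≠ k
    refine Fin.cases ?_ (fun k => ?_) k
    · simp [consArcFun]
    refine Fin.cases ?_ (fun k => ?_) k
    · exact (zero_ne_one : (0 : Fin (N + 2)) ≠ 1)
    · simp [consArcFun, π.2.2]⟩

theorem consArc_zero (π : LinkPattern N) : (consArc π).1 0 = 1 := rfl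

theorem consArc_one (π : LinkPattern N) : (consArc π).1 1 = 0 := rfl

theorem consArc_succ_succ (π : LinkPattern N) (k : Fin N) :
    (consArc π).1 k.succ.succ = (π.1 k).succ.succ := rfl

end LinkPattern

/-- The extension of a permutation that fixes two new points in front. -/
def liftPerm {N : ℕ} (s : Perm (Fin N)) : Perm (Fin (N + 2)) where
  toFun := Fin.cases 0 (Fin.cases 1 fun k => (s k).succ.succ)
  invFun := Fin.cases 0 (Fin.cases 1 fun k => (s⁻¹ k).succ.succ)
  left_inv k := by
    refine Fin.cases rfl (fun k => ?_) k
    refine Fin.cases rfl (fun k => ?_) k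
    simp
  right_inv k := by
    refine Fin.cases rfl (fun k => ?_) k
    refine Fin.cases rfl (fun k => ?_) k
    simp

section LiftPerm

variable {N : ℕ}

theorem liftPerm_zero (s : Perm (Fin N)) : liftPerm s 0 = 0 := rfl

theorem liftPerm_one (s : Perm (Fin N)) : liftPerm s 1 = 1 := rfl

theorem liftPerm_succ_succ (s : Perm (Fin N)) (k : Fin N) :
    liftPerm s k.succ.succ = (s k).succ.succ := rfl

theorem forall_fin_add_two {P : Fin (N + 2) → Prop} (h0 : P 0) (h1 : P 1)
    (h2 : ∀ k : Fin N, P k.succ.succ) (k : Fin (N + 2)) : P k := by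
  refine Fin.cases h0 (fun k => ?_) k
  exact Fin.cases h1 h2 k

theorem liftPerm_swap (i j : Fin N) : liftPerm (swap i j) = swap i.succ.succ j.succ.succ := by
  apply Equiv.ext
  apply forall_fin_add_two
  · rw [liftPerm_zero, swap_apply_of_ne_of_ne] <;> simp [Fin.ext_iff]
  · rw [liftPerm_one, swap_apply_of_ne_of_ne] <;> simp [Fin.ext_iff]
  · intro k
    rw [liftPerm_succ_succ, swap_apply_def, swap_apply_def]
    simp only [Fin.succ_inj]
    split_ifs <;> rfl

theorem conj_liftPerm_consArc (s : Perm (Fin N)) (π : LinkPattern N) :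
    LinkPattern.conj (liftPerm s) π.consArc = (LinkPattern.conj s π).consArc := by
  apply LinkPattern.ext_apply
  intro k
  obtain ⟨k, rfl⟩ := (liftPerm s).surjective k
  rw [LinkPattern.conj_apply_apply]
  refine forall_fin_add_two (P := fun k => liftPerm s (π.consArc.1 k) =
    ((LinkPattern.conj s π).consArc).1 (liftPerm s k)) rfl rfl (fun k => ?_) k
  rw [liftPerm_succ_succ, LinkPattern.consArc_succ_succ, LinkPattern.consArc_succ_succ,
    LinkPattern.conj_apply_apply, liftPerm_succ_succ]

theorem join_consArc (i j : Fin N) (π : LinkPattern N) :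
    π.consArc.join i.succ.succ j.succ.succ = (π.join i j).consArc := by
  unfold LinkPattern.join
  rw [LinkPattern.consArc_succ_succ, ← liftPerm_swap, conj_liftPerm_consArc]

theorem conj_swap_consArc (π : LinkPattern N) :
    LinkPattern.conj (swap 0 1) π.consArc = π.consArc :=
  LinkPattern.conj_swap_of_apply rfl

end LiftPerm

/-! ### The arc operator and crossing symmetry -/

section Arc

variable {N : ℕ} {K : Type} [Field K]

/-- Adding an arc in front, extended linearly. -/
noncomputable def arcOp (K : Type) [Field K] (N : ℕ) :
    (LinkPattern N →₀ K) →ₗ[K] (LinkPattern (N + 2) →₀ K) :=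
  Finsupp.lmapDomain K K LinkPattern.consArc

theorem arcOp_single (π : LinkPattern N) (x : K) :
    arcOp K N (Finsupp.single π x) = Finsupp.single π.consArc x := by
  simp [arcOp]

theorem consArc_injective : Function.Injective (LinkPattern.consArc (N := N)) := by
  intro π σ h
  apply LinkPattern.ext_apply
  intro k
  have : (π.consArc).1 k.succ.succ = (σ.consArc).1 k.succ.succ := by rw [h]
  rw [LinkPattern.consArc_succ_succ, LinkPattern.consArc_succ_succ] at this
  exact Fin.succ_injective _ (Fin.succ_injective _ this)

theorem arcOp_injective : Function.Injective (arcOp K N) :=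
  Finsupp.mapDomain_injective consArc_injective

theorem conjOp_liftPerm_arcOp (s : Perm (Fin N)) (x : LinkPattern N →₀ K) :
    conjOp K (liftPerm s) (arcOp K N x) = arcOp K N (conjOp K s x) := by
  induction x using Finsupp.induction_linear with
  | zero => simp
  | add x y hx hy => simp only [map_add, hx, hy]
  | single π x =>
    rw [arcOp_single, conjOp_single, conjOp_single, arcOp_single, conj_liftPerm_consArc]

theorem conjOp_swap_arcOp (x : LinkPattern N →₀ K) :
    conjOp K (swap 0 1) (arcOp K N x) = arcOp K N x := by
  induction x using Finsupp.induction_linear with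
  | zero => simp
  | add x y hx hy => simp only [map_add, hx, hy]
  | single π x => rw [arcOp_single, conjOp_single, conj_swap_consArc]

theorem eOp_arcOp (β : K) (i j : Fin N) (x : LinkPattern N →₀ K) :
    eOp β i.succ.succ j.succ.succ (arcOp K N x) = arcOp K N (eOp β i j x) := by
  induction x using Finsupp.induction_linear with
  | zero => simp
  | add x y hx hy => simp only [map_add, hx, hy]
  | single π x =>
    rw [arcOp_single, eOp_single, eOp_single, arcOp_single, join_consArc,
      LinkPattern.consArc_succ_succ]
    simp only [Fin.succ_inj]

theorem rOp_apply (A c : K) (i j : Fin N) (u : K) (x : LinkPattern N →₀ K) :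
    rOp A c i j u x = (c * (A - u)) • x + (u * (A - u)) • conjOp K (swap i j) x +
      (u * c) • eOp (loopWeight A c) i j x := by
  simp [rOp, smul_smul]

theorem rOp_arcOp (A c : K) (i j : Fin N) (u : K) (x : LinkPattern N →₀ K) :
    rOp A c i.succ.succ j.succ.succ u (arcOp K N x) = arcOp K N (rOp A c i j u x) := by
  rw [rOp_apply, rOp_apply, eOp_arcOp, ← liftPerm_swap, conjOp_liftPerm_arcOp]
  simp only [map_add, map_smul]

/-- Crossing symmetry. Both sides are combinations of the same three patterns: σ and its conjugates
by (j k) and (i k). The identity term on one side is the e-term on the other, so their coefficients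
are interchanged by u ↦ A − u, while that of the f-term, u (A − u), is invariant. -/
theorem rOp_crossing_single (A c : K) {i j k : Fin N} (hik : i ≠ k) (hjk : j ≠ k)
    {σ : LinkPattern N} (h : σ.1 i = j) (u x : K) :
    rOp A c i j u (Finsupp.single (LinkPattern.conj (swap i j * swap j k) σ) x) =
      rOp A c j k (A - u) (Finsupp.single σ x) := by
  have hij : i ≠ j := fun e => σ.2.2 i (h.trans e.symm)
  have hs : LinkPattern.conj (swap i j) σ = σ := LinkPattern.conj_swap_of_apply h
  have hk : (LinkPattern.conj (swap i j * swap j k) σ).1 k = j := by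
    have := LinkPattern.conj_apply_apply (swap i j * swap j k) σ j
    rw [σ.apply_eq_iff.1 h] at this
    simpa [swap_apply_of_ne_of_ne hik.symm hjk.symm, swap_apply_of_ne_of_ne hij hik] using this
  rw [rOp_apply, rOp_apply, eOp_single_of_apply _ hik h, eOp_comm _ hij,
    eOp_single_of_apply _ hik.symm hk]
  simp only [conjOp_single, LinkPattern.conj_conj]
  have e1 : swap i j * (swap i j * swap j k) = swap j k := by
    rw [← mul_assoc, swap_mul_self, one_mul]
  have e2 : swap k i * (swap i j * swap j k) = swap i j := by
    rw [swap_comm k i, ← swap_braid hik hjk, mul_assoc, mul_assoc, e1, swap_mul_self, mul_one]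
  have e3 : LinkPattern.conj (swap i k) σ = LinkPattern.conj (swap i j * swap j k) σ := by
    rw [← swap_braid hik hjk, ← LinkPattern.conj_conj _ (swap i j), hs]
  rw [e1, e2, e3, hs]
  module

theorem rOp_crossing (A c : K) {i j k : Fin (N + 2)} (hik : i ≠ k) (hjk : j ≠ k)
    {s : Perm (Fin (N + 2))} (h0 : s 0 = i) (h1 : s 1 = j) (u : K) (x : LinkPattern N →₀ K) :
    rOp A c i j u (conjOp K (swap i j * swap j k * s) (arcOp K N x)) =
      rOp A c j k (A - u) (conjOp K s (arcOp K N x)) := by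
  induction x using Finsupp.induction_linear with
  | zero => simp
  | add x y hx hy => simp only [map_add, hx, hy]
  | single π x =>
    rw [arcOp_single, conjOp_single, conjOp_single, ← LinkPattern.conj_conj]
    apply rOp_crossing_single A c hik hjk
    rw [← h0, LinkPattern.conj_apply_apply, LinkPattern.consArc_zero, h1]

end Arc
end BrauerQKZ


namespace BrauerQKZ

open MvPolynomial

/-! ### Polynomial functions with degree bounds in each variable -/

section PolynomialFunctions

variable {σ τ K : Type*} [Field K]

/-- The function is given by a polynomial whose degree in the variable `k` is at most `d k`. -/
def HasDeg (f : (σ → K) → K) (d : σ → ℕ) : Prop :=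
  ∃ p : MvPolynomial σ K, (∀ z, f z = eval z p) ∧ ∀ k, p.degreeOf k ≤ d k

/-- The function is given by a polynomial. -/
def IsPoly (f : (σ → K) → K) : Prop := ∃ p : MvPolynomial σ K, ∀ z, f z = eval z p

theorem HasDeg.isPoly {f : (σ → K) → K} {d : σ → ℕ} (h : HasDeg f d) : IsPoly f :=
  ⟨h.choose, h.choose_spec.1⟩

theorem HasDeg.mono {f : (σ → K) → K} {d d' : σ → ℕ} (h : HasDeg f d) (hd : ∀ k, d k ≤ d' k) :
    HasDeg f d' := by
  obtain ⟨p, hp, hk⟩ := h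
  exact ⟨p, hp, fun k => (hk k).trans (hd k)⟩

theorem HasDeg.const (a : K) (d : σ → ℕ) : HasDeg (fun _ => a) d :=
  ⟨C a, fun z => by simp, fun k => by simp⟩

theorem HasDeg.proj [DecidableEq σ] (i : σ) : HasDeg (fun z : σ → K => z i) (Pi.single i 1) :=
  ⟨X i, fun z => by simp, fun k => by
    classical
    rw [degreeOf_X, Pi.single_apply]⟩

theorem HasDeg.add {f g : (σ → K) → K} {d : σ → ℕ} (hf : HasDeg f d) (hg : HasDeg g d) :
    HasDeg (fun z => f z + g z) d := by
  obtain ⟨p, hp, hk⟩ := hf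
  obtain ⟨q, hq, hl⟩ := hg
  exact ⟨p + q, fun z => by simp only [hp, hq, map_add], fun k =>
    (degreeOf_add_le k p q).trans (max_le (hk k) (hl k))⟩

theorem HasDeg.sub {f g : (σ → K) → K} {d : σ → ℕ} (hf : HasDeg f d) (hg : HasDeg g d) :
    HasDeg (fun z => f z - g z) d := by
  obtain ⟨p, hp, hk⟩ := hf
  obtain ⟨q, hq, hl⟩ := hg
  exact ⟨p - q, fun z => by simp only [hp, hq, map_sub], fun k =>
    (degreeOf_sub_le k p q).trans (max_le (hk k) (hl k))⟩

theorem HasDeg.mul {f g : (σ → K) → K} {d d' : σ → ℕ} (hf : HasDeg f d) (hg : HasDeg g d') :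
    HasDeg (fun z => f z * g z) (d + d') := by
  obtain ⟨p, hp, hk⟩ := hf
  obtain ⟨q, hq, hl⟩ := hg
  exact ⟨p * q, fun z => by simp only [hp, hq, map_mul], fun k =>
    (degreeOf_mul_le k p q).trans (add_le_add (hk k) (hl k))⟩

theorem HasDeg.sum {ι : Type*} {s : Finset ι} {f : ι → (σ → K) → K} {d : σ → ℕ}
    (h : ∀ i ∈ s, HasDeg (f i) d) : HasDeg (fun z => ∑ i ∈ s, f i z) d := by
  classical
  induction s using Finset.induction_on with
  | empty => simpa using HasDeg.const 0 d
  | insert a s ha ih =>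
    simp only [Finset.sum_insert ha]
    exact (h a (by simp)).add (ih fun i hi => h i (by simp [hi]))

theorem HasDeg.prod {ι : Type*} {s : Finset ι} {f : ι → (σ → K) → K} {d : ι → σ → ℕ}
    (h : ∀ i ∈ s, HasDeg (f i) (d i)) : HasDeg (fun z => ∏ i ∈ s, f i z) (∑ i ∈ s, d i) := by
  classical
  induction s using Finset.induction_on with
  | empty => simpa using HasDeg.const 1 _
  | insert a s ha ih =>
    simp only [Finset.prod_insert ha, Finset.sum_insert ha]
    exact (h a (by simp)).mul (ih fun i hi => h i (by simp [hi]))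

theorem HasDeg.comp_injective {f : (τ → K) → K} {d : τ → ℕ} (hf : HasDeg f d) {e : τ → σ}
    (he : Function.Injective e) {d' : σ → ℕ} (hd : ∀ k, d k ≤ d' (e k)) :
    HasDeg (fun z : σ → K => f (fun k => z (e k))) d' := by
  classical
  obtain ⟨p, hp, hk⟩ := hf
  refine ⟨rename e p, fun z => by simp only [hp, eval_rename]; rfl, fun k => ?_⟩
  by_cases h : ∃ j, e j = k
  · obtain ⟨j, rfl⟩ := h
    rw [degreeOf_rename_of_injective he]
    exact (hk j).trans (hd j)
  · have : degreeOf k (rename e p) = 0 := by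
      by_contra h0
      have h1 := mem_vars_iff_degreeOf_ne_zero.2 h0
      obtain ⟨j, -, hj⟩ := Finset.mem_image.1 (vars_rename e p h1)
      exact h ⟨j, hj⟩
    omega

theorem IsPoly.const (a : K) : IsPoly (fun _ : σ → K => a) := ⟨C a, fun z => by simp⟩

theorem IsPoly.proj (i : σ) : IsPoly (fun z : σ → K => z i) := ⟨X i, fun z => by simp⟩

theorem IsPoly.add {f g : (σ → K) → K} (hf : IsPoly f) (hg : IsPoly g) :
    IsPoly (fun z => f z + g z) := by
  obtain ⟨p, hp⟩ := hf
  obtain ⟨q, hq⟩ := hg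
  exact ⟨p + q, fun z => by simp only [hp, hq, map_add]⟩

theorem IsPoly.sub {f g : (σ → K) → K} (hf : IsPoly f) (hg : IsPoly g) :
    IsPoly (fun z => f z - g z) := by
  obtain ⟨p, hp⟩ := hf
  obtain ⟨q, hq⟩ := hg
  exact ⟨p - q, fun z => by simp only [hp, hq, map_sub]⟩

theorem IsPoly.mul {f g : (σ → K) → K} (hf : IsPoly f) (hg : IsPoly g) :
    IsPoly (fun z => f z * g z) := by
  obtain ⟨p, hp⟩ := hf
  obtain ⟨q, hq⟩ := hg
  exact ⟨p * q, fun z => by simp only [hp, hq, map_mul]⟩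

theorem IsPoly.prod {ι : Type*} {s : Finset ι} {f : ι → (σ → K) → K}
    (h : ∀ i ∈ s, IsPoly (f i)) : IsPoly (fun z => ∏ i ∈ s, f i z) := by
  classical
  induction s using Finset.induction_on with
  | empty => simpa using IsPoly.const 1
  | insert a s ha ih =>
    simp only [Finset.prod_insert ha]
    exact (h a (by simp)).mul (ih fun i hi => h i (by simp [hi]))

theorem IsPoly.sum {ι : Type*} {s : Finset ι} {f : ι → (σ → K) → K}
    (h : ∀ i ∈ s, IsPoly (f i)) : IsPoly (fun z => ∑ i ∈ s, f i z) := by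
  classical
  induction s using Finset.induction_on with
  | empty => simpa using IsPoly.const 0
  | insert a s ha ih =>
    simp only [Finset.sum_insert ha]
    exact (h a (by simp)).add (ih fun i hi => h i (by simp [hi]))

theorem IsPoly.comp {f : (τ → K) → K} (hf : IsPoly f) {φ : (σ → K) → τ → K}
    (hφ : ∀ k, IsPoly fun z => φ z k) : IsPoly (fun z => f (φ z)) := by
  obtain ⟨p, hp⟩ := hf
  choose q hq using hφ
  refine ⟨bind₁ q p, fun z => ?_⟩
  simp only at hq
  simp only [hp]
  rw [← coe_aeval_eq_eval, ← coe_aeval_eq_eval, RingHom.coe_coe, RingHom.coe_coe, aeval_bind₁]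
  congr 2
  funext k
  rw [hq, ← coe_aeval_eq_eval]
  rfl

theorem IsPoly.update [DecidableEq σ] {f : (σ → K) → K} (hf : IsPoly f) (k : σ)
    {t : (σ → K) → K} (ht : IsPoly t) : IsPoly (fun z => f (Function.update z k (t z))) := by
  refine hf.comp fun l => ?_
  rcases eq_or_ne l k with rfl | h
  · simpa using ht
  · simpa [Function.update_of_ne h] using IsPoly.proj l

theorem natDegree_aeval_update_le [DecidableEq σ] (p : MvPolynomial σ K) (z : σ → K) (k : σ) :
    (aeval (Function.update (fun i => Polynomial.C (z i)) k Polynomial.X) p).natDegree ≤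
      p.degreeOf k := by
  rw [p.as_sum, map_sum, ← p.as_sum]
  refine Polynomial.natDegree_sum_le_of_forall_le _ _ fun m hm => ?_
  rw [aeval_monomial]
  refine (Polynomial.natDegree_mul_le).trans ?_
  have h1 : (algebraMap K (Polynomial K) (coeff m p)).natDegree = 0 := Polynomial.natDegree_C _
  rw [h1, zero_add]
  refine le_trans ?_ (monomial_le_degreeOf k hm)
  refine (Polynomial.natDegree_prod_le _ _).trans ?_
  have h2 : ∀ i ∈ m.support, ((fun i e =>
      Function.update (fun i => Polynomial.C (z i)) k Polynomial.X i ^ e) i (m i)).natDegree ≤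
      if i = k then m k else 0 := by
    intro i _
    rcases eq_or_ne i k with rfl | h
    · simp
    · simp only [Function.update_of_ne h, if_neg h, ← Polynomial.C_pow, Polynomial.natDegree_C, le_refl]
  refine (Finset.sum_le_sum h2).trans ?_
  rw [Finset.sum_ite_eq']
  split_ifs <;> simp

/-- With the other variables frozen, this is a polynomial in one variable with more roots than its
degree. -/
theorem HasDeg.eq_zero_of_nodes [DecidableEq σ] {f : (σ → K) → K} {d : σ → ℕ} (hf : HasDeg f d)
    (z : σ → K) (k : σ) (S : Finset K) (hS : d k < S.card)
    (h : ∀ t ∈ S, f (Function.update z k t) = 0) : f z = 0 := by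
  obtain ⟨p, hp, hd⟩ := hf
  set q := aeval (Function.update (fun i => Polynomial.C (z i)) k Polynomial.X) p with hq
  have key : ∀ t, q.eval t = f (Function.update z k t) := by
    intro t
    rw [hp, hq, ← Polynomial.coe_evalRingHom, ← coe_aeval_eq_eval]
    have := MvPolynomial.map_aeval (Function.update (fun i => Polynomial.C (z i)) k Polynomial.X)
      (Polynomial.evalRingHom t) p
    rw [this, RingHom.coe_coe, aeval_def, coe_eval₂Hom]
    have e1 : (Polynomial.evalRingHom t).comp (algebraMap K (Polynomial K)) = algebraMap K K := by
      ext a; simp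
    rw [e1]
    congr 1
    funext i
    rcases eq_or_ne i k with rfl | h
    · simp
    · simp [Function.update_of_ne h]
  have h0 : q = 0 := by
    apply Polynomial.eq_zero_of_natDegree_lt_card_of_eval_eq_zero' q S
    · intro t ht
      rw [key, h t ht]
    · exact ((natDegree_aeval_update_le p z k).trans (hd k)).trans_lt hS
  have := key (z k)
  rw [h0, Polynomial.eval_zero, Function.update_eq_self] at this
  exact this.symm

/-- Multiplying by all forms z i − z j − δ gives a polynomial that vanishes everywhere, and none of
these forms is zero. Later identities can thus be checked at points where the scalars to be
cancelled are nonzero. -/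
theorem IsPoly.eq_zero_of_generic [Fintype σ] [DecidableEq σ] [Infinite K] {f : (σ → K) → K}
    (hf : IsPoly f) (S : Finset K)
    (h : ∀ z : σ → K, (∀ i j, i ≠ j → ∀ δ ∈ S, z i - z j ≠ δ) → f z = 0) (z : σ → K) :
    f z = 0 := by
  classical
  obtain ⟨p, hp⟩ := hf
  let I : Finset ((σ × σ) × K) := (Finset.univ.filter fun e : σ × σ => e.1 ≠ e.2) ×ˢ S
  let Q : MvPolynomial σ K := ∏ e ∈ I, (X e.1.1 - X e.1.2 - C e.2)
  have hQ : Q ≠ 0 := by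
    refine Finset.prod_ne_zero_iff.2 fun e he h0 => ?_
    have hne : e.1.1 ≠ e.1.2 := by simpa [I] using (Finset.mem_product.1 he).1
    have := congrArg (eval (Pi.single e.1.1 (e.2 + 1) : σ → K)) h0
    simp [hne.symm] at this
  have hpQ : p * Q = 0 := by
    apply MvPolynomial.funext
    intro z
    rw [map_mul, map_zero, mul_eq_zero]
    by_cases hz : ∀ i j, i ≠ j → ∀ δ ∈ S, z i - z j ≠ δ
    · left
      rw [← hp, h z hz]
    · right
      push Not at hz
      obtain ⟨i, j, hij, δ, hδ, e⟩ := hz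
      rw [map_prod]
      refine Finset.prod_eq_zero (i := ((i, j), δ)) ?_ ?_
      · simp [I, hij, hδ]
      · simp [e]
  rw [hp, (mul_eq_zero.1 hpQ).resolve_right hQ, map_zero]

end PolynomialFunctions

/-! ### Divisibility by linear polynomials -/

section LinearPrimes

variable {σ R : Type*} [CommRing R] [DecidableEq σ]

/-- The hypothesis `hq` holds when q does not involve X a. Modulo X a − q every polynomial is
congruent to its value under X a ↦ q; no field is needed, so this applies over ℤ. -/
theorem X_sub_dvd_iff {a : σ} {q : MvPolynomial σ R}
    (hq : aeval (Function.update X a q) q = q) (p : MvPolynomial σ R) :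
    X a - q ∣ p ↔ aeval (Function.update X a q) p = 0 := by
  constructor
  · rintro ⟨r, rfl⟩
    rw [map_mul, map_sub, aeval_X, Function.update_self, hq, sub_self, zero_mul]
  · intro h
    have key : ∀ p, X a - q ∣ p - aeval (Function.update X a q) p := by
      intro p
      induction p using MvPolynomial.induction_on with
      | C r => simp
      | add p r hp hr =>
        rw [map_add, add_sub_add_comm]
        exact dvd_add hp hr
      | mul_X p i hp =>
        rw [map_mul, aeval_X]
        have : p * X i - aeval (Function.update X a q) p * Function.update X a q i =
          (p - aeval (Function.update X a q) p) * X i +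
            aeval (Function.update X a q) p * (X i - Function.update X a q i) := by ring
        rw [this]
        refine dvd_add (hp.mul_right _) (Dvd.dvd.mul_left ?_ _)
        rcases eq_or_ne i a with rfl | hi
        · simp
        · simp [Function.update_of_ne hi]
    have := key p
    rwa [h, sub_zero] at this

theorem prime_X_sub [IsDomain R] {a : σ} {q : MvPolynomial σ R}
    (hq : aeval (Function.update X a q) q = q) (hne : X a ≠ q) : Prime (X a - q) := by
  refine ⟨sub_ne_zero.2 hne, fun hu => ?_, fun p r h => ?_⟩
  · have := (X_sub_dvd_iff hq 1).1 hu.dvd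
    rw [map_one] at this
    exact one_ne_zero this
  · rw [X_sub_dvd_iff hq, map_mul, mul_eq_zero] at h
    rwa [X_sub_dvd_iff hq, X_sub_dvd_iff hq]

end LinearPrimes

/-- A new prime that divides p divides none of the previous factors, hence divides the cofactor. -/
theorem prod_dvd_of_prime {ι R : Type*} [CommRing R] [IsDomain R] {s : Finset ι} {ℓ : ι → R}
    (hℓ : ∀ i ∈ s, Prime (ℓ i)) (hne : ∀ i ∈ s, ∀ j ∈ s, i ≠ j → ¬ ℓ i ∣ ℓ j) {p : R}
    (hp : ∀ i ∈ s, ℓ i ∣ p) : ∏ i ∈ s, ℓ i ∣ p := by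
  classical
  induction s using Finset.induction_on with
  | empty => simp
  | insert a s ha ih =>
    rw [Finset.prod_insert ha]
    obtain ⟨r, rfl⟩ := ih (fun i hi => hℓ i (by simp [hi]))
      (fun i hi j hj => hne i (by simp [hi]) j (by simp [hj])) (fun i hi => hp i (by simp [hi]))
    have h1 := hℓ a (by simp)
    rcases h1.dvd_or_dvd (hp a (by simp)) with h | h
    · obtain ⟨j, hj, hd⟩ := (h1.dvd_finsetProd_iff _).1 h
      exact absurd hd (hne a (by simp) j (by simp [hj]) (fun e => ha (e ▸ hj)))
    · rw [mul_comm]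
      exact mul_dvd_mul_left _ h

end BrauerQKZ


namespace BrauerQKZ

open Equiv MvPolynomial

instance (N : ℕ) : Finite (LinkPattern N) :=
  inferInstanceAs (Finite {π : Perm (Fin N) // (∀ k, π (π k) = k) ∧ ∀ k, π k ≠ k})

/-! ### Polynomial functions with values in the span of link patterns -/

section VectorFunctions

variable {σ τ : Type*} {N M : ℕ} {K : Type} [Field K]

/-- All components are polynomials of degree at most `d k` in the variable `k`. -/
def VDeg (F : (σ → K) → LinkPattern N →₀ K) (d : σ → ℕ) : Prop :=
  ∀ π, HasDeg (fun z => F z π) d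

/-- All components are polynomials. -/
def VPoly (F : (σ → K) → LinkPattern N →₀ K) : Prop := ∀ π, IsPoly (fun z => F z π)

theorem VDeg.vPoly {F : (σ → K) → LinkPattern N →₀ K} {d : σ → ℕ} (h : VDeg F d) : VPoly F :=
  fun π => (h π).isPoly

theorem VDeg.mono {F : (σ → K) → LinkPattern N →₀ K} {d d' : σ → ℕ} (h : VDeg F d)
    (hd : ∀ k, d k ≤ d' k) : VDeg F d' := fun π => (h π).mono hd

theorem VDeg.add {F G : (σ → K) → LinkPattern N →₀ K} {d : σ → ℕ} (hF : VDeg F d)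
    (hG : VDeg G d) : VDeg (fun z => F z + G z) d := fun π => (hF π).add (hG π)

theorem VPoly.add {F G : (σ → K) → LinkPattern N →₀ K} (hF : VPoly F)
    (hG : VPoly G) : VPoly (fun z => F z + G z) := fun π => (hF π).add (hG π)

theorem VPoly.smul {f : (σ → K) → K} {F : (σ → K) → LinkPattern N →₀ K} (hf : IsPoly f)
    (hF : VPoly F) : VPoly (fun z => f z • F z) := fun π => hf.mul (hF π)

theorem VDeg.smul {f : (σ → K) → K} {F : (σ → K) → LinkPattern N →₀ K} {d d' : σ → ℕ}
    (hf : HasDeg f d) (hF : VDeg F d') : VDeg (fun z => f z • F z) (d + d') :=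
  fun π => hf.mul (hF π)

theorem apply_eq_sum (T : (LinkPattern N →₀ K) →ₗ[K] (LinkPattern M →₀ K))
    (x : LinkPattern N →₀ K) (π : LinkPattern M) [Fintype (LinkPattern N)] :
    T x π = ∑ ρ, x ρ * T (Finsupp.single ρ 1) π := by
  conv_lhs => rw [← Finsupp.univ_sum_single x]
  rw [map_sum, Finsupp.finsetSum_apply]
  refine Finset.sum_congr rfl fun ρ _ => ?_
  rw [← smul_eq_mul, ← Finsupp.smul_apply, ← map_smul, Finsupp.smul_single, smul_eq_mul, mul_one]

theorem VDeg.map {F : (σ → K) → LinkPattern N →₀ K} {d : σ → ℕ} (hF : VDeg F d)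
    (T : (LinkPattern N →₀ K) →ₗ[K] (LinkPattern M →₀ K)) : VDeg (fun z => T (F z)) d := by
  intro π
  have := Fintype.ofFinite (LinkPattern N)
  simp only [fun z => apply_eq_sum T (F z) π]
  refine HasDeg.sum fun ρ _ => ?_
  have := (hF ρ).mul (HasDeg.const (T (Finsupp.single ρ 1) π) 0)
  simpa using this

theorem VPoly.map {F : (σ → K) → LinkPattern N →₀ K} (hF : VPoly F)
    (T : (LinkPattern N →₀ K) →ₗ[K] (LinkPattern M →₀ K)) : VPoly (fun z => T (F z)) := by
  intro π
  have := Fintype.ofFinite (LinkPattern N)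
  simp only [fun z => apply_eq_sum T (F z) π]
  exact IsPoly.sum fun ρ _ => (hF ρ).mul (IsPoly.const _)

theorem VPoly.rOp {F : (σ → K) → LinkPattern N →₀ K} (hF : VPoly F) (A c : K) (i j : Fin N)
    {u : (σ → K) → K} (hu : IsPoly u) : VPoly (fun z => rOp A c i j (u z) (F z)) := by
  simp only [rOp_apply]
  exact ((VPoly.smul ((IsPoly.const _).mul ((IsPoly.const _).sub hu)) hF).add
    (VPoly.smul (hu.mul ((IsPoly.const _).sub hu)) (hF.map _))).add
    (VPoly.smul (hu.mul (IsPoly.const _)) (hF.map _))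

theorem HasDeg.const_sub {u : (σ → K) → K} {d : σ → ℕ} (hu : HasDeg u d) (a : K) :
    HasDeg (fun z => a - u z) d := (HasDeg.const a d).sub hu

theorem VDeg.rOp {F : (σ → K) → LinkPattern N →₀ K} {d d' : σ → ℕ} (hF : VDeg F d) (A c : K)
    (i j : Fin N) {u : (σ → K) → K} (hu : HasDeg u d') :
    VDeg (fun z => rOp A c i j (u z) (F z)) (d' + d' + d) := by
  simp only [rOp_apply]
  have h1 : HasDeg (fun z => c * (A - u z)) (d' + d') :=
    ((HasDeg.const c d').mul (hu.const_sub A))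
  exact ((VDeg.smul h1 hF).add (VDeg.smul (hu.mul (hu.const_sub A)) (hF.map _))).add
    (VDeg.smul (hu.mul (HasDeg.const c d')) (hF.map _))

theorem VDeg.comp_injective {F : (τ → K) → LinkPattern N →₀ K} {d : τ → ℕ} (hF : VDeg F d)
    {e : τ → σ} (he : Function.Injective e) {d' : σ → ℕ} (hd : ∀ k, d k ≤ d' (e k)) :
    VDeg (fun z : σ → K => F (fun k => z (e k))) d' :=
  fun π => (hF π).comp_injective he hd

theorem VPoly.comp {F : (τ → K) → LinkPattern N →₀ K} (hF : VPoly F) {φ : (σ → K) → τ → K}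
    (hφ : ∀ k, IsPoly fun z => φ z k) : VPoly (fun z => F (φ z)) := fun π => (hF π).comp hφ

theorem VPoly.update [DecidableEq σ] {F : (σ → K) → LinkPattern N →₀ K} (hF : VPoly F) (k : σ)
    {t : (σ → K) → K} (ht : IsPoly t) : VPoly (fun z => F (Function.update z k (t z))) :=
  fun π => (hF π).update k ht

theorem VPoly.eq_of_generic [Fintype σ] [DecidableEq σ] [Infinite K]
    {F G : (σ → K) → LinkPattern N →₀ K} (hF : VPoly F) (hG : VPoly G) (S : Finset K)
    (h : ∀ z : σ → K, (∀ i j, i ≠ j → ∀ δ ∈ S, z i - z j ≠ δ) → F z = G z) (z : σ → K) :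
    F z = G z := by
  ext π
  refine sub_eq_zero.1 (((hF π).sub (hG π)).eq_zero_of_generic S (fun z hz => ?_) z)
  rw [h z hz, sub_self]

theorem VDeg.eq_of_nodes [DecidableEq σ] {F G : (σ → K) → LinkPattern N →₀ K} {d : σ → ℕ}
    (hF : VDeg F d) (hG : VDeg G d) (z : σ → K) (k : σ) (S : Finset K) (hS : d k < S.card)
    (h : ∀ t ∈ S, F (Function.update z k t) = G (Function.update z k t)) : F z = G z := by
  ext π
  refine sub_eq_zero.1 (((hF π).sub (hG π)).eq_zero_of_nodes z k S hS fun t ht => ?_)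
  rw [h t ht, sub_self]

end VectorFunctions

theorem gFun_eq_zero {K : Type} [Field K] {A c u : K} : gFun A c u = 0 ↔ u = -A ∨ u = c := by
  unfold gFun
  rw [mul_eq_zero, sub_eq_zero, eq_comm (a := c), add_comm, add_eq_zero_iff_eq_neg]

theorem IsPoly.gFun {σ : Type*} {K : Type} [Field K] (A c : K) {u : (σ → K) → K} (hu : IsPoly u) :
    IsPoly (fun z => gFun A c (u z)) :=
  ((IsPoly.const A).add hu).mul ((IsPoly.const c).sub hu)

theorem HasDeg.gFun {σ : Type*} {K : Type} [Field K] (A c : K) {u : (σ → K) → K} {d : σ → ℕ}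
    (hu : HasDeg u d) : HasDeg (fun z => gFun A c (u z)) (d + d) :=
  ((HasDeg.const A d).add hu).mul ((HasDeg.const c d).sub hu)

/-! ### Exchange relations and the chain of R-matrices -/

section Exchange

variable {N : ℕ} {K : Type} [Field K]

/-- The exchange relation for the places `i` and `j`. -/
def Exch (A c : K) (F : (Fin N → K) → LinkPattern N →₀ K) (i j : Fin N) : Prop :=
  ∀ z, gFun A c (z i - z j) • F (z ∘ swap i j) = rOp A c i j (z i - z j) (F z)

/-- Equality of two solutions of an exchange relation is transported along the exchange. -/
theorem Exch.transport {A c : K} {F G : (Fin N → K) → LinkPattern N →₀ K} {i j : Fin N}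
    (hF : Exch A c F i j) (hG : Exch A c G i j) {z : Fin N → K} (h : F z = G z)
    (h1 : z i - z j ≠ -A) (h2 : z i - z j ≠ c) : F (z ∘ swap i j) = G (z ∘ swap i j) := by
  have h3 : gFun A c (z i - z j) ≠ 0 := by
    rw [Ne, gFun_eq_zero]
    tauto
  exact smul_right_injective _ h3 (by simp only [hF z, hG z, h])

/-- The vector obtained by joining the new place `0` with the place `n + 1`. -/
noncomputable def chain (A c : K) (Ψ : (Fin N → K) → LinkPattern N →₀ K) :
    ℕ → (Fin (N + 2) → K) → LinkPattern (N + 2) →₀ K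
  | 0, z => arcOp K N (Ψ fun k => z k.succ.succ)
  | n + 1, z =>
    if h : n + 2 < N + 2 then
      rOp A c ⟨n + 1, by omega⟩ ⟨n + 2, h⟩ (z ⟨n + 2, h⟩ - z ⟨n + 1, by omega⟩)
        (chain A c Ψ n (z ∘ swap ⟨n + 1, by omega⟩ ⟨n + 2, h⟩))
    else 0

variable {A c : K} {Ψ : (Fin N → K) → LinkPattern N →₀ K}

theorem chain_succ {n : ℕ} {a b : Fin (N + 2)} (ha : (a : ℕ) = n + 1) (hb : (b : ℕ) = n + 2)
    (z : Fin (N + 2) → K) :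
    chain A c Ψ (n + 1) z = rOp A c a b (z b - z a) (chain A c Ψ n (z ∘ swap a b)) := by
  have h : n + 2 < N + 2 := hb ▸ b.2
  obtain rfl : (⟨n + 1, Nat.lt_of_succ_lt h⟩ : Fin (N + 2)) = a := Fin.ext ha.symm
  obtain rfl : (⟨n + 2, h⟩ : Fin (N + 2)) = b := Fin.ext hb.symm
  rw [chain, dif_pos h]

theorem chain_succ_swap {n : ℕ} {a b : Fin (N + 2)} (ha : (a : ℕ) = n + 1) (hb : (b : ℕ) = n + 2)
    (z : Fin (N + 2) → K) :
    chain A c Ψ (n + 1) (z ∘ swap a b) = rOp A c a b (z a - z b) (chain A c Ψ n z) := by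
  rw [chain_succ ha hb]
  have : (z ∘ swap a b) ∘ swap a b = z := by funext k; simp
  rw [this]
  simp

/-- Exchanging backwards undoes the last R-matrix of the chain, by unitarity. -/
theorem rOp_chain_succ (hc : c ≠ 0) {n : ℕ} {a b : Fin (N + 2)} (ha : (a : ℕ) = n + 1)
    (hb : (b : ℕ) = n + 2) (z : Fin (N + 2) → K) :
    rOp A c a b (z a - z b) (chain A c Ψ (n + 1) z) =
      (gFun A c (z a - z b) * gFun A c (z b - z a)) • chain A c Ψ n (z ∘ swap a b) := by
  have hab : a ≠ b := fun e => by rw [e] at ha; omega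
  rw [chain_succ ha hb, ← neg_sub (z a) (z b), ← Module.End.mul_apply, rOp_unitarity hc hab]
  simp

theorem Exch.of_disjoint {F G : (Fin N → K) → LinkPattern N →₀ K} {i j a b : Fin N}
    (hF : Exch A c F i j) (hab : a ≠ b) (hij : i ≠ j) (hia : i ≠ a) (hib : i ≠ b) (hja : j ≠ a)
    (hjb : j ≠ b) (hG : ∀ z, G z = rOp A c a b (z b - z a) (F (z ∘ swap a b))) :
    Exch A c G i j := by
  intro z
  have e1 : (z ∘ swap i j) ∘ swap a b = (z ∘ swap a b) ∘ swap i j := by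
    funext k
    simp only [Function.comp_apply]
    congr 1
    rw [← Perm.mul_apply, ← Perm.mul_apply]
    congr 1
    rw [Equiv.mul_swap_eq_swap_mul, swap_apply_of_ne_of_ne hia.symm hja.symm,
      swap_apply_of_ne_of_ne hib.symm hjb.symm]
  have h := hF (z ∘ swap a b)
  simp only [Function.comp_apply, swap_apply_of_ne_of_ne hia hib,
    swap_apply_of_ne_of_ne hja hjb] at h
  rw [hG, hG, e1]
  simp only [Function.comp_apply, swap_apply_of_ne_of_ne hia.symm hja.symm,
    swap_apply_of_ne_of_ne hib.symm hjb.symm]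
  rw [← map_smul, h, ← Module.End.mul_apply, ← Module.End.mul_apply,
    (rOp_commute A c hab hij hia.symm hja.symm hib.symm hjb.symm _ _).eq]

/-- The R-matrices of the chain do not reach the places beyond the arc, where only the relations of
Ψ matter. -/
theorem chain_exch_right (hΨ : ∀ i j : Fin N, (i : ℕ) + 1 = j → Exch A c Ψ i j) (n : ℕ)
    (i j : Fin (N + 2)) (hij : (i : ℕ) + 1 = j) (hi : n + 1 < (i : ℕ)) :
    Exch A c (chain A c Ψ n) i j := by
  induction n with
  | zero =>
    obtain ⟨i, rfl⟩ : ∃ i' : Fin N, i = i'.succ.succ :=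
      ⟨⟨i - 2, by omega⟩, Fin.ext (by simp; omega)⟩
    obtain ⟨j, rfl⟩ : ∃ j' : Fin N, j = j'.succ.succ :=
      ⟨⟨j - 2, by omega⟩, Fin.ext (by simp; omega)⟩
    intro z
    have h := hΨ i j (by simpa using hij) (fun k => z k.succ.succ)
    simp only [chain]
    rw [rOp_arcOp, ← h, map_smul]
    congr 3
    funext k
    simp only [Function.comp_apply, ← liftPerm_swap, liftPerm_succ_succ]
  | succ n ih =>
    refine (ih (by omega)).of_disjoint (a := ⟨n + 1, by omega⟩) (b := ⟨n + 2, by omega⟩)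
      ?_ ?_ ?_ ?_ ?_ ?_ (fun z => chain_succ rfl rfl z) <;>
    simp only [ne_eq, Fin.ext_iff] <;> omega

/-- For the places under the arc, Yang–Baxter carries R_ij through the last two R-matrices of the
chain and turns it into R_jb acting beyond the shorter chain, where `chain_exch_right` applies.
Further R-matrices of the chain act on disjoint places. -/
theorem chain_exch_left (hc : c ≠ 0) (hΨ : ∀ i j : Fin N, (i : ℕ) + 1 = j → Exch A c Ψ i j)
    (n : ℕ) (hn : n < N + 1) (i j : Fin (N + 2)) (hij : (i : ℕ) + 1 = j) (hi : 1 ≤ (i : ℕ))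
    (hj : (j : ℕ) ≤ n) : Exch A c (chain A c Ψ n) i j := by
  induction n with
  | zero => omega
  | succ n ih =>
    rcases Nat.lt_or_ge n j with h | h
    · obtain ⟨m, rfl⟩ : ∃ m, n = m + 1 := ⟨n - 1, by omega⟩
      obtain ⟨b, hb⟩ : ∃ b : Fin (N + 2), (b : ℕ) = m + 3 := ⟨⟨m + 3, by omega⟩, rfl⟩
      have hi' : (i : ℕ) = m + 1 := by omega
      have hj' : (j : ℕ) = m + 2 := by omega
      have hne1 : i ≠ j := by simp only [ne_eq, Fin.ext_iff]; omega
      have hne2 : i ≠ b := by simp only [ne_eq, Fin.ext_iff]; omega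
      have hne3 : j ≠ b := by simp only [ne_eq, Fin.ext_iff]; omega
      have hx := chain_exch_right hΨ m j b (by omega) (by omega)
      intro z
      have hw := hx ((z ∘ swap j b) ∘ swap i j)
      rw [chain_succ (n := m + 1) hj' hb, chain_succ hi' hj', chain_succ (n := m + 1) hj' hb,
        chain_succ hi' hj']
      have e1 : ((z ∘ swap i j) ∘ swap j b) ∘ swap i j =
          ((z ∘ swap j b) ∘ swap i j) ∘ swap j b := by
        funext k
        simp only [Function.comp_apply]
        congr 1
        rw [← Perm.mul_apply, ← Perm.mul_apply, ← Perm.mul_apply, ← Perm.mul_apply,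
          swap_braid hne2 hne3, swap_comm j b, swap_comm i j,
          swap_braid hne2.symm hne1.symm, swap_comm]
      simp only [Function.comp_apply, swap_apply_left, swap_apply_right,
        swap_apply_of_ne_of_ne hne2.symm hne3.symm, swap_apply_of_ne_of_ne hne1 hne2] at hw ⊢
      rw [e1, ← map_smul, ← map_smul, hw]
      have := congrArg (fun T => T (chain A c Ψ m ((z ∘ swap j b) ∘ swap i j)))
        (rOp_yangBaxter (A := A) hc hne1 hne2 hne3 (z i - z j) (z b - z i))
      simp only [Module.End.mul_apply] at this
      have e2 : z i - z j + (z b - z i) = z b - z j := by ring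
      rw [e2] at this
      exact this.symm
    · refine (ih (by omega) h).of_disjoint (a := ⟨n + 1, by omega⟩) (b := ⟨n + 2, by omega⟩)
        ?_ ?_ ?_ ?_ ?_ ?_ (fun z => chain_succ rfl rfl z) <;>
      simp only [ne_eq, Fin.ext_iff] <;> omega

end Exchange
end BrauerQKZ


namespace BrauerQKZ

open Equiv MvPolynomial

/-! ### The Vandermonde product in the variables after the first -/

section Vandermonde

variable {N : ℕ} {K : Type} [Field K]

/-- The increasing pairs. -/
def incPairs (n : ℕ) : Finset (Fin n × Fin n) := Finset.univ.filter fun e => e.1 < e.2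

theorem mem_incPairs {n : ℕ} {e : Fin n × Fin n} : e ∈ incPairs n ↔ e.1 < e.2 := by
  simp [incPairs]

/-- The Vandermonde product in all variables but the first. -/
noncomputable def vand (K : Type) [Field K] (N : ℕ) : MvPolynomial (Fin (N + 2)) K :=
  ∏ e ∈ incPairs (N + 1), (X e.1.succ - X e.2.succ)

/-- The complementary factor of `∏ k ≠ j, (X j - X k)` in the Vandermonde product. -/
noncomputable def vandCof (K : Type) [Field K] (N : ℕ) (j : Fin (N + 1)) :
    MvPolynomial (Fin (N + 2)) K :=
  (∏ k ∈ Finset.univ.erase j, if k < j then -1 else 1) *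
    ∏ e ∈ (incPairs (N + 1)).filter fun e => e.1 ≠ j ∧ e.2 ≠ j, (X e.1.succ - X e.2.succ)

/-- Each pair containing j gives one factor on either side, up to orientation; the signs in
`vandCof` correct for k < j. -/
theorem vand_eq (j : Fin (N + 1)) : vand K N =
    vandCof K N j * ∏ k ∈ Finset.univ.erase j, (X j.succ - X k.succ) := by
  unfold vand vandCof
  rw [← Finset.prod_filter_mul_prod_filter_not _ (fun e => e.1 ≠ j ∧ e.2 ≠ j), mul_right_comm,
    mul_comm, ← Finset.prod_mul_distrib]
  congr 1
  symm
  refine Finset.prod_bij (fun k _ => if k < j then (k, j) else (j, k)) ?_ ?_ ?_ ?_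
  · intro k hk
    have hk := Finset.ne_of_mem_erase hk
    split_ifs with h
    · simp [mem_incPairs, h]
    · simp [mem_incPairs, lt_of_le_of_ne (not_lt.1 h) hk.symm]
  · intro k hk l hl h
    have hk := Finset.ne_of_mem_erase hk
    have hl := Finset.ne_of_mem_erase hl
    split_ifs at h <;> simp_all
  · rintro ⟨k, l⟩ he
    simp only [Finset.mem_filter, mem_incPairs] at he
    obtain ⟨h1, h2⟩ := he
    by_cases h : k = j
    · subst h
      exact ⟨l, by simp [h1.ne'], by simp [h1.le]⟩
    · have : l = j := by tauto
      subst this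
      exact ⟨k, by simp [h], by simp [h1]⟩
  · intro k hk
    split_ifs with h <;> ring

theorem degreeOf_X_sub_X {σ : Type*} {a b : σ} (hab : a ≠ b) :
    degreeOf a (X a - X b : MvPolynomial σ K) = 1 := by
  rw [sub_eq_add_neg, degreeOf_add_eq_of_degreeOf_lt]
  · simp
  · rw [degreeOf_neg, degreeOf_X_of_ne hab]
    simp

theorem degreeOf_X_sub_X_of_ne {σ : Type*} {a b k : σ} (ha : k ≠ a) (hb : k ≠ b) :
    degreeOf k (X a - X b : MvPolynomial σ K) = 0 := by
  have := degreeOf_sub_le k (X a : MvPolynomial σ K) (X b)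
  rw [degreeOf_X_of_ne ha, degreeOf_X_of_ne hb] at this
  simpa using this

theorem X_sub_X_ne_zero {σ : Type*} {a b : σ} (hab : a ≠ b) :
    (X a - X b : MvPolynomial σ K) ≠ 0 := by
  intro h
  have := degreeOf_X_sub_X (K := K) hab
  rw [h, degreeOf_zero] at this
  omega

theorem vand_ne_zero : vand K N ≠ 0 := by
  refine Finset.prod_ne_zero_iff.2 fun e he => X_sub_X_ne_zero ?_
  rw [mem_incPairs] at he
  simpa using he.ne

theorem vandCof_ne_zero (j : Fin (N + 1)) : vandCof K N j ≠ 0 := by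
  intro h
  have := vand_ne_zero (K := K) (N := N)
  rw [vand_eq j, h, zero_mul] at this
  exact this rfl

theorem nodeProd_ne_zero (j : Fin (N + 1)) :
    (∏ k ∈ Finset.univ.erase j, (X j.succ - X k.succ) : MvPolynomial (Fin (N + 2)) K) ≠ 0 := by
  refine Finset.prod_ne_zero_iff.2 fun k hk => X_sub_X_ne_zero ?_
  simpa using (Finset.ne_of_mem_erase hk).symm

theorem degreeOf_vandCof_of_forall (j : Fin (N + 1)) (p : Fin (N + 2))
    (h : ∀ e : Fin (N + 1) × Fin (N + 1), e.1 ≠ j → e.2 ≠ j → p ≠ e.1.succ ∧ p ≠ e.2.succ) :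
    degreeOf p (vandCof K N j) = 0 := by
  unfold vandCof
  refine Nat.eq_zero_of_le_zero ((degreeOf_mul_le _ _ _).trans ?_)
  refine (add_le_add (degreeOf_prod_le _ _ _) (degreeOf_prod_le _ _ _)).trans ?_
  rw [Finset.sum_eq_zero fun k _ => ?_, Finset.sum_eq_zero fun e he => ?_]
  · exact le_rfl
  · simp only [Finset.mem_filter] at he
    exact degreeOf_X_sub_X_of_ne (h e he.2.1 he.2.2).1 (h e he.2.1 he.2.2).2
  · split_ifs
    · rw [degreeOf_neg, degreeOf_one]
    · rw [degreeOf_one]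

theorem degreeOf_vand (m : Fin (N + 1)) : degreeOf m.succ (vand K N) = N := by
  rw [vand_eq m, degreeOf_mul_eq (vandCof_ne_zero m) (nodeProd_ne_zero m),
    degreeOf_vandCof_of_forall, degreeOf_prod_eq, Finset.sum_congr rfl (g := fun _ => 1)]
  · simp
  · intro k hk
    exact degreeOf_X_sub_X (by simpa using (Finset.ne_of_mem_erase hk).symm)
  · intro k hk
    exact X_sub_X_ne_zero (by simpa using (Finset.ne_of_mem_erase hk).symm)
  · intro e h1 h2
    simp [h1.symm, h2.symm]

theorem degreeOf_vandCof_zero (j : Fin (N + 1)) : degreeOf 0 (vandCof K N j) = 0 :=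
  degreeOf_vandCof_of_forall j 0 fun _ _ _ => ⟨(Fin.succ_ne_zero _).symm, (Fin.succ_ne_zero _).symm⟩

theorem degreeOf_vandCof_self (j : Fin (N + 1)) : degreeOf j.succ (vandCof K N j) = 0 :=
  degreeOf_vandCof_of_forall j _ fun e h1 h2 => by simp [h1.symm, h2.symm]

/-- One of the N factors of `vand` containing the variable m is the one shared with j, which the
cofactor omits. -/
theorem degreeOf_vandCof_lt {j m : Fin (N + 1)} (h : m ≠ j) :
    degreeOf m.succ (vandCof K N j) + 1 ≤ N := by
  have h1 := degreeOf_vand (K := K) m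
  rw [vand_eq j, degreeOf_mul_eq (vandCof_ne_zero j) (nodeProd_ne_zero j)] at h1
  have h2 : 1 ≤ degreeOf m.succ
      (∏ k ∈ Finset.univ.erase j, (X j.succ - X k.succ) : MvPolynomial (Fin (N + 2)) K) := by
    rw [degreeOf_prod_eq]
    · have h3 : degreeOf m.succ (X j.succ - X m.succ : MvPolynomial (Fin (N + 2)) K) = 1 := by
        rw [← neg_sub, degreeOf_neg]
        exact degreeOf_X_sub_X (by simpa using h)
      refine h3.ge.trans ?_
      exact Finset.single_le_sum (f := fun k : Fin (N + 1) =>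
        degreeOf m.succ (X j.succ - X k.succ : MvPolynomial (Fin (N + 2)) K))
        (fun _ _ => Nat.zero_le _) (by simp [h])
    · intro k hk
      exact X_sub_X_ne_zero (by simpa using (Finset.ne_of_mem_erase hk).symm)
  omega

theorem swap_succ_succ {n : ℕ} (a b k : Fin n) :
    swap a.succ b.succ k.succ = (swap a b k).succ := by
  simp only [swap_apply_def, Fin.succ_inj]
  split_ifs <;> rfl

theorem swap_succ_zero {n : ℕ} (a b : Fin n) : swap a.succ b.succ 0 = 0 :=
  swap_apply_of_ne_of_ne (Fin.succ_ne_zero _).symm (Fin.succ_ne_zero _).symm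

theorem eval_vand_swap {a b : Fin (N + 1)} (hab : (a : ℕ) + 1 = b) (z : Fin (N + 2) → K) :
    eval (z ∘ swap a.succ b.succ) (vand K N) = - eval z (vand K N) := by
  have hmem : (a, b) ∈ incPairs (N + 1) := by
    rw [mem_incPairs, Fin.lt_def]
    simp only
    omega
  unfold vand
  simp only [map_prod, map_sub, eval_X, Function.comp_apply, swap_succ_succ]
  rw [← Finset.mul_prod_erase _ _ hmem, ← Finset.mul_prod_erase (incPairs (N + 1)) _ hmem]
  have : ∏ e ∈ (incPairs (N + 1)).erase (a, b), (z (swap a b e.1).succ - z (swap a b e.2).succ) =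
      ∏ e ∈ (incPairs (N + 1)).erase (a, b), (z e.1.succ - z e.2.succ) := by
    refine Finset.prod_equiv ((swap a b).prodCongr (swap a b)) (fun e => ?_) (fun e _ => rfl)
    obtain ⟨k, l⟩ := e
    simp only [Finset.mem_erase, mem_incPairs, prodCongr_apply, Prod.map_apply, ne_eq,
      Prod.mk.injEq, swap_apply_def, Fin.lt_def, Fin.ext_iff]
    split_ifs <;> omega
  rw [this]
  simp only [swap_apply_left, swap_apply_right]
  ring

theorem dvd_of_forall_eval {σ : Type*} [DecidableEq σ] [Infinite K] {a : σ}
    {q p : MvPolynomial σ K} (hq : aeval (Function.update X a q) q = q)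
    (h : ∀ z : σ → K, z a = eval z q → eval z p = 0) : X a - q ∣ p := by
  rw [X_sub_dvd_iff hq]
  apply MvPolynomial.funext
  intro z
  have key : ∀ r, eval z (aeval (Function.update X a q) r) =
      eval (Function.update z a (eval z q)) r := by
    intro r
    rw [← coe_aeval_eq_eval, ← coe_aeval_eq_eval, RingHom.coe_coe, RingHom.coe_coe,
      ← AlgHom.comp_apply, comp_aeval]
    congr 2
    funext i
    rcases eq_or_ne i a with rfl | hi
    · simp
    · simp [Function.update_of_ne hi]
  rw [key, map_zero]
  apply h
  rw [Function.update_self, ← key, hq]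

theorem aeval_update_X_of_ne {σ : Type*} [DecidableEq σ] {a b : σ} (hab : a ≠ b)
    (q : MvPolynomial σ K) : aeval (Function.update X a q) (X b : MvPolynomial σ K) = X b := by
  rw [aeval_X, Function.update_of_ne hab.symm]

theorem vand_dvd [Infinite K] {p : MvPolynomial (Fin (N + 2)) K}
    (h : ∀ (z : Fin (N + 2) → K) (a b : Fin (N + 1)), a < b → z a.succ = z b.succ →
      eval z p = 0) : vand K N ∣ p := by
  have hq : ∀ e ∈ incPairs (N + 1), aeval (Function.update (X : Fin (N + 2) → MvPolynomial (Fin (N + 2)) K)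
      e.1.succ (X e.2.succ)) (X e.2.succ : MvPolynomial (Fin (N + 2)) K) = X e.2.succ := by
    intro e he
    rw [mem_incPairs] at he
    exact aeval_update_X_of_ne (by simpa using he.ne) _
  refine prod_dvd_of_prime (fun e he => ?_) (fun e he f hf hef hd => ?_) (fun e he => ?_)
  · refine prime_X_sub (hq e he) ?_
    rw [mem_incPairs] at he
    exact sub_ne_zero.1 (X_sub_X_ne_zero (by simpa using he.ne))
  · rw [mem_incPairs] at he hf
    have hv : ∀ z : Fin (N + 2) → K, z e.1.succ = z e.2.succ → z f.1.succ = z f.2.succ := by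
      intro z hz
      obtain ⟨r, hr⟩ := hd
      have := congrArg (eval z) hr
      simp only [map_sub, map_mul, eval_X, hz, sub_self, zero_mul] at this
      exact sub_eq_zero.1 this
    by_cases h1 : f.1 = e.1 ∨ f.1 = e.2
    · by_cases h2 : f.2 = e.1 ∨ f.2 = e.2
      · apply hef
        rcases h1 with h1 | h1 <;> rcases h2 with h2 | h2
        · rw [h1, h2] at hf; exact absurd hf (lt_irrefl _)
        · exact Prod.ext h1.symm h2.symm
        · rw [h1, h2] at hf; exact absurd hf he.asymm
        · rw [h1, h2] at hf; exact absurd hf (lt_irrefl _)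
      · rw [not_or] at h2
        have := hv (Pi.single f.2.succ 1)
        simp [hf.ne, Ne.symm h2.1, Ne.symm h2.2] at this
    · rw [not_or] at h1
      have := hv (Pi.single f.1.succ 1)
      simp [hf.ne', Ne.symm h1.1, Ne.symm h1.2] at this
  · refine dvd_of_forall_eval (hq e he) fun z hz => ?_
    rw [mem_incPairs] at he
    exact h z e.1 e.2 he (by simpa using hz)

end Vandermonde
end BrauerQKZ


namespace BrauerQKZ

open Equiv MvPolynomial

/-! ### The Lagrange interpolant and its exchange relations -/

section Lagrange

variable {N : ℕ} {K : Type} [Field K] {A c : K} {Ψ : (Fin N → K) → LinkPattern N →₀ K}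

/-- The value of the interpolating vector at the node `z 0 = z j.succ - A`. -/
noncomputable def nodeVec (A c : K) (Ψ : (Fin N → K) → LinkPattern N →₀ K) (j : Fin (N + 1))
    (z : Fin (N + 2) → K) : LinkPattern (N + 2) →₀ K :=
  (∏ k ∈ Finset.Ioi j, gFun A c (z j.succ - z k.succ)) • chain A c Ψ j z

theorem nodeVec_swap_of_ne (hc : c ≠ 0)
    (hΨ : ∀ i j : Fin N, (i : ℕ) + 1 = j → Exch A c Ψ i j) {a b j : Fin (N + 1)}
    (hab : (a : ℕ) + 1 = b) (hja : j ≠ a) (hjb : j ≠ b) :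
    Exch A c (nodeVec A c Ψ j) a.succ b.succ := by
  intro z
  have h1 : Exch A c (chain A c Ψ j) a.succ b.succ := by
    rcases lt_or_gt_of_ne hja with h | h
    · exact chain_exch_right hΨ j _ _ (by simpa using hab) (by simpa using h)
    · refine chain_exch_left hc hΨ j (by omega) _ _ (by simpa using hab) (by simp) ?_
      rw [Fin.lt_def] at h
      have : (j : ℕ) ≠ b := fun e => hjb (Fin.ext e)
      simp only [Fin.val_succ]
      omega
  have h2 : ∏ k ∈ Finset.Ioi j, gFun A c ((z ∘ swap a.succ b.succ) j.succ -
      (z ∘ swap a.succ b.succ) k.succ) =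
      ∏ k ∈ Finset.Ioi j, gFun A c (z j.succ - z k.succ) := by
    simp only [Function.comp_apply, swap_succ_succ]
    refine Finset.prod_equiv (swap a b) (fun k => ?_) (fun k _ => ?_)
    · have h3 : (j : ℕ) ≠ a := fun e => hja (Fin.ext e)
      have h4 : (j : ℕ) ≠ b := fun e => hjb (Fin.ext e)
      simp only [Finset.mem_Ioi, swap_apply_def, Fin.lt_def, Fin.ext_iff]
      split_ifs <;> omega
    · rw [swap_apply_of_ne_of_ne hja hjb]
  unfold nodeVec
  rw [h2, smul_comm, h1 z, map_smul]

theorem Ioi_eq_insert {n : ℕ} {a b : Fin n} (hab : (a : ℕ) + 1 = b) :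
    Finset.Ioi a = insert b (Finset.Ioi b) := by
  ext k
  simp only [Finset.mem_Ioi, Finset.mem_insert, Fin.lt_def, Fin.ext_iff]
  omega

theorem prod_Ioi_swap {a b : Fin (N + 1)} (hab : (a : ℕ) + 1 = b) (f : K → K)
    (z : Fin (N + 2) → K) (x : K) :
    ∏ k ∈ Finset.Ioi b, f (x - (z ∘ swap a.succ b.succ) k.succ) =
      ∏ k ∈ Finset.Ioi b, f (x - z k.succ) := by
  refine Finset.prod_congr rfl fun k hk => ?_
  rw [Finset.mem_Ioi, Fin.lt_def] at hk
  rw [Function.comp_apply, swap_succ_succ, swap_apply_of_ne_of_ne] <;>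
  · rw [ne_eq, Fin.ext_iff]
    omega

/-- Moving the node from a to b = a + 1 lengthens the chain by one R-matrix, and the factor g(z a −
z b) of node a is the normalisation that this R-matrix requires. -/
theorem nodeVec_swap_right {a b : Fin (N + 1)} (hab : (a : ℕ) + 1 = b) (z : Fin (N + 2) → K) :
    gFun A c (z a.succ - z b.succ) • nodeVec A c Ψ b (z ∘ swap a.succ b.succ) =
      rOp A c a.succ b.succ (z a.succ - z b.succ) (nodeVec A c Ψ a z) := by
  unfold nodeVec
  rw [Ioi_eq_insert hab, Finset.prod_insert (by simp), ← hab,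
    chain_succ_swap (by simp) (by simp [← hab]), prod_Ioi_swap hab]
  simp only [Function.comp_apply, swap_apply_right]
  rw [map_smul, smul_smul]

/-- In this direction the last R-matrix of the chain is cancelled by unitarity, which supplies the
g-factor that node a has in excess. -/
theorem nodeVec_swap_left (hc : c ≠ 0) {a b : Fin (N + 1)} (hab : (a : ℕ) + 1 = b)
    (z : Fin (N + 2) → K) :
    gFun A c (z a.succ - z b.succ) • nodeVec A c Ψ a (z ∘ swap a.succ b.succ) =
      rOp A c a.succ b.succ (z a.succ - z b.succ) (nodeVec A c Ψ b z) := by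
  unfold nodeVec
  rw [Ioi_eq_insert hab, Finset.prod_insert (by simp), ← hab, map_smul,
    rOp_chain_succ hc (by simp) (by simp [← hab]), prod_Ioi_swap hab]
  simp only [Function.comp_apply, swap_apply_right, swap_apply_left]
  rw [smul_smul, smul_smul]
  congr 1
  ring

/-- The terms of the Lagrange interpolation formula. -/
noncomputable def lagrangeTerm (A c : K) (Ψ : (Fin N → K) → LinkPattern N →₀ K) (j : Fin (N + 1))
    (z : Fin (N + 2) → K) : LinkPattern (N + 2) →₀ K :=
  (∏ k ∈ Finset.univ.erase j, (A + z 0 - z k.succ) / (z j.succ - z k.succ)) • nodeVec A c Ψ j z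

/-- The scalar Lagrange weights are merely permuted by the swap, so the claim reduces to the node
values. -/
theorem lagrangeTerm_swap (hc : c ≠ 0)
    (hΨ : ∀ i j : Fin N, (i : ℕ) + 1 = j → Exch A c Ψ i j) {a b : Fin (N + 1)}
    (hab : (a : ℕ) + 1 = b) (j : Fin (N + 1)) (z : Fin (N + 2) → K) :
    gFun A c (z a.succ - z b.succ) •
        lagrangeTerm A c Ψ (swap a b j) (z ∘ swap a.succ b.succ) =
      rOp A c a.succ b.succ (z a.succ - z b.succ) (lagrangeTerm A c Ψ j z) := by
  have h1 : ∏ k ∈ Finset.univ.erase (swap a b j),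
      (A + (z ∘ swap a.succ b.succ) 0 - (z ∘ swap a.succ b.succ) k.succ) /
        ((z ∘ swap a.succ b.succ) (swap a b j).succ - (z ∘ swap a.succ b.succ) k.succ) =
      ∏ k ∈ Finset.univ.erase j, (A + z 0 - z k.succ) / (z j.succ - z k.succ) := by
    simp only [Function.comp_apply, swap_succ_succ, swap_succ_zero, swap_apply_self]
    refine Finset.prod_equiv (swap a b) (fun k => ?_) (fun k _ => rfl)
    simp only [Finset.mem_erase, Finset.mem_univ, and_true, ne_eq]
    rw [swap_apply_eq_iff]
  have h2 : gFun A c (z a.succ - z b.succ) •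
        nodeVec A c Ψ (swap a b j) (z ∘ swap a.succ b.succ) =
      rOp A c a.succ b.succ (z a.succ - z b.succ) (nodeVec A c Ψ j z) := by
    rcases eq_or_ne j a with rfl | hja
    · rw [swap_apply_left]
      exact nodeVec_swap_right hab z
    rcases eq_or_ne j b with rfl | hjb
    · rw [swap_apply_right]
      exact nodeVec_swap_left hc hab z
    rw [swap_apply_of_ne_of_ne hja hjb]
    exact nodeVec_swap_of_ne hc hΨ hab hja hjb z
  unfold lagrangeTerm
  rw [h1, smul_comm, h2, map_smul]

theorem sum_lagrangeTerm_exch (hc : c ≠ 0)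
    (hΨ : ∀ i j : Fin N, (i : ℕ) + 1 = j → Exch A c Ψ i j) {a b : Fin (N + 1)}
    (hab : (a : ℕ) + 1 = b) :
    Exch A c (fun z => ∑ j, lagrangeTerm A c Ψ j z) a.succ b.succ := by
  intro z
  simp only
  rw [map_sum, Finset.smul_sum, ← Equiv.sum_comp (swap a b)]
  exact Finset.sum_congr rfl fun j _ => lagrangeTerm_swap hc hΨ hab j z

theorem sum_lagrangeTerm_node {z : Fin (N + 2) → K} (hz : ∀ i j : Fin (N + 1), i ≠ j → z i.succ ≠ z j.succ)
    {m : Fin (N + 1)} (hm : z 0 = z m.succ - A) :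
    ∑ j, lagrangeTerm A c Ψ j z = nodeVec A c Ψ m z := by
  rw [Finset.sum_eq_single m]
  · unfold lagrangeTerm
    rw [Finset.prod_eq_one, one_smul]
    intro k hk
    have hk := Finset.ne_of_mem_erase hk
    rw [hm, add_sub_cancel, div_self (sub_ne_zero.2 (hz m k hk.symm))]
  · intro j _ hj
    unfold lagrangeTerm
    rw [Finset.prod_eq_zero (i := m) (by simp [hj.symm]), zero_smul]
    rw [hm, add_sub_cancel, sub_self, zero_div]
  · simp

/-- The Lagrange interpolation formula multiplied by the Vandermonde product. -/
noncomputable def lagrangeNum (A c : K) (Ψ : (Fin N → K) → LinkPattern N →₀ K)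
    (z : Fin (N + 2) → K) : LinkPattern (N + 2) →₀ K :=
  ∑ j, (eval z (vandCof K N j) * ∏ k ∈ Finset.univ.erase j, (A + z 0 - z k.succ)) •
    nodeVec A c Ψ j z

theorem lagrangeNum_eq {z : Fin (N + 2) → K} (hz : ∀ i j : Fin (N + 1), i ≠ j → z i.succ ≠ z j.succ) :
    lagrangeNum A c Ψ z = eval z (vand K N) • ∑ j, lagrangeTerm A c Ψ j z := by
  unfold lagrangeNum lagrangeTerm
  rw [Finset.smul_sum]
  refine Finset.sum_congr rfl fun j _ => ?_
  rw [smul_smul, vand_eq j, Finset.prod_div_distrib, map_mul, map_prod]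
  simp only [map_sub, eval_X]
  congr 1
  have : ∏ k ∈ Finset.univ.erase j, (z j.succ - z k.succ) ≠ 0 :=
    Finset.prod_ne_zero_iff.2 fun k hk =>
      sub_ne_zero.2 (hz j k (Finset.ne_of_mem_erase hk).symm)
  field_simp

/-- Each R-matrix is quadratic in a difference of two variables. The variable at the arc occurs in
all n of them, each variable under the arc in one, and those beyond in none. -/
theorem chain_vDeg {D : ℕ} (hD : VDeg Ψ fun _ => D) (n : ℕ) (hn : n < N + 1) :
    VDeg (chain A c Ψ n) fun p => if p = 0 then 0 else if (p : ℕ) < n + 1 then D + 2 else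
      if (p : ℕ) = n + 1 then 2 * n else D := by
  induction n with
  | zero =>
    have h1 := hD.comp_injective (e := fun k : Fin N => k.succ.succ)
      (d' := fun p => if p = 0 then 0 else if (p : ℕ) < 1 then D + 2 else
        if (p : ℕ) = 1 then 0 else D)
      (fun a b h => Fin.succ_injective _ (Fin.succ_injective _ h)) (fun k => by
        simp [Fin.ext_iff])
    exact h1.map (arcOp K N)
  | succ n ih =>
    have ih := ih (by omega)
    obtain ⟨a, ha⟩ : ∃ a : Fin (N + 2), (a : ℕ) = n + 1 := ⟨⟨n + 1, by omega⟩, rfl⟩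
    obtain ⟨b, hb⟩ : ∃ b : Fin (N + 2), (b : ℕ) = n + 2 := ⟨⟨n + 2, by omega⟩, rfl⟩
    have h1 := ih.comp_injective (swap a b).injective (d' := fun p =>
      (fun p : Fin (N + 2) => if p = 0 then 0 else if (p : ℕ) < n + 1 then D + 2 else
      if (p : ℕ) = n + 1 then 2 * n else D) (swap a b p)) (fun k => by simp)
    have h2 : HasDeg (fun z : Fin (N + 2) → K => z b - z a) (Pi.single b 1 + Pi.single a 1) :=
      ((HasDeg.proj b).mono (by simp)).sub ((HasDeg.proj a).mono (by simp))
    have h3 := h1.rOp A c a b h2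
    have h4 : VDeg (chain A c Ψ (n + 1)) _ := fun π => by
      simp only [chain_succ ha hb]
      exact h3 π
    refine h4.mono fun p => ?_
    simp only [Pi.add_apply, Pi.single_apply, swap_apply_def, Fin.ext_iff, Fin.val_zero]
    split_ifs <;> omega

theorem nodeVec_vDeg {D : ℕ} (hD : VDeg Ψ fun _ => D) (j : Fin (N + 1)) :
    VDeg (nodeVec A c Ψ j) fun p => if p = 0 then 0 else if p = j.succ then 2 * N else D + 2 := by
  have h1 : ∀ k ∈ Finset.Ioi j, HasDeg (fun z : Fin (N + 2) → K => gFun A c (z j.succ - z k.succ))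
      (Pi.single j.succ 2 + Pi.single k.succ 2) := by
    intro k _
    have h2 : HasDeg (fun z : Fin (N + 2) → K => z j.succ - z k.succ)
        (Pi.single j.succ 1 + Pi.single k.succ 1) :=
      ((HasDeg.proj j.succ).mono (by simp)).sub ((HasDeg.proj k.succ).mono (by simp))
    refine (h2.gFun A c).mono fun p => ?_
    simp only [Pi.add_apply, Pi.single_apply]
    split_ifs <;> omega
  refine (VDeg.smul (HasDeg.prod h1) (chain_vDeg hD j j.2)).mono fun p => ?_
  simp only [Finset.sum_add_distrib, Pi.add_apply, Finset.sum_apply, Finset.sum_const,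
    Fin.card_Ioi]
  refine Fin.cases ?_ (fun m => ?_) p
  · simp [(Fin.succ_ne_zero _).symm]
  · simp only [Pi.single_apply, Fin.succ_inj, Pi.smul_apply, smul_eq_mul, Finset.sum_ite_eq,
      Finset.mem_Ioi, Fin.succ_ne_zero, if_false, Fin.val_succ]
    simp only [Fin.lt_def, Fin.ext_iff]
    have := j.2
    have := m.2
    split_ifs <;> omega

/-- For m ≠ j the degree is at most (N − 1) + 1 + (D + 2) = 2N. For m = j the whole degree 2N comes
from the node value. Division by the Vandermonde product, of degree N in each of its variables, will
leave N. -/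
theorem lagrangeNum_vDeg {D : ℕ} (hD : VDeg Ψ fun _ => D) (hN : D + 2 = N) :
    VDeg (lagrangeNum A c Ψ) fun p => if p = 0 then N else 2 * N := by
  intro π
  unfold lagrangeNum
  simp only [Finsupp.finsetSum_apply]
  refine HasDeg.sum fun j _ => ?_
  have h1 : HasDeg (fun z => eval z (vandCof K N j)) (fun p => degreeOf p (vandCof K N j)) :=
    ⟨_, fun _ => rfl, fun _ => le_rfl⟩
  have h2 : ∀ k ∈ Finset.univ.erase j, HasDeg (fun z : Fin (N + 2) → K => A + z 0 - z k.succ)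
      (Pi.single 0 1 + Pi.single k.succ 1) := fun k _ =>
    ((HasDeg.const A _).add ((HasDeg.proj 0).mono (by simp))).sub
      ((HasDeg.proj k.succ).mono (by simp))
  refine ((VDeg.smul (h1.mul (HasDeg.prod h2)) (nodeVec_vDeg hD j)).mono fun p => ?_) π
  simp only [Finset.sum_add_distrib, Pi.add_apply, Finset.sum_apply, Finset.sum_const]
  refine Fin.cases ?_ (fun m => ?_) p
  · simp [(Fin.succ_ne_zero _).symm, degreeOf_vandCof_zero]
  · simp only [Pi.single_apply, Fin.succ_inj, Pi.smul_apply, smul_eq_mul, Finset.sum_ite_eq,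
      Fin.succ_ne_zero, if_false, Finset.mem_erase, Finset.mem_univ, and_true]
    rcases eq_or_ne m j with rfl | h
    · simp [degreeOf_vandCof_self]
    · have := degreeOf_vandCof_lt (K := K) h
      simp only [ne_eq, h, not_false_eq_true, if_true, if_false, mul_zero]
      omega

end Lagrange
end BrauerQKZ


namespace BrauerQKZ

open Equiv MvPolynomial

theorem comp_swap_comp_swap {α K : Type*} [DecidableEq α] (z : α → K) (i j : α) :
    (z ∘ swap i j) ∘ swap i j = z := by
  funext k
  simp

theorem comp_swap_of_eq {α K : Type*} [DecidableEq α] {z : α → K} {i j : α} (h : z i = z j) :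
    z ∘ swap i j = z := by
  funext k
  simp only [Function.comp_apply, swap_apply_def]
  split_ifs with h1 h2
  · rw [h1, h]
  · rw [h2, h]
  · rfl

theorem VPoly.comp_perm {α : Type*} {N : ℕ} {K : Type} [Field K]
    {F : (α → K) → LinkPattern N →₀ K} (hF : VPoly F) (s : Perm α) :
    VPoly (fun z => F (z ∘ s)) :=
  hF.comp fun k => IsPoly.proj (s k)

/-! ### Polynomiality of the interpolant -/

section Interpolation

variable {N : ℕ} {K : Type} [Field K] [Infinite K] {A c : K}
  {Ψ : (Fin N → K) → LinkPattern N →₀ K} {D : ℕ}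

theorem lagrangeNum_swap (hc : c ≠ 0) (hΨ : ∀ i j : Fin N, (i : ℕ) + 1 = j → Exch A c Ψ i j)
    (hD : VDeg Ψ fun _ => D) (hN : D + 2 = N) {a b : Fin (N + 1)} (hab : (a : ℕ) + 1 = b)
    (z : Fin (N + 2) → K) :
    gFun A c (z a.succ - z b.succ) • lagrangeNum A c Ψ (z ∘ swap a.succ b.succ) =
      (-1 : K) • rOp A c a.succ b.succ (z a.succ - z b.succ) (lagrangeNum A c Ψ z) := by
  have hP := (lagrangeNum_vDeg (A := A) (c := c) hD hN).vPoly
  have hu : IsPoly fun z : Fin (N + 2) → K => z a.succ - z b.succ :=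
    (IsPoly.proj _).sub (IsPoly.proj _)
  refine VPoly.eq_of_generic (VPoly.smul (hu.gFun A c) (hP.comp_perm _))
    (VPoly.smul (IsPoly.const _) (hP.rOp A c _ _ hu)) {0} (fun z hz => ?_) z
  have hz' : ∀ i j : Fin (N + 1), i ≠ j → z i.succ ≠ z j.succ := fun i j hij =>
    sub_ne_zero.1 (hz _ _ (by simpa using hij) 0 (by simp))
  rw [lagrangeNum_eq hz', lagrangeNum_eq, eval_vand_swap hab, smul_comm,
    sum_lagrangeTerm_exch hc hΨ hab z, map_smul, smul_smul, neg_one_mul]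
  intro i j hij
  simp only [Function.comp_apply, swap_succ_succ]
  exact hz' _ _ (by simpa using hij)

/-- The antisymmetric Vandermonde factor puts a sign into the exchange relation. At equal adjacent
variables R(0) = cA and g(0) = Ac, so the relation reads 2Ac · H = 0. Other pairs of equal variables
are made adjacent by generic exchanges. -/
theorem lagrangeNum_eq_zero (h2 : (2 : K) ≠ 0) (hA : A ≠ 0) (hc : c ≠ 0)
    (hΨ : ∀ i j : Fin N, (i : ℕ) + 1 = j → Exch A c Ψ i j)
    (hD : VDeg Ψ fun _ => D) (hN : D + 2 = N) (d : ℕ) (a b : Fin (N + 1))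
    (hab : (a : ℕ) + 1 + d = b) (z : Fin (N + 2) → K) (hz : z a.succ = z b.succ) :
    lagrangeNum A c Ψ z = 0 := by
  classical
  induction d generalizing b z with
  | zero =>
    have h := lagrangeNum_swap hc hΨ hD hN hab z
    rw [comp_swap_of_eq hz, hz, sub_self, rOp_zero, LinearMap.smul_apply, Module.End.one_apply,
      smul_smul, ← sub_eq_zero, ← sub_smul] at h
    refine (smul_eq_zero.1 h).resolve_left ?_
    have : gFun A c 0 - -1 * (c * A) = 2 * (A * c) := by unfold gFun; ring
    rw [this]
    exact mul_ne_zero h2 (mul_ne_zero hA hc)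
  | succ d ih =>
    obtain ⟨e, he⟩ : ∃ e : Fin (N + 1), (e : ℕ) + 1 = b := ⟨⟨b - 1, by omega⟩, by simp; omega⟩
    have hae : a ≠ e := by rw [ne_eq, Fin.ext_iff]; omega
    have hab' : a ≠ b := by rw [ne_eq, Fin.ext_iff]; omega
    have heb : e ≠ b := by rw [ne_eq, Fin.ext_iff]; omega
    have hP := (lagrangeNum_vDeg (A := A) (c := c) hD hN).vPoly
    have key := VPoly.eq_of_generic (hP.update b.succ (IsPoly.proj a.succ))
      (G := fun _ => 0) (fun _ => IsPoly.const 0) {-A, c} (fun z hz => ?_) z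
    · simpa [hz] using key
    · set w := Function.update z b.succ (z a.succ) with hw
      have w1 : w a.succ = z a.succ := Function.update_of_ne (by simpa using hab') _ _
      have w2 : w b.succ = z a.succ := Function.update_self _ _ _
      have w3 : w e.succ = z e.succ := Function.update_of_ne (by simpa using heb) _ _
      have h0 := ih e (by omega) (w ∘ swap e.succ b.succ) (by
        simp only [Function.comp_apply, swap_succ_succ, swap_apply_left,
          swap_apply_of_ne_of_ne hae hab', w1, w2])
      have h1 := lagrangeNum_swap hc hΨ hD hN he (w ∘ swap e.succ b.succ)
      rw [h0, map_zero, smul_zero, comp_swap_comp_swap] at h1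
      refine (smul_eq_zero.1 h1).resolve_left ?_
      simp only [Function.comp_apply, swap_apply_left, swap_apply_right, w2, w3]
      rw [gFun_eq_zero, not_or]
      exact ⟨hz _ _ (by simpa using hae) _ (by simp), hz _ _ (by simpa using hae) _ (by simp)⟩

/-- The numerator vanishes on every diagonal, so the Vandermonde product divides it and the degree
drops to N in every variable, as needed for the next induction step. -/
theorem exists_interpolation (h2 : (2 : K) ≠ 0) (hA : A ≠ 0) (hc : c ≠ 0)
    (hΨ : ∀ i j : Fin N, (i : ℕ) + 1 = j → Exch A c Ψ i j)
    (hD : VDeg Ψ fun _ => D) (hN : D + 2 = N) :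
    ∃ L : (Fin (N + 2) → K) → LinkPattern (N + 2) →₀ K, VDeg L (fun _ => N) ∧
      (∀ a b : Fin (N + 1), (a : ℕ) + 1 = b → Exch A c L a.succ b.succ) ∧
      ∀ (m : Fin (N + 1)) (z : Fin (N + 2) → K), z 0 = z m.succ - A →
        L z = nodeVec A c Ψ m z := by
  have hH := lagrangeNum_vDeg (A := A) (c := c) hD hN
  have key : ∀ π, ∃ p : MvPolynomial (Fin (N + 2)) K, (∀ k, p.degreeOf k ≤ N) ∧
      ∀ z, lagrangeNum A c Ψ z π = eval z (vand K N) * eval z p := by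
    intro π
    obtain ⟨q, hq, hd⟩ := hH π
    have hdvd : vand K N ∣ q := by
      refine vand_dvd fun z a b hab hz => ?_
      rw [Fin.lt_def] at hab
      have h := hq z
      simp only at h
      rw [← h, lagrangeNum_eq_zero h2 hA hc hΨ hD hN (b - a - 1) a b (by omega) z hz]
      rfl
    obtain ⟨p, rfl⟩ := hdvd
    refine ⟨p, fun k => ?_, fun z => (hq z).trans (map_mul _ _ _)⟩
    rcases eq_or_ne p 0 with rfl | hp
    · simp
    have h1 := hd k
    simp only at h1
    rw [degreeOf_mul_eq vand_ne_zero hp] at h1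
    revert h1
    refine Fin.cases ?_ (fun m => ?_) k
    · intro h1
      rw [if_pos rfl] at h1
      omega
    · intro h1
      rw [degreeOf_vand, if_neg (Fin.succ_ne_zero _)] at h1
      omega
  choose p hp1 hp2 using key
  -- The quotient polynomials extend the Lagrange sum to the diagonals, where its denominators
  -- vanish.
  let L : (Fin (N + 2) → K) → LinkPattern (N + 2) →₀ K := fun z =>
    Finsupp.equivFunOnFinite.symm fun π => eval z (p π)
  have hL : VDeg L (fun _ => N) := fun π => ⟨p π, fun z => rfl, hp1 π⟩
  have hLeq : ∀ z : Fin (N + 2) → K, (∀ i j : Fin (N + 1), i ≠ j → z i.succ ≠ z j.succ) →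
      L z = ∑ j, lagrangeTerm A c Ψ j z := by
    intro z hz
    have hv : eval z (vand K N) ≠ 0 := by
      unfold vand
      rw [map_prod]
      refine Finset.prod_ne_zero_iff.2 fun e he => ?_
      rw [mem_incPairs] at he
      simpa [sub_eq_zero] using hz _ _ he.ne
    refine smul_right_injective _ hv ?_
    simp only
    rw [← lagrangeNum_eq hz]
    ext π
    rw [hp2]
    rfl
  have hgen : ∀ z : Fin (N + 2) → K, (∀ i j, i ≠ j → ∀ δ ∈ ({0} : Finset K), z i - z j ≠ δ) →
      ∀ i j : Fin (N + 1), i ≠ j → z i.succ ≠ z j.succ := fun z hz i j hij =>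
    sub_ne_zero.1 (hz _ _ (by simpa using hij) 0 (by simp))
  refine ⟨L, hL, fun a b hab z => ?_, fun m z hz => ?_⟩
  · have hu : IsPoly fun z : Fin (N + 2) → K => z a.succ - z b.succ :=
      (IsPoly.proj _).sub (IsPoly.proj _)
    refine VPoly.eq_of_generic (VPoly.smul (hu.gFun A c) (hL.vPoly.comp_perm _))
      (hL.vPoly.rOp A c _ _ hu) {0} (fun z hz => ?_) z
    have hz' := hgen z hz
    rw [hLeq z hz', hLeq]
    · exact sum_lagrangeTerm_exch hc hΨ hab z
    · intro i j hij
      simp only [Function.comp_apply, swap_succ_succ]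
      exact hz' _ _ (by simpa using hij)
  · have ht : IsPoly fun z : Fin (N + 2) → K => z m.succ - A := (IsPoly.proj _).sub (IsPoly.const _)
    have := VPoly.eq_of_generic (hL.vPoly.update 0 ht)
      ((nodeVec_vDeg (A := A) (c := c) hD m).vPoly.update 0 ht) {0} (fun z hz => ?_) z
    · rwa [← hz, Function.update_eq_self] at this
    · have hz' := hgen z hz
      have hs : ∀ k : Fin (N + 1), Function.update z 0 (z m.succ - A) k.succ = z k.succ :=
        fun k => Function.update_of_ne (Fin.succ_ne_zero _) _ _
      rw [hLeq, sum_lagrangeTerm_node]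
      · simpa [hs] using hz'
      · rw [hs, Function.update_self]
      · simpa [hs] using hz'

end Interpolation
end BrauerQKZ


namespace BrauerQKZ

open Equiv MvPolynomial

section Affine

variable {σ K : Type*} [Field K]

theorem degreeOf_bind₁_le [DecidableEq σ] {q : σ → MvPolynomial σ K} {i : σ}
    (hq : ∀ k, (q k).degreeOf i ≤ if k = i then 1 else 0) (p : MvPolynomial σ K) :
    (bind₁ q p).degreeOf i ≤ p.degreeOf i := by
  conv_lhs => rw [p.as_sum, map_sum]
  refine (degreeOf_sum_le _ _ _).trans (Finset.sup_le fun m hm => ?_)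
  rw [bind₁_monomial]
  refine (degreeOf_C_mul_le _ _ _).trans ((degreeOf_prod_le _ _ _).trans ?_)
  refine (Finset.sum_le_sum (g := fun k => if k = i then m k else 0) fun k _ => ?_).trans ?_
  · refine (degreeOf_pow_le _ _ _).trans ((Nat.mul_le_mul_left _ (hq k)).trans ?_)
    split_ifs <;> simp
  · rw [Finset.sum_ite_eq']
    split_ifs
    · exact monomial_le_degreeOf i hm
    · exact Nat.zero_le _

theorem HasDeg.comp_affine {f : (σ → K) → K} {d : σ → ℕ} (hf : HasDeg f d) (a b : σ → K) :
    HasDeg (fun z => f fun k => a k * z k + b k) d := by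
  classical
  obtain ⟨p, hp, hk⟩ := hf
  refine ⟨bind₁ (fun k => C (a k) * X k + C (b k)) p, fun z => ?_, fun i =>
    (degreeOf_bind₁_le (fun k => ?_) p).trans (hk i)⟩
  · simp only [hp]
    rw [← coe_aeval_eq_eval, ← coe_aeval_eq_eval, RingHom.coe_coe, RingHom.coe_coe, aeval_bind₁]
    simp
  · refine (degreeOf_add_le _ _ _).trans (max_le ((degreeOf_C_mul_le _ _ _).trans ?_) (by simp))
    rw [degreeOf_X]
    simp [eq_comm]

end Affine

/-! ### Reflection of the places -/

section Mirror

variable {N : ℕ} {K : Type} [Field K] {A c : K}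

/-- Reflection of the places combined with a change of sign of the variables. -/
noncomputable def mirror (F : (Fin N → K) → LinkPattern N →₀ K) (z : Fin N → K) :
    LinkPattern N →₀ K :=
  conjOp K Fin.revPerm (F fun k => -z k.rev)

theorem swap_rev (i j k : Fin N) : swap i.rev j.rev k.rev = (swap i j k).rev := by
  simp only [swap_apply_def, Fin.rev_inj]
  split_ifs <;> rfl

/-- Reflection reverses the order of the two places, negation restores the sign of their difference,
and R_ij is symmetric in i and j. -/
theorem Exch.mirror {F : (Fin N → K) → LinkPattern N →₀ K} {i j : Fin N} (hF : Exch A c F i j)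
    (hij : i ≠ j) : Exch A c (mirror F) j.rev i.rev := by
  intro z
  have h := hF fun k => -z k.rev
  have e : (fun k => -z k.rev) ∘ swap i j = fun k => -(z ∘ swap j.rev i.rev) k.rev := by
    funext k
    simp only [Function.comp_apply, swap_comm j.rev, swap_rev]
  have e2 : -z i.rev - -z j.rev = z j.rev - z i.rev := by ring
  rw [e, e2] at h
  unfold BrauerQKZ.mirror
  rw [← map_smul, h, rOp_comm _ _ (Fin.rev_injective.ne hij).symm, ← Module.End.mul_apply,
    conjOp_rOp, Module.End.mul_apply]
  rfl

theorem VDeg.mirror {F : (Fin N → K) → LinkPattern N →₀ K} {D : ℕ} (hF : VDeg F fun _ => D) :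
    VDeg (mirror F) fun _ => D := by
  refine VDeg.map (F := fun z => F fun k => -z k.rev) (fun π => ?_) _
  have := ((hF π).comp_affine (-1) 0).comp_injective Fin.rev_injective (d' := fun _ => D)
    fun _ => le_rfl
  simpa using this

end Mirror

/-! ### Moving arcs past other places -/

section ArcPerm

variable {N : ℕ} {K : Type} [Field K] {A c : K}

/-- The permutation that moves the first two places to the right, past `j` places. -/
def arcPerm (N : ℕ) : ℕ → Perm (Fin (N + 2))
  | 0 => 1
  | j + 1 => swap (Fin.ofNat _ j) (Fin.ofNat _ (j + 1)) *
      swap (Fin.ofNat _ (j + 1)) (Fin.ofNat _ (j + 2)) * arcPerm N j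

theorem ofNat_ne {n i j : ℕ} [NeZero n] (hi : i < n) (hj : j < n) (h : i ≠ j) :
    Fin.ofNat n i ≠ Fin.ofNat n j := by
  rw [ne_eq, Fin.ext_iff, Fin.val_ofNat, Fin.val_ofNat, Nat.mod_eq_of_lt hi, Nat.mod_eq_of_lt hj]
  exact h

theorem ne_ofNat {n j : ℕ} [NeZero n] {x : Fin n} (hj : j < n) (h : (x : ℕ) ≠ j) :
    x ≠ Fin.ofNat n j := by
  rw [ne_eq, Fin.ext_iff, Fin.val_ofNat, Nat.mod_eq_of_lt hj]
  exact h

theorem arcPerm_zero_one {j : ℕ} (hj : j < N + 1) :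
    arcPerm N j 0 = Fin.ofNat _ j ∧ arcPerm N j 1 = Fin.ofNat _ (j + 1) := by
  induction j with
  | zero => exact ⟨rfl, rfl⟩
  | succ j ih =>
    obtain ⟨h0, h1⟩ := ih (by omega)
    rw [arcPerm, Perm.mul_apply, Perm.mul_apply, Perm.mul_apply, Perm.mul_apply, h0, h1,
      swap_apply_of_ne_of_ne (ofNat_ne _ _ _) (ofNat_ne _ _ _), swap_apply_left, swap_apply_left,
      swap_apply_of_ne_of_ne (ofNat_ne _ _ _) (ofNat_ne _ _ _)]
    · exact ⟨rfl, rfl⟩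
    all_goals omega

theorem arcPerm_succ_succ {j : ℕ} (hj : j < N + 1) (k : Fin N) :
    arcPerm N j k.succ.succ = if (k : ℕ) < j then k.castSucc.castSucc else k.succ.succ := by
  induction j with
  | zero => rfl
  | succ j ih =>
    rw [arcPerm, Perm.mul_apply, Perm.mul_apply, ih (by omega)]
    have m0 : j % (N + 2) = j := Nat.mod_eq_of_lt (by omega)
    have m1 : (j + 1) % (N + 2) = j + 1 := Nat.mod_eq_of_lt (by omega)
    have m2 : (j + 2) % (N + 2) = j + 2 := Nat.mod_eq_of_lt (by omega)
    rcases lt_trichotomy (k : ℕ) j with h | h | h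
    · rw [if_pos h, if_pos (by omega), swap_apply_of_ne_of_ne (x := k.castSucc.castSucc),
        swap_apply_of_ne_of_ne (x := k.castSucc.castSucc)] <;>
      simp only [ne_eq, Fin.ext_iff, Fin.val_ofNat, m0, m1, m2, Fin.val_castSucc] <;>
      omega
    · rw [if_neg (by omega), if_pos (by omega)]
      have e1 : k.succ.succ = Fin.ofNat (N + 2) (j + 2) := by
        rw [Fin.ext_iff, Fin.val_ofNat, m2]; simp; omega
      rw [e1, swap_apply_right, swap_apply_right, Fin.ext_iff, Fin.val_ofNat, m0]
      simp; omega
    · rw [if_neg (by omega), if_neg (by omega), swap_apply_of_ne_of_ne (x := k.succ.succ),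
        swap_apply_of_ne_of_ne (x := k.succ.succ)] <;>
      simp only [ne_eq, Fin.ext_iff, Fin.val_ofNat, m0, m1, m2, Fin.val_succ] <;>
      omega

theorem arcPerm_last : arcPerm N N * swap 0 1 = Fin.revPerm * liftPerm Fin.revPerm := by
  apply Equiv.ext
  have h := arcPerm_zero_one (N := N) (j := N) (by omega)
  apply forall_fin_add_two
  · rw [Perm.mul_apply, swap_apply_left, h.2]
    rw [Perm.mul_apply, liftPerm_zero, Fin.ext_iff, Fin.val_ofNat, Nat.mod_eq_of_lt (by omega)]
    simp
  · rw [Perm.mul_apply, swap_apply_right, h.1]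
    rw [Perm.mul_apply, liftPerm_one, Fin.ext_iff, Fin.val_ofNat, Nat.mod_eq_of_lt (by omega)]
    simp [Fin.val_rev]
  · intro k
    rw [Perm.mul_apply, swap_apply_of_ne_of_ne (by simp [Fin.ext_iff]) (by simp [Fin.ext_iff]),
      arcPerm_succ_succ (by omega), if_pos k.2, Perm.mul_apply, liftPerm_succ_succ, Fin.ext_iff]
    simp [Fin.val_rev]
    omega

/-- The permutations on the two sides differ by the exchange of the ends of the front arc, which
fixes every pattern having that arc. -/
theorem conjOp_revPerm_arcOp (x : LinkPattern N →₀ K) :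
    conjOp K Fin.revPerm (arcOp K N (conjOp K Fin.revPerm x)) =
      conjOp K (arcPerm N N) (arcOp K N x) := by
  rw [← conjOp_liftPerm_arcOp, ← Module.End.mul_apply, ← conjOp_mul, ← arcPerm_last, conjOp_mul,
    Module.End.mul_apply, conjOp_swap_arcOp]

theorem blockSwap_apply :
    (swap 0 2 * swap 1 3 : Perm (Fin (N + 4))) 0 = 2 ∧
    (swap 0 2 * swap 1 3 : Perm (Fin (N + 4))) 1 = 3 ∧
    (swap 0 2 * swap 1 3 : Perm (Fin (N + 4))) 2 = 0 ∧
    (swap 0 2 * swap 1 3 : Perm (Fin (N + 4))) 3 = 1 ∧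
    ∀ k : Fin N, (swap 0 2 * swap 1 3 : Perm (Fin (N + 4))) k.succ.succ.succ.succ =
      k.succ.succ.succ.succ := by
  have hne : ∀ i j : ℕ, i < 4 → j < 4 → i ≠ j → Fin.ofNat (N + 4) i ≠ Fin.ofNat (N + 4) j :=
    fun i j hi hj => ofNat_ne (by omega) (by omega)
  have n03 : (0 : Fin (N + 4)) ≠ 3 := hne 0 3 (by omega) (by omega) (by omega)
  have n12 : (1 : Fin (N + 4)) ≠ 2 := hne 1 2 (by omega) (by omega) (by omega)
  have n01 : (0 : Fin (N + 4)) ≠ 1 := hne 0 1 (by omega) (by omega) (by omega)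
  have n23 : (2 : Fin (N + 4)) ≠ 3 := hne 2 3 (by omega) (by omega) (by omega)
  refine ⟨?_, ?_, ?_, ?_, fun k => ?_⟩
  · rw [Perm.mul_apply, swap_apply_of_ne_of_ne n01 n03, swap_apply_left]
  · rw [Perm.mul_apply, swap_apply_left, swap_apply_of_ne_of_ne n03.symm n23.symm]
  · rw [Perm.mul_apply, swap_apply_of_ne_of_ne n12.symm n23, swap_apply_right]
  · rw [Perm.mul_apply, swap_apply_right, swap_apply_of_ne_of_ne n01.symm n12]
  · have hne : ∀ j < 4, k.succ.succ.succ.succ ≠ Fin.ofNat (N + 4) j := fun j hj =>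
      ne_ofNat (by omega) (by simp only [Fin.val_succ]; omega)
    exact (congrArg (swap 0 2) (swap_apply_of_ne_of_ne (hne 1 (by omega))
      (hne 3 (by omega)))).trans
      (swap_apply_of_ne_of_ne (hne 0 (by omega)) (hne 2 (by omega)))

theorem conjOp_blockSwap_arcOp (x : LinkPattern N →₀ K) :
    conjOp K (swap 0 2 * swap 1 3) (arcOp K (N + 2) (arcOp K N x)) =
      arcOp K (N + 2) (arcOp K N x) := by
  induction x using Finsupp.induction_linear with
  | zero => simp
  | add x y hx hy => simp only [map_add, hx, hy]
  | single π x =>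
    rw [arcOp_single, arcOp_single, conjOp_single]
    congr 1
    apply LinkPattern.ext_apply
    intro k
    obtain ⟨k, rfl⟩ := (swap 0 2 * swap 1 3 : Perm (Fin (N + 4))).surjective k
    rw [LinkPattern.conj_apply_apply]
    revert k
    obtain ⟨t0, t1, t2, t3, t⟩ := blockSwap_apply (N := N)
    apply forall_fin_add_two
    · rw [LinkPattern.consArc_zero, t0, t1]; rfl
    · rw [LinkPattern.consArc_one, t0, t1]; rfl
    · apply forall_fin_add_two
      · rw [LinkPattern.consArc_succ_succ, LinkPattern.consArc_zero]
        change (swap 0 2 * swap 1 3 : Perm (Fin (N + 4))) 3 =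
          π.consArc.consArc.1 ((swap 0 2 * swap 1 3 : Perm (Fin (N + 4))) 2)
        rw [t2, t3]; rfl
      · rw [LinkPattern.consArc_succ_succ, LinkPattern.consArc_one]
        change (swap 0 2 * swap 1 3 : Perm (Fin (N + 4))) 2 =
          π.consArc.consArc.1 ((swap 0 2 * swap 1 3 : Perm (Fin (N + 4))) 3)
        rw [t2, t3]; rfl
      · intro k
        rw [LinkPattern.consArc_succ_succ, LinkPattern.consArc_succ_succ, t, t]; rfl

end ArcPerm
end BrauerQKZ


namespace BrauerQKZ

open Equiv MvPolynomial

/-! ### The last node value is invariant under reflection -/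

section ChainProducts

variable {N : ℕ} {K : Type} [Field K] {A c : K}

/-- The operator `R_{0,1}(w 0) R_{1,2}(w 1) ⋯ R_{n-1,n}(w (n-1))`. -/
noncomputable def leftProd (A c : K) (N : ℕ) (w : ℕ → K) (n : ℕ) :
    Module.End K (LinkPattern (N + 2) →₀ K) :=
  ((List.range n).map fun k => rOp A c (Fin.ofNat (N + 2) k) (Fin.ofNat (N + 2) (k + 1)) (w k)).prod

/-- The operator `R_{n,n+1}(v (n-1)) ⋯ R_{1,2}(v 0)`. -/
noncomputable def rightProd (A c : K) (N : ℕ) (v : ℕ → K) (n : ℕ) :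
    Module.End K (LinkPattern (N + 2) →₀ K) :=
  ((List.range n).reverse.map fun k =>
    rOp A c (Fin.ofNat (N + 2) (k + 1)) (Fin.ofNat (N + 2) (k + 2)) (v k)).prod

theorem leftProd_succ (w : ℕ → K) (n : ℕ) :
    leftProd A c N w (n + 1) =
      leftProd A c N w n * rOp A c (Fin.ofNat (N + 2) n) (Fin.ofNat (N + 2) (n + 1)) (w n) := by
  simp [leftProd, List.range_succ]

theorem rightProd_succ (v : ℕ → K) (n : ℕ) :
    rightProd A c N v (n + 1) =
      rOp A c (Fin.ofNat (N + 2) (n + 1)) (Fin.ofNat (N + 2) (n + 2)) (v n) *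
        rightProd A c N v n := by
  simp [rightProd, List.range_succ]

theorem rightProd_congr {v v' : ℕ → K} {n : ℕ} (h : ∀ k < n, v k = v' k) :
    rightProd A c N v n = rightProd A c N v' n := by
  unfold rightProd
  congr 1
  refine List.map_congr_left fun k hk => ?_
  rw [h k (by simpa using hk)]

theorem leftProd_commute {w : ℕ → K} {n : ℕ} {a b : Fin (N + 2)} (hab : a ≠ b) (ha : n < (a : ℕ))
    (hb : n < (b : ℕ)) (u : K) : Commute (leftProd A c N w n) (rOp A c a b u) := by
  refine Commute.list_prod_left _ _ fun T hT => ?_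
  obtain ⟨k, hk, rfl⟩ := List.mem_map.1 hT
  rw [List.mem_range] at hk
  exact rOp_commute A c (ofNat_ne (by omega) (by omega) (by omega)) hab
    (ne_ofNat (by omega) (by omega)).symm (ne_ofNat (by omega) (by omega)).symm
    (ne_ofNat (by omega) (by omega)).symm (ne_ofNat (by omega) (by omega)).symm _ _

/-- The rightmost R-matrix acts next to the arc, and crossing turns it into an R-matrix one place
further right, with parameter A − w. This commutes with the remaining left product, and the arc has
moved back by one place. -/
theorem leftProd_arc (w : ℕ → K) {n : ℕ} (hn : n < N + 1) (x : LinkPattern N →₀ K) :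
    leftProd A c N w n (conjOp K (arcPerm N n) (arcOp K N x)) =
      rightProd A c N (fun k => A - w k) n (arcOp K N x) := by
  induction n with
  | zero => simp [leftProd, rightProd, arcPerm, conjOp_one]
  | succ n ih =>
    have hs := arcPerm_zero_one (N := N) (j := n) (by omega)
    have h1 := leftProd_commute (A := A) (c := c) (w := w) (n := n)
      (a := Fin.ofNat (N + 2) (n + 1)) (b := Fin.ofNat (N + 2) (n + 2))
      (ofNat_ne (by omega) (by omega) (by omega))
      (by rw [Fin.val_ofNat, Nat.mod_eq_of_lt (by omega)]; omega)
      (by rw [Fin.val_ofNat, Nat.mod_eq_of_lt (by omega)]; omega) (A - w n)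
    rw [leftProd_succ, rightProd_succ, Module.End.mul_apply, Module.End.mul_apply, arcPerm,
      rOp_crossing A c (ofNat_ne (by omega) (by omega) (by omega))
      (ofNat_ne (by omega) (by omega) (by omega)) hs.1 hs.2, ← Module.End.mul_apply, h1.eq,
      Module.End.mul_apply, ih (by omega)]

theorem conjOp_revPerm_rightProd (v : ℕ → K) (x : LinkPattern (N + 2) →₀ K) :
    conjOp K Fin.revPerm (rightProd A c N v N x) =
      leftProd A c N (fun k => v (N - 1 - k)) N (conjOp K Fin.revPerm x) := by
  have key : ∀ l : List ℕ, (∀ k ∈ l, k < N) →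
      conjOp K Fin.revPerm * (l.map fun k =>
        rOp A c (Fin.ofNat (N + 2) (k + 1)) (Fin.ofNat (N + 2) (k + 2)) (v k)).prod =
      (l.map fun k => rOp A c (Fin.ofNat (N + 2) (N - 1 - k)) (Fin.ofNat (N + 2) (N - 1 - k + 1))
        (v k)).prod * conjOp K Fin.revPerm := by
    intro l hl
    induction l with
    | nil => simp
    | cons k l ih =>
      have hk := hl k (by simp)
      rw [List.map_cons, List.map_cons, List.prod_cons, List.prod_cons, ← mul_assoc, conjOp_rOp,
        mul_assoc, ih fun i hi => hl i (by simp [hi]), mul_assoc]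
      congr 1
      rw [rOp_comm A c (Equiv.injective _ |>.ne (ofNat_ne (by omega) (by omega) (by omega)))]
      congr 1 <;>
      · rw [Fin.ext_iff, Fin.revPerm_apply, Fin.val_rev, Fin.val_ofNat, Fin.val_ofNat,
          Nat.mod_eq_of_lt (by omega), Nat.mod_eq_of_lt (by omega)]
        omega
  have hr : (List.range N).reverse = (List.range N).map fun k => N - 1 - k := by
    apply List.ext_getElem
    · simp
    · intro i h1 h2
      simp
  have := key (List.range N).reverse (by simp)
  have e : ((List.range N).reverse.map fun k => rOp A c (Fin.ofNat (N + 2) (N - 1 - k))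
      (Fin.ofNat (N + 2) (N - 1 - k + 1)) (v k)) = (List.range N).map fun k =>
      rOp A c (Fin.ofNat (N + 2) k) (Fin.ofNat (N + 2) (k + 1)) (v (N - 1 - k)) := by
    rw [hr, List.map_map]
    refine List.map_congr_left fun k hk => ?_
    rw [List.mem_range] at hk
    have : N - 1 - (N - 1 - k) = k := by omega
    simp only [Function.comp_apply, this]
  rw [e] at this
  exact congrArg (fun T => T x) this

theorem chain_eq_rightProd (Ψ : (Fin N → K) → LinkPattern N →₀ K) {n : ℕ} (hn : n < N + 1)
    (z : Fin (N + 2) → K) :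
    chain A c Ψ n z =
      rightProd A c N (fun k => z (Fin.ofNat _ (n + 1)) - z (Fin.ofNat _ (k + 1))) n
        (arcOp K N (Ψ fun k => z (if (k : ℕ) < n then k.castSucc.succ else k.succ.succ))) := by
  induction n generalizing z with
  | zero => simp [rightProd, chain]
  | succ n ih =>
    have v1 : (Fin.ofNat (N + 2) (n + 1) : ℕ) = n + 1 := Nat.mod_eq_of_lt (by omega)
    have v2 : (Fin.ofNat (N + 2) (n + 2) : ℕ) = n + 2 := Nat.mod_eq_of_lt (by omega)
    rw [chain_succ v1 v2, ih (by omega), rightProd_succ, Module.End.mul_apply]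
    congr 1
    have e : (fun k : Fin N => (z ∘ swap (Fin.ofNat (N + 2) (n + 1)) (Fin.ofNat (N + 2) (n + 2)))
        (if (k : ℕ) < n then k.castSucc.succ else k.succ.succ)) =
        fun k : Fin N => z (if (k : ℕ) < n + 1 then k.castSucc.succ else k.succ.succ) := by
      funext k
      simp only [Function.comp_apply]
      congr 1
      rcases lt_trichotomy (k : ℕ) n with h | h | h
      · rw [if_pos h, if_pos (by omega), swap_apply_of_ne_of_ne] <;>
        simp only [ne_eq, Fin.ext_iff, v1, v2, Fin.val_castSucc, Fin.val_succ] <;> omega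
      · rw [if_neg (by omega), if_pos (by omega)]
        have e1 : k.succ.succ = Fin.ofNat (N + 2) (n + 2) := by
          rw [Fin.ext_iff, v2]; simp; omega
        rw [e1, swap_apply_right, Fin.ext_iff, v1]
        simp; omega
      · rw [if_neg (by omega), if_neg (by omega), swap_apply_of_ne_of_ne] <;>
        simp only [ne_eq, Fin.ext_iff, v1, v2, Fin.val_succ] <;> omega
    rw [e, rightProd_congr]
    intro k hk
    simp only [Function.comp_apply]
    rw [swap_apply_left, swap_apply_of_ne_of_ne (ofNat_ne _ _ _) (ofNat_ne _ _ _)]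
    all_goals omega

/-- If the last place is paired with the first, the chain is invariant under reflection. -/
theorem mirror_chain {Ψ : (Fin N → K) → LinkPattern N →₀ K} (hΨ : mirror Ψ = Ψ)
    {z : Fin (N + 2) → K} (hz : z 0 = z (Fin.last _) - A) :
    mirror (chain A c Ψ N) z = chain A c Ψ N z := by
  unfold mirror
  rw [chain_eq_rightProd Ψ (by omega), chain_eq_rightProd Ψ (by omega), conjOp_revPerm_rightProd]
  have e : Ψ (fun k => -z ((if (k : ℕ) < N then k.castSucc.succ else k.succ.succ).rev)) =
      conjOp K Fin.revPerm (Ψ fun k => z (if (k : ℕ) < N then k.castSucc.succ else k.succ.succ)) := by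
    rw [← congrFun hΨ]
    unfold mirror
    congr 2
    funext k
    simp only [Fin.is_lt, if_true, neg_neg]
    congr 1
    rw [Fin.ext_iff]
    simp [Fin.val_rev]
    omega
  have l0 : Fin.ofNat (N + 2) (N + 1) = Fin.last _ := by
    rw [Fin.ext_iff, Fin.val_ofNat, Nat.mod_eq_of_lt (by omega)]
    rfl
  rw [e, conjOp_revPerm_arcOp, leftProd_arc _ (by omega)]
  congr 1
  apply rightProd_congr
  intro k hk
  have : (Fin.ofNat (N + 2) (N - 1 - k + 1)).rev = Fin.ofNat (N + 2) (k + 1) := by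
    rw [Fin.ext_iff, Fin.val_rev, Fin.val_ofNat, Fin.val_ofNat, Nat.mod_eq_of_lt (by omega),
      Nat.mod_eq_of_lt (by omega)]
    omega
  -- The crossed parameter is A − (z (k+1) − z 0), which equals the original z last − z (k+1)
  -- because z 0 = z last − A.
  rw [l0, Fin.rev_last, this, hz]
  ring

end ChainProducts
end BrauerQKZ


namespace BrauerQKZ

open Equiv MvPolynomial

/-! ### Transporting equalities along exchanges -/

section Transport

variable {n : ℕ} {K : Type} [Field K] {A c : K}

/-- The differences of the variables at places between `lo` and `hi` avoid `S`. -/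
def GenericOn (S : Set K) (lo hi : ℕ) (z : Fin n → K) : Prop :=
  ∀ i j : Fin n, lo ≤ (i : ℕ) → (i : ℕ) ≤ hi → lo ≤ (j : ℕ) → (j : ℕ) ≤ hi → i ≠ j →
    z i - z j ∉ S

theorem GenericOn.comp_swap {S : Set K} {lo hi : ℕ} {z : Fin n → K} (h : GenericOn S lo hi z)
    {a b : Fin n} (ha : lo ≤ (a : ℕ)) (hab : (a : ℕ) + 1 = b) (hb : (b : ℕ) ≤ hi) :
    GenericOn S lo hi (z ∘ swap a b) := by
  have key : ∀ i : Fin n, lo ≤ (i : ℕ) → (i : ℕ) ≤ hi →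
      lo ≤ (swap a b i : ℕ) ∧ (swap a b i : ℕ) ≤ hi := by
    intro i h1 h2
    rw [swap_apply_def]
    split_ifs <;> omega
  intro i j h1 h2 h3 h4 h5
  exact h _ _ (key i h1 h2).1 (key i h1 h2).2 (key j h3 h4).1 (key j h3 h4).2
    ((swap a b).injective.ne h5)

/-- If `F` and `G` satisfy the exchange relations between the places `lo` and `hi`, then equality of
`F` and `G` where `z p = z k + δ` does not depend on the place `k` in this range. -/
theorem eq_of_exch_range {F G : (Fin n → K) → LinkPattern n →₀ K} {lo hi : ℕ}
    (hF : ∀ i j : Fin n, lo ≤ (i : ℕ) → (i : ℕ) + 1 = j → (j : ℕ) ≤ hi → Exch A c F i j)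
    (hG : ∀ i j : Fin n, lo ≤ (i : ℕ) → (i : ℕ) + 1 = j → (j : ℕ) ≤ hi → Exch A c G i j)
    {S : Set K} (hS1 : -A ∈ S) (hS2 : c ∈ S) {Q : (Fin n → K) → Prop}
    (hQ : ∀ z (i j : Fin n), lo ≤ (i : ℕ) → (i : ℕ) + 1 = j → (j : ℕ) ≤ hi → Q z → Q (z ∘ swap i j))
    {p : Fin n} (hp : (p : ℕ) < lo ∨ hi < (p : ℕ)) {δ : K} {k k' : Fin n}
    (hk : lo ≤ (k : ℕ) ∧ (k : ℕ) ≤ hi) (hk' : lo ≤ (k' : ℕ) ∧ (k' : ℕ) ≤ hi)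
    (h : ∀ z, GenericOn S lo hi z → Q z → z p = z k + δ → F z = G z)
    {z : Fin n → K} (hz : GenericOn S lo hi z) (hz1 : Q z) (hz2 : z p = z k' + δ) : F z = G z := by
  let P : Fin n → Prop := fun k => ∀ z, GenericOn S lo hi z → Q z → z p = z k + δ → F z = G z
  -- Since p lies outside the range, the swap moves only k, and genericity keeps the coefficient g
  -- nonzero.
  have step : ∀ i j : Fin n, lo ≤ (i : ℕ) → (i : ℕ) + 1 = j → (j : ℕ) ≤ hi →
      ∀ a : Fin n, a = i ∨ a = j → P a → P (swap i j a) := by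
    intro i j hi1 hij hj a ha hPa z hz hz1 hz2
    have hpi : p ≠ i := by rintro rfl; omega
    have hpj : p ≠ j := by rintro rfl; omega
    have hne : i ≠ j := by rintro rfl; omega
    have h1 := hPa (z ∘ swap i j) (hz.comp_swap hi1 hij hj) (hQ z i j hi1 hij hj hz1) (by
      simp only [Function.comp_apply]
      rw [swap_apply_of_ne_of_ne hpi hpj, hz2])
    have hg : z j - z i ∉ S := hz j i (by omega) (by omega) (by omega) (by omega) hne.symm
    have h2 := (hF i j hi1 hij hj).transport (hG i j hi1 hij hj) h1
      (fun e => hg (by simp at e; rwa [e]))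
      (fun e => hg (by simp at e; rwa [e]))
    rwa [comp_swap_comp_swap] at h2
  have hlo : lo < n := lt_of_le_of_lt hk.1 k.2
  have up : ∀ d (a : Fin n), (a : ℕ) = lo + d → (a : ℕ) ≤ hi → (P ⟨lo, hlo⟩ ↔ P a) := by
    intro d
    induction d with
    | zero => intro a ha _; rw [show a = ⟨lo, hlo⟩ from Fin.ext ha]
    | succ d ih =>
      intro a ha hah
      obtain ⟨b, hb⟩ : ∃ b : Fin n, (b : ℕ) = lo + d := ⟨⟨lo + d, by omega⟩, rfl⟩
      refine (ih b hb (by omega)).trans ⟨fun h => ?_, fun h => ?_⟩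
      · simpa using step b a (by omega) (by omega) hah b (Or.inl rfl) h
      · simpa using step b a (by omega) (by omega) hah a (Or.inr rfl) h
  have hPk : P k := h
  have := (up (k' - lo) k' (by omega) hk'.2).1 ((up (k - lo) k (by omega) hk.2).2 hPk)
  exact this z hz hz1 hz2

end Transport

/-! ### Solutions on N and N + 2 places -/

section Step

/-- Solutions of the exchange relations on `N` and `N + 2` places that are related at
`z 0 = z 1 - A`. -/
structure IsExchPair {K : Type} [Field K] (A c : K) (N : ℕ) (Ψ' : (Fin N → K) → LinkPattern N →₀ K)
    (Ψ : (Fin (N + 2) → K) → LinkPattern (N + 2) →₀ K) : Prop where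
  exch : ∀ i j : Fin (N + 2), (i : ℕ) + 1 = j → Exch A c Ψ i j
  deg : VDeg Ψ fun _ => N
  node : ∀ z : Fin (N + 2) → K, z 0 = z 1 - A →
    Ψ z = (∏ k : Fin N, gFun A c (z 1 - z k.succ.succ)) • arcOp K N (Ψ' fun k => z k.succ.succ)
  mirror_left : mirror Ψ' = Ψ'
  mirror_right : mirror Ψ = Ψ

variable {N : ℕ} {K : Type} [Field K] {A c : K} {Ψ' : (Fin N → K) → LinkPattern N →₀ K}
  {Ψ : (Fin (N + 2) → K) → LinkPattern (N + 2) →₀ K}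

theorem nodeVec_zero {n : ℕ} (Φ : (Fin n → K) → LinkPattern n →₀ K) (z : Fin (n + 2) → K) :
    nodeVec A c Φ 0 z = (∏ k : Fin n, gFun A c (z 1 - z k.succ.succ)) •
      arcOp K n (Φ fun k => z k.succ.succ) := by
  unfold nodeVec chain
  congr 1
  have : Finset.Ioi (0 : Fin (n + 1)) = Finset.univ.map (Fin.succEmb n) := by
    ext i
    refine Fin.cases ?_ (fun i => ?_) i <;> simp
  rw [this, Finset.prod_map]
  rfl

/-- The value of the mirror image at `z (n + 1) = z n + A`. -/
theorem mirror_node_last {n : ℕ} {Φ : (Fin n → K) → LinkPattern n →₀ K}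
    {L : (Fin (n + 2) → K) → LinkPattern (n + 2) →₀ K}
    (hL : ∀ z, z 0 = z 1 - A → L z =
      (∏ k : Fin n, gFun A c (z 1 - z k.succ.succ)) • arcOp K n (Φ fun k => z k.succ.succ))
    (hΦ : mirror Φ = Φ) (z : Fin (n + 2) → K)
    (hz : z (Fin.last _) = z (Fin.last n).castSucc + A) :
    mirror L z = (∏ k : Fin n, gFun A c (z k.castSucc.castSucc - z (Fin.last n).castSucc)) •
      conjOp K (arcPerm n n) (arcOp K n (Φ fun k => z k.castSucc.castSucc)) := by
  have r1 : (1 : Fin (n + 2)).rev = (Fin.last n).castSucc := by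
    rw [← Fin.succ_zero_eq_one, Fin.rev_succ, Fin.rev_zero]
  have h1 := hL (fun k => -z k.rev) (by
    simp only [Fin.rev_zero, r1, hz]
    ring)
  unfold mirror
  rw [h1]
  simp only [r1, Fin.rev_succ]
  have h2 : (fun k : Fin n => -z k.rev.castSucc.castSucc) =
      fun k => -(fun k : Fin n => z k.castSucc.castSucc) k.rev := rfl
  have h3 : Φ (fun k : Fin n => -z k.rev.castSucc.castSucc) =
      conjOp K Fin.revPerm (Φ fun k => z k.castSucc.castSucc) := by
    rw [← congrFun hΦ]
    unfold mirror
    simp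
  rw [h3, map_smul, conjOp_revPerm_arcOp]
  congr 1
  refine Fintype.prod_equiv Fin.revPerm _ _ fun k => ?_
  rw [Fin.revPerm_apply]
  congr 1
  ring

theorem IsExchPair.node_last (h : IsExchPair A c N Ψ' Ψ) (z : Fin (N + 2) → K)
    (hz : z (Fin.last _) = z (Fin.last N).castSucc + A) :
    Ψ z = (∏ k : Fin N, gFun A c (z k.castSucc.castSucc - z (Fin.last N).castSucc)) •
      conjOp K (arcPerm N N) (arcOp K N (Ψ' fun k => z k.castSucc.castSucc)) := by
  rw [← mirror_node_last h.node h.mirror_left z hz, h.mirror_right]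

theorem arcPerm_add_two :
    arcPerm (N + 2) (N + 2) = liftPerm (arcPerm N N) * (swap 0 2 * swap 1 3) := by
  obtain ⟨t0, t1, t2, t3, t⟩ := blockSwap_apply (N := N)
  obtain ⟨a0, a1⟩ := arcPerm_zero_one (N := N) (j := N) (by omega)
  obtain ⟨b0, b1⟩ := arcPerm_zero_one (N := N + 2) (j := N + 2) (by omega)
  have v : ∀ k < N + 2, (Fin.ofNat (N + 2) k).succ.succ = Fin.ofNat (N + 4) (k + 2) := fun k hk => by
    rw [Fin.ext_iff, Fin.val_succ, Fin.val_succ, Fin.val_ofNat, Fin.val_ofNat,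
      Nat.mod_eq_of_lt (by omega), Nat.mod_eq_of_lt (by omega)]
  apply Equiv.ext
  apply forall_fin_add_two
  · rw [Perm.mul_apply, t0, b0]
    exact ((congrArg (fun k : Fin (N + 2) => k.succ.succ) a0).trans (v _ (by omega))).symm
  · rw [Perm.mul_apply, t1, b1]
    exact ((congrArg (fun k : Fin (N + 2) => k.succ.succ) a1).trans (v _ (by omega))).symm
  · intro k
    rw [arcPerm_succ_succ (by omega), if_pos k.2]
    revert k
    apply forall_fin_add_two
    · exact (congrArg (liftPerm (arcPerm N N)) t2).symm
    · exact (congrArg (liftPerm (arcPerm N N)) t3).symm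
    · intro k
      rw [Perm.mul_apply, t, liftPerm_succ_succ, arcPerm_succ_succ (by omega), if_pos k.2]
      rfl

theorem conjOp_arcPerm_arcOp_arcOp (x : LinkPattern N →₀ K) :
    conjOp K (arcPerm (N + 2) (N + 2)) (arcOp K (N + 2) (arcOp K N x)) =
      arcOp K (N + 2) (conjOp K (arcPerm N N) (arcOp K N x)) := by
  rw [arcPerm_add_two, conjOp_mul, Module.End.mul_apply, conjOp_blockSwap_arcOp,
    conjOp_liftPerm_arcOp]

/-- Under both specialisations each side reduces to Ψ' with one arc at either end, and the order of
adding the arcs is immaterial. The g-factors match because z 0 − z (N+2) = z 1 − z (N+3). -/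
theorem IsExchPair.corner (h : IsExchPair A c N Ψ' Ψ)
    {L : (Fin (N + 4) → K) → LinkPattern (N + 4) →₀ K}
    (hL : ∀ z, z 0 = z 1 - A → L z = nodeVec A c Ψ 0 z) {z : Fin (N + 4) → K} (h0 : z 0 = z 1 - A)
    (h1 : z (Fin.last _) = z (Fin.last (N + 2)).castSucc + A) :
    mirror L z = nodeVec A c Ψ 0 z := by
  rw [mirror_node_last (fun z hz => (hL z hz).trans (nodeVec_zero Ψ z)) h.mirror_right z h1,
    nodeVec_zero, h.node (fun k => z k.castSucc.castSucc) h0, h.node_last (fun k => z k.succ.succ)]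
  swap
  · exact h1
  rw [map_smul, map_smul, map_smul, conjOp_arcPerm_arcOp_arcOp, smul_smul, smul_smul]
  congr 1
  rw [Fin.prod_univ_succ, Fin.prod_univ_succ, Fin.prod_univ_castSucc (n := N + 1),
    Fin.prod_univ_castSucc (n := N)]
  have e : z 0 - z (Fin.last (N + 2)).castSucc = z 1 - z (Fin.last _) := by
    rw [h0, h1]
    ring
  change gFun A c (z 0 - z (Fin.last (N + 2)).castSucc) *
      (gFun A c (z 1 - z (Fin.last (N + 2)).castSucc) *
        ∏ i : Fin N, gFun A c (z i.succ.succ.castSucc.castSucc - z (Fin.last (N + 2)).castSucc)) *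
      (∏ i : Fin N, gFun A c (z 1 - z i.succ.succ.castSucc.castSucc)) =
    (∏ i : Fin N, gFun A c (z 1 - z i.succ.succ.castSucc.castSucc)) *
      gFun A c (z 1 - z (Fin.last (N + 2)).castSucc) * gFun A c (z 1 - z (Fin.last _)) *
      ∏ i : Fin N, gFun A c (z i.succ.succ.castSucc.castSucc - z (Fin.last (N + 2)).castSucc)
  rw [e]
  ring

end Step
end BrauerQKZ


namespace BrauerQKZ

open Equiv MvPolynomial

/-! ### The interpolant is invariant under reflection -/

section Symmetry

variable {N : ℕ} {K : Type} [Field K] {A c : K} {Ψ' : (Fin N → K) → LinkPattern N →₀ K}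
  {Ψ : (Fin (N + 2) → K) → LinkPattern (N + 2) →₀ K}
  {L : (Fin (N + 4) → K) → LinkPattern (N + 4) →₀ K}

theorem VDeg.eq_of_node_family {σ ι : Type*} [DecidableEq σ] {n : ℕ}
    {F G : (σ → K) → LinkPattern n →₀ K} {d : σ → ℕ} (hF : VDeg F d) (hG : VDeg G d) (z : σ → K)
    (k : σ) (s : Finset ι) (t : ι → K) (ht : Set.InjOn t s) (hs : d k < s.card)
    (h : ∀ i ∈ s, F (Function.update z k (t i)) = G (Function.update z k (t i))) : F z = G z := by
  classical
  refine hF.eq_of_nodes hG z k (s.image t) (by rwa [Finset.card_image_of_injOn ht]) fun x hx => ?_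
  obtain ⟨i, hi, rfl⟩ := Finset.mem_image.1 hx
  exact h i hi

/-- The properties of the interpolating vector on two more places. -/
structure IsInterpolation (A c : K) (Ψ : (Fin (N + 2) → K) → LinkPattern (N + 2) →₀ K)
    (L : (Fin (N + 4) → K) → LinkPattern (N + 4) →₀ K) : Prop where
  deg : VDeg L fun _ => N + 2
  exch : ∀ a b : Fin (N + 3), (a : ℕ) + 1 = b → Exch A c L a.succ b.succ
  node : ∀ (m : Fin (N + 3)) (z : Fin (N + 4) → K), z 0 = z m.succ - A → L z = nodeVec A c Ψ m z

/-- The relation at (0, 1) is unknown for L but known for its mirror image, which is why equality of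
the two completes the construction. -/
theorem IsInterpolation.exch_mirror (hL : IsInterpolation A c Ψ L) {i j : Fin (N + 4)}
    (hij : (i : ℕ) + 1 = j) (hj : (j : ℕ) ≤ N + 2) : Exch A c (mirror L) i j := by
  obtain ⟨a, ha⟩ : ∃ a : Fin (N + 3), a.succ = j.rev :=
    ⟨⟨N + 2 - j, by omega⟩, by rw [Fin.ext_iff, Fin.val_succ, Fin.val_rev]; simp only; omega⟩
  obtain ⟨b, hb⟩ : ∃ b : Fin (N + 3), b.succ = i.rev :=
    ⟨⟨N + 2 - i, by omega⟩, by rw [Fin.ext_iff, Fin.val_succ, Fin.val_rev]; simp only; omega⟩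
  have ha' := congrArg Fin.val ha
  have hb' := congrArg Fin.val hb
  rw [Fin.val_succ, Fin.val_rev] at ha' hb'
  have := (hL.exch a b (by omega)).mirror (by rw [ne_eq, Fin.ext_iff]; simp; omega)
  rwa [ha, hb, Fin.rev_rev, Fin.rev_rev] at this

/-- At the last node the g-product is empty, so the value is a pure chain, and the condition z 0 = z
last − A is itself invariant under reflection. -/
theorem IsInterpolation.eq_mirror_last (hL : IsInterpolation A c Ψ L) (hΨ : mirror Ψ = Ψ)
    {z : Fin (N + 4) → K} (hz : z 0 = z (Fin.last _) - A) : L z = mirror L z := by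
  have h1 : ∀ z : Fin (N + 4) → K, z 0 = z (Fin.last _) - A → L z = chain A c Ψ (N + 2) z := by
    intro z hz
    have h2 : Finset.Ioi (Fin.last (N + 2)) = ∅ := by
      ext x
      simp [Fin.le_last]
    rw [hL.node (Fin.last _) z hz, nodeVec, h2, Finset.prod_empty, one_smul]
    rfl
  rw [h1 z hz, ← mirror_chain hΨ hz]
  unfold mirror
  rw [h1]
  simp only [Fin.rev_zero, Fin.rev_last, hz]
  ring

/-- The reflected point lies on node N + 2, and the last factor in the product of `nodeVec` becomes
g(z 0 − z 1) = g(−A) = 0. -/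
theorem IsInterpolation.mirror_node_two (hL : IsInterpolation A c Ψ L) {z : Fin (N + 4) → K}
    (h0 : z 0 = z 1 - A) (h1 : z (Fin.last _) = z 1 + A) : mirror L z = 0 := by
  unfold mirror
  have r : (Fin.last (N + 1)).castSucc.succ.rev = (1 : Fin (N + 4)) := by
    rw [Fin.rev_succ, Fin.rev_castSucc, Fin.rev_last]
    rfl
  rw [hL.node (Fin.last (N + 1)).castSucc]
  · unfold nodeVec
    rw [Finset.prod_eq_zero (i := Fin.last (N + 2)), zero_smul, map_zero]
    · simp [Fin.lt_def]
    · have : (Fin.last (N + 2)).succ.rev = (0 : Fin (N + 4)) := by simp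
      simp only [r, this]
      rw [gFun_eq_zero]
      left
      rw [h0]
      ring
  · rw [r, Fin.rev_zero, h1]
    ring

variable [Infinite K]

/-- Both sides have degree at most N + 2 in the last variable and are compared at the N + 3 points z
last = z i + A. For i = 0 this is the last node, and for i = 1 both sides vanish. For i ≥ 2 the
exchange relations reduce it to i = N + 2, which is `IsExchPair.corner`. -/
theorem IsExchPair.mirror_node (h : IsExchPair A c N Ψ' Ψ) (hA : A ≠ 0) (hc : c ≠ 0)
    (hL : IsInterpolation A c Ψ L) {z : Fin (N + 4) → K} (hz : z 0 = z 1 - A) :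
    mirror L z = nodeVec A c Ψ 0 z := by
  classical
  have hT := nodeVec_vDeg (A := A) (c := c) h.deg 0
  have hR := hL.deg.mirror
  have ht : IsPoly fun z : Fin (N + 4) → K => z 1 - A := (IsPoly.proj _).sub (IsPoly.const _)
  have hnode : ∀ z : Fin (N + 4) → K, z 0 = z 1 - A → L z = nodeVec A c Ψ 0 z := hL.node 0
  suffices H : ∀ z : Fin (N + 4) → K, (∀ i j, i ≠ j → ∀ δ ∈ ({0, A, -A, c} : Finset K),
      z i - z j ≠ δ) → mirror L (Function.update z 0 (z 1 - A)) =
        nodeVec A c Ψ 0 (Function.update z 0 (z 1 - A)) by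
    have := VPoly.eq_of_generic (hR.vPoly.update 0 ht) (hT.vPoly.update 0 ht) _ H z
    rwa [← hz, Function.update_eq_self] at this
  intro z hz
  set w := Function.update z 0 (z 1 - A) with hw
  have ws : ∀ k : Fin (N + 4), k ≠ 0 → w k = z k := fun k hk => Function.update_of_ne hk _ _
  have n10 : (1 : Fin (N + 4)) ≠ 0 := one_ne_zero
  have w0 : w 0 = w 1 - A := by rw [ws 1 n10, hw, Function.update_self]
  have hinj : ∀ i j : Fin (N + 4), i < j → w i ≠ w j := by
    intro i j hij e
    have hj : j ≠ 0 := (Fin.zero_le i |>.trans_lt hij).ne'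
    rcases eq_or_ne i 0 with rfl | hi
    · rcases eq_or_ne j 1 with rfl | hj1
      · rw [w0] at e
        exact hA (by linear_combination -e)
      · rw [w0, ws 1 n10, ws j hj] at e
        exact hz 1 j hj1.symm A (by simp) (by linear_combination e)
    · rw [ws i hi, ws j hj] at e
      exact hz i j hij.ne 0 (by simp) (by linear_combination e)
  have hl0 : Fin.last (N + 3) ≠ 0 := Fin.ne_of_val_ne (by simp)
  have hl1 : Fin.last (N + 3) ≠ 1 := by rw [ne_eq, Fin.ext_iff]; simp
  -- The larger degree at place 1 is harmless, since only the bound at the last place is used.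
  refine VDeg.eq_of_node_family (d := fun p => if p = 1 then 2 * (N + 2) else N + 2)
    (hR.mono fun p => ?_) (hT.mono fun p => ?_) w (Fin.last _) Finset.univ
    (fun i : Fin (N + 3) => w i.castSucc + A) ?_ ?_ ?_
  · split_ifs <;> omega
  · rcases eq_or_ne p 0 with rfl | h0
    · simp
    · rcases eq_or_ne p 1 with rfl | h1
      · simp
      · simp [h0, h1]
  · intro i _ j _ e
    by_contra hne
    rcases lt_or_gt_of_ne hne with hlt | hlt
    · exact hinj i.castSucc j.castSucc hlt (add_right_cancel e)
    · exact hinj j.castSucc i.castSucc hlt (add_right_cancel e).symm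
  · simp [hl1]
  · intro i _
    set v := Function.update w (Fin.last _) (w i.castSucc + A) with hv
    have vs : ∀ k : Fin (N + 4), k ≠ Fin.last _ → v k = w k :=
      fun k hk => Function.update_of_ne hk _ _
    have v0 : v 0 = v 1 - A := by rw [vs 0 hl0.symm, vs 1 hl1.symm, w0]
    have vl : v (Fin.last _) = v i.castSucc + A := by
      rw [vs _ (Fin.castSucc_lt_last i).ne, hv, Function.update_self]
    rcases eq_or_ne i 0 with rfl | hi0
    · rw [← hL.eq_mirror_last h.mirror_right, hnode v v0]
      rw [vl]
      simp
    rcases eq_or_ne i 1 with rfl | hi1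
    · have vl' : v (Fin.last _) = v 1 + A := vl
      rw [hL.mirror_node_two v0 vl', nodeVec_zero,
        Finset.prod_eq_zero (i := Fin.last (N + 1)) (Finset.mem_univ _), zero_smul]
      rw [gFun_eq_zero]
      left
      change v 1 - v (Fin.last _) = -A
      rw [vl']
      ring
    have hi : 2 ≤ (i : ℕ) := by
      have h0 := Fin.val_ne_of_ne hi0
      have h1 := Fin.val_ne_of_ne hi1
      rw [Fin.val_zero] at h0
      rw [Fin.val_one] at h1
      omega
    refine eq_of_exch_range (A := A) (c := c) (lo := 2) (hi := N + 2) (S := {-A, c})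
      (Q := fun z => z 0 = z 1 - A) (p := Fin.last _) (δ := A) (k := (Fin.last (N + 2)).castSucc)
      (k' := i.castSucc) ?_ ?_ (by simp) (by simp) ?_ (Or.inr (by simp)) ⟨by simp, by simp⟩
      ⟨by simpa using hi, by simp; omega⟩ ?_ ?_ v0 vl
    · intro i j h1 h2 h3
      exact hL.exch_mirror h2 h3
    · intro i j h1 h2 h3
      obtain ⟨a, rfl⟩ := Fin.exists_succ_eq.2 (show i ≠ 0 by rintro rfl; simp at h1)
      obtain ⟨b, rfl⟩ := Fin.exists_succ_eq.2 (show j ≠ 0 by rintro rfl; simp at h2)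
      simp only [Fin.val_succ] at h1 h2
      refine nodeVec_swap_of_ne hc h.exch (by omega) ?_ ?_ <;> rw [ne_eq, Fin.ext_iff] <;>
      simp <;> omega
    · intro z i j h1 h2 h3 h4
      simp only [Function.comp_apply]
      rw [swap_apply_of_ne_of_ne, swap_apply_of_ne_of_ne, h4] <;> rw [ne_eq, Fin.ext_iff] <;>
      simp <;> omega
    · intro z _ h2 h3
      exact h.corner hnode h2 h3
    · intro i j h1 h2 h3 h4 h5 hmem
      have e1 : ∀ i : Fin (N + 4), 2 ≤ (i : ℕ) → (i : ℕ) ≤ N + 2 → v i = z i := by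
        intro i h1 h2
        rw [vs i (Fin.ne_of_val_ne (by simp; omega)), 
          ws i (Fin.ne_of_val_ne (by rw [Fin.val_zero]; omega))]
      rw [e1 i h1 h2, e1 j h3 h4] at hmem
      rcases hmem with hm | hm
      · exact hz i j h5 (-A) (by simp) hm
      · exact hz i j h5 c (by simp) hm

/-- Both sides have degree at most N + 2 in z 0, so agreement at the N + 3 nodes suffices. The last
node is `eq_mirror_last`. The others are carried to the first one by exchanges among the places 1 to
N + 2, valid for both functions, and there `mirror_node` applies. -/
theorem IsExchPair.mirror_interpolation (h : IsExchPair A c N Ψ' Ψ) (hA : A ≠ 0) (hc : c ≠ 0)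
    (hL : IsInterpolation A c Ψ L) : mirror L = L := by
  classical
  funext z
  refine VPoly.eq_of_generic hL.deg.mirror.vPoly hL.deg.vPoly {0, -A, c} (fun z hz => ?_) z
  refine hL.deg.mirror.eq_of_node_family hL.deg z 0 Finset.univ
    (fun i : Fin (N + 3) => z i.succ - A) ?_ (by simp) ?_
  · intro i _ j _ e
    by_contra hne
    exact hz i.succ j.succ (by simpa using hne) 0 (by simp) (by linear_combination e)
  intro i _
  set w := Function.update z 0 (z i.succ - A) with hw
  have ws : ∀ k : Fin (N + 4), k ≠ 0 → w k = z k := fun k hk => Function.update_of_ne hk _ _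
  have w0 : w 0 = w i.succ + -A := by
    rw [ws _ (Fin.succ_ne_zero _), hw, Function.update_self, sub_eq_add_neg]
  rcases eq_or_ne i (Fin.last _) with rfl | hi
  · refine (hL.eq_mirror_last h.mirror_right ?_).symm
    rw [w0, sub_eq_add_neg]
    rfl
  have hi' : (i : ℕ) < N + 2 := by
    rw [ne_eq, Fin.ext_iff, Fin.val_last] at hi
    omega
  refine eq_of_exch_range (A := A) (c := c) (lo := 1) (hi := N + 2) (S := {-A, c})
    (Q := fun z => True) (p := 0) (δ := -A) (k := 1)
    (k' := i.succ) ?_ ?_ (by simp) (by simp) (fun _ _ _ _ _ _ _ => trivial) (Or.inl (by simp))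
    ⟨by simp, by simp⟩ ⟨by simp, by simp; omega⟩ ?_ ?_ trivial w0
  · intro i j h1 h2 h3
    exact hL.exch_mirror h2 h3
  · intro i j h1 h2 h3
    obtain ⟨a, rfl⟩ := Fin.exists_succ_eq.2 (show i ≠ 0 by rintro rfl; simp at h1)
    obtain ⟨b, rfl⟩ := Fin.exists_succ_eq.2 (show j ≠ 0 by rintro rfl; simp at h2)
    simp only [Fin.val_succ] at h1 h2
    exact hL.exch a b (by omega)
  · intro z _ _ h2
    rw [← sub_eq_add_neg] at h2
    rw [h.mirror_node hA hc hL h2, hL.node 0 z h2]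
  · intro i j h1 h2 h3 h4 h5 hmem
    rw [ws i (by rintro rfl; simp at h1), ws j (by rintro rfl; simp at h3)] at hmem
    rcases hmem with hm | hm
    · exact hz i j h5 (-A) (by simp) hm
    · exact hz i j h5 c (by simp) hm

theorem IsExchPair.exists_next (h : IsExchPair A c N Ψ' Ψ) (h2 : (2 : K) ≠ 0) (hA : A ≠ 0)
    (hc : c ≠ 0) : ∃ L, IsExchPair A c (N + 2) Ψ L := by
  obtain ⟨L, h3, h4, h5⟩ := exists_interpolation h2 hA hc h.exch h.deg rfl
  have hL : IsInterpolation A c Ψ L := ⟨h3, h4, h5⟩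
  have hm := h.mirror_interpolation hA hc hL
  refine ⟨L, ⟨fun i j hij => ?_, h3, fun z hz => ?_, h.mirror_right, hm⟩⟩
  · rcases Nat.lt_or_ge (N + 2) j with hj | hj
    · obtain ⟨a, rfl⟩ := Fin.exists_succ_eq.2 (show i ≠ 0 by rintro rfl; simp at hij; omega)
      obtain ⟨b, rfl⟩ := Fin.exists_succ_eq.2 (show j ≠ 0 by rintro rfl; simp at hij)
      simp only [Fin.val_succ] at hij
      exact hL.exch a b (by omega)
    · rw [← hm]
      exact hL.exch_mirror hij hj
  · rw [← nodeVec_zero]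
    exact h5 0 z hz

end Symmetry
end BrauerQKZ


namespace BrauerQKZ

open Equiv MvPolynomial

/-! ### Two places: the start of the induction -/

section Base

variable {K : Type} [Field K] {A c : K}

instance : Subsingleton (LinkPattern 0) := ⟨fun _ _ => LinkPattern.ext_apply fun k => k.elim0⟩

instance : Subsingleton (LinkPattern 2) := by
  refine ⟨fun π σ => LinkPattern.ext_apply fun k => ?_⟩
  have h1 := π.2.2 k
  have h2 := σ.2.2 k
  rw [ne_eq, Fin.ext_iff] at h1 h2
  rw [Fin.ext_iff]
  omega

/-- On a pattern with arc (i, j) both f and e act by scalars, and c(A−u) + u(A−u) + 2u(c−A) =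
(A+u)(c−u). -/
theorem rOp_single_of_apply (hc : c ≠ 0) {N : ℕ} {i j : Fin N} {π : LinkPattern N}
    (h : π.1 i = j) (u x : K) :
    rOp A c i j u (Finsupp.single π x) = gFun A c u • Finsupp.single π x := by
  rw [rOp_apply, conjOp_single, LinkPattern.conj_swap_of_apply h, eOp_single, if_pos h,
    LinkPattern.join_of_apply h,
    Finsupp.smul_single, Finsupp.smul_single, Finsupp.smul_single, Finsupp.smul_single,
    ← Finsupp.single_add, ← Finsupp.single_add]
  congr 1
  simp only [loopWeight, gFun, smul_eq_mul]
  field_simp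
  ring

/-- The empty link pattern. -/
def LinkPattern.empty : LinkPattern 0 := ⟨1, fun _ => rfl, fun k => k.elim0⟩

theorem conjOp_of_subsingleton {N : ℕ} [Subsingleton (LinkPattern N)] (s : Perm (Fin N))
    (x : LinkPattern N →₀ K) : conjOp K s x = x := by
  induction x using Finsupp.induction_linear with
  | zero => simp
  | add x y hx hy => simp only [map_add, hx, hy]
  | single π x => rw [conjOp_single, Subsingleton.elim (LinkPattern.conj s π) π]

theorem isExchPair_base (hc : c ≠ 0) :
    IsExchPair A c 0 (fun _ => Finsupp.single LinkPattern.empty 1)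
      (fun _ => arcOp K 0 (Finsupp.single LinkPattern.empty 1)) where
  exch i j hij z := by
    obtain rfl : i = 0 := by rw [Fin.ext_iff, Fin.val_zero]; omega
    obtain rfl : j = 1 := by rw [Fin.ext_iff, Fin.val_one]; simpa using hij.symm
    rw [arcOp_single, rOp_single_of_apply hc (LinkPattern.consArc_zero _)]
  deg π := HasDeg.const _ _
  node z hz := by simp
  mirror_left := by
    funext z
    exact conjOp_of_subsingleton _ _
  mirror_right := by
    funext z
    exact conjOp_of_subsingleton (N := 2) _ _

end Base

/-! ### Rotated arcs -/

section Rotate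

variable {N : ℕ} {K : Type} [Field K] {A c : K}

theorem finRotate_castSucc {n : ℕ} (k : Fin n) : finRotate (n + 1) k.castSucc = k.succ := by
  rw [Fin.ext_iff, coe_finRotate_of_ne_last (Fin.castSucc_lt_last k).ne, Fin.val_succ,
    Fin.val_castSucc]

theorem finRotate_inv_succ {n : ℕ} (k : Fin n) : (finRotate (n + 1))⁻¹ k.succ = k.castSucc := by
  rw [Perm.inv_eq_iff_eq, finRotate_castSucc]

theorem finRotate_inv_zero {n : ℕ} : (finRotate (n + 1))⁻¹ 0 = Fin.last n := by
  rw [Perm.inv_eq_iff_eq, finRotate_last]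

theorem arcPerm_one_mul_liftPerm :
    arcPerm (N + 2) 1 * liftPerm (finRotate (N + 2))⁻¹ =
      (finRotate (N + 4))⁻¹ * (swap 0 2 * swap 1 3) := by
  obtain ⟨t0, t1, t2, t3, t⟩ := blockSwap_apply (N := N)
  obtain ⟨a0, a1⟩ := arcPerm_zero_one (N := N + 2) (j := 1) (by omega)
  apply Equiv.ext
  apply forall_fin_add_two
  · rw [Perm.mul_apply, Perm.mul_apply, t0, liftPerm_zero, a0]
    exact (finRotate_inv_succ (n := N + 3) 1).symm
  · rw [Perm.mul_apply, Perm.mul_apply, t1, liftPerm_one, a1]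
    exact (finRotate_inv_succ (n := N + 3) 2).symm
  · intro k
    rw [Perm.mul_apply, liftPerm_succ_succ, arcPerm_succ_succ (by omega)]
    revert k
    apply forall_fin_add_two
    · rw [finRotate_inv_zero, if_neg (by simp)]
      rw [Perm.mul_apply]
      exact (congrArg _ t2).trans finRotate_inv_zero |>.symm
    · have : (finRotate (N + 2))⁻¹ 1 = 0 := finRotate_inv_succ 0
      rw [this, if_pos (by simp), Perm.mul_apply]
      exact ((congrArg _ t3).trans (finRotate_inv_succ (n := N + 3) 0)).symm
    · intro k
      rw [Perm.mul_apply, t, finRotate_inv_succ, finRotate_inv_succ, if_neg (by simp)]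
      rfl

/-- Either way the result has the arcs (0, last) and (1, 2) around and in front of the same inner
pattern; the permutations differ by an interchange of the two front arcs. -/
theorem conjOp_rotate_arcOp_arcOp (x : LinkPattern N →₀ K) :
    conjOp K (arcPerm (N + 2) 1) (arcOp K (N + 2) (conjOp K (finRotate (N + 2))⁻¹ (arcOp K N x))) =
      conjOp K (finRotate (N + 4))⁻¹ (arcOp K (N + 2) (arcOp K N x)) := by
  rw [← conjOp_liftPerm_arcOp, ← Module.End.mul_apply, ← conjOp_mul, arcPerm_one_mul_liftPerm,
    conjOp_mul, Module.End.mul_apply, conjOp_blockSwap_arcOp]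

end Rotate

/-! ### The value at z 1 = z 2 − A -/

section NodeOne

variable {N : ℕ} {K : Type} [Field K] {A c : K}
  {Ψ' : (Fin (N + 1) → K) → LinkPattern (N + 1) →₀ K}
  {Ψ : (Fin (N + 3) → K) → LinkPattern (N + 3) →₀ K}

/-- Two exchanges lead here from the node z 0 = z 1 − A and apply R_12, then R_01, to a front arc.
Crossing rewrites the first as R_01 on the arc at (1, 2), where unitarity cancels it against the
second, so no R-matrix remains. -/
theorem IsExchPair.node_one_of_ne (h : IsExchPair A c (N + 1) Ψ' Ψ) (hc : c ≠ 0)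
    {z : Fin (N + 3) → K} (hz : z 1 = z 2 - A) (h1 : gFun A c (z 1 - z 0) ≠ 0)
    (h2 : gFun A c (z 2 - z 0) ≠ 0) :
    Ψ z = (gFun A c (z 0 - z 1) * ∏ k : Fin N, gFun A c (z 2 - z k.succ.succ.succ)) •
      conjOp K (arcPerm (N + 1) 1) (arcOp K (N + 1)
        (Ψ' (Fin.cons (z 0) fun k => z k.succ.succ.succ))) := by
  have hne : ∀ i j : ℕ, i < 3 → j < 3 → i ≠ j → Fin.ofNat (N + 3) i ≠ Fin.ofNat (N + 3) j :=
    fun i j hi hj => ofNat_ne (by omega) (by omega)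
  have n01 : (0 : Fin (N + 3)) ≠ 1 := hne 0 1 (by omega) (by omega) (by omega)
  have n02 : (0 : Fin (N + 3)) ≠ 2 := hne 0 2 (by omega) (by omega) (by omega)
  have n12 : (1 : Fin (N + 3)) ≠ 2 := hne 1 2 (by omega) (by omega) (by omega)
  have v2 : ((2 : Fin (N + 3)) : ℕ) = 2 := Nat.mod_eq_of_lt (show 2 < N + 3 by omega)
  set y := (z ∘ swap 0 1) ∘ swap 1 2 with hy
  have y0 : y 0 = z 1 := by simp [hy, swap_apply_of_ne_of_ne n01 n02]
  have y1 : y 1 = z 2 := by simp [hy, swap_apply_of_ne_of_ne n02.symm n12.symm]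
  have y2 : y 2 = z 0 := by simp [hy]
  have y3 : ∀ k : Fin N, y k.succ.succ.succ = z k.succ.succ.succ := by
    intro k
    have hk : ∀ j < 3, k.succ.succ.succ ≠ Fin.ofNat (N + 3) j := fun j hj =>
      ne_ofNat (by omega) (by simp only [Fin.val_succ]; omega)
    have e1 : swap 1 2 k.succ.succ.succ = k.succ.succ.succ :=
      swap_apply_of_ne_of_ne (hk 1 (by omega)) (hk 2 (by omega))
    have e2 : swap 0 1 k.succ.succ.succ = k.succ.succ.succ :=
      swap_apply_of_ne_of_ne (hk 0 (by omega)) (hk 1 (by omega))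
    rw [hy, Function.comp_apply, Function.comp_apply, e1, e2]
  have hyn := h.node y (by rw [y0, y1, hz])
  have hyt : (fun k : Fin (N + 1) => y k.succ.succ) =
      Fin.cons (z 0) fun k => z k.succ.succ.succ := by
    funext k
    refine Fin.cases ?_ (fun k => ?_) k
    · exact y2
    · exact y3 k
  have hprod : ∏ k : Fin (N + 1), gFun A c (y 1 - y k.succ.succ) =
      gFun A c (z 2 - z 0) * ∏ k : Fin N, gFun A c (z 2 - z k.succ.succ.succ) := by
    rw [Fin.prod_univ_succ, y1]
    simp only [y3]
    rw [← y2]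
    rfl
  rw [hyt, hprod] at hyn
  have e1 := h.exch 1 2 (by rw [v2, Fin.val_one]) y
  rw [hy, comp_swap_comp_swap, ← hy, y1, y2, hyn] at e1
  have e2 := h.exch 0 1 (by simp) (z ∘ swap 0 1)
  rw [comp_swap_comp_swap] at e2
  simp only [Function.comp_apply, swap_apply_left, swap_apply_right] at e2
  have e3 := rOp_crossing A c (N := N + 1) (i := 0) (j := 1) (k := 2) n02 n12 (s := 1) rfl rfl
    (z 0 - z 1) (Ψ' (Fin.cons (z 0) fun k => z k.succ.succ.succ))
  have e4 : A - (z 0 - z 1) = z 2 - z 0 := by rw [hz]; ring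
  rw [e4, conjOp_one, Module.End.one_apply] at e3
  have e5 : arcPerm (N + 1) 1 = swap 0 1 * swap 1 2 * 1 := rfl
  rw [← e5] at e3
  have e6 := congrArg (fun T => T (conjOp K (arcPerm (N + 1) 1) (arcOp K (N + 1)
    (Ψ' (Fin.cons (z 0) fun k => z k.succ.succ.succ))))) (rOp_unitarity (A := A) hc n01 (z 1 - z 0))
  simp only [Module.End.mul_apply, neg_sub] at e6
  refine smul_right_injective _ (mul_ne_zero h1 h2) ?_
  simp only
  rw [mul_comm, mul_smul, e2, ← map_smul, e1, map_smul, map_smul, ← e3, e6]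
  simp only [LinearMap.smul_apply, Module.End.one_apply, smul_smul]
  congr 1
  ring

/-- The value at `z 1 = z 2 - A`. -/
theorem IsExchPair.node_one [Infinite K] (h : IsExchPair A c (N + 1) Ψ' Ψ) (hc : c ≠ 0)
    (hP : VPoly Ψ')
    {z : Fin (N + 3) → K} (hz : z 1 = z 2 - A) :
    Ψ z = (gFun A c (z 0 - z 1) * ∏ k : Fin N, gFun A c (z 2 - z k.succ.succ.succ)) •
      conjOp K (arcPerm (N + 1) 1) (arcOp K (N + 1)
        (Ψ' (Fin.cons (z 0) fun k => z k.succ.succ.succ))) := by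
  classical
  have ht : IsPoly fun z : Fin (N + 3) → K => z 2 - A := (IsPoly.proj _).sub (IsPoly.const _)
  have n12 : (2 : Fin (N + 3)) ≠ 1 :=
    ofNat_ne (i := 2) (j := 1) (by omega) (by omega) (by omega)
  have n02 : (2 : Fin (N + 3)) ≠ 0 :=
    ofNat_ne (i := 2) (j := 0) (by omega) (by omega) (by omega)
  have hG : VPoly fun z : Fin (N + 3) → K =>
      (gFun A c (z 0 - z 1) * ∏ k : Fin N, gFun A c (z 2 - z k.succ.succ.succ)) •
      conjOp K (arcPerm (N + 1) 1) (arcOp K (N + 1)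
        (Ψ' (Fin.cons (z 0) fun k => z k.succ.succ.succ))) := by
    refine VPoly.smul ((((IsPoly.proj 0).sub (IsPoly.proj 1)).gFun A c).mul
      (IsPoly.prod fun k _ => ((IsPoly.proj 2).sub (IsPoly.proj _)).gFun A c)) (VPoly.map
      (VPoly.map (hP.comp fun k => ?_) _) _)
    refine Fin.cases ?_ (fun k => ?_) k
    · exact IsPoly.proj 0
    · exact IsPoly.proj k.succ.succ.succ
  -- With z 1 = z 2 − A, the zeros of g(z 1 − z 0) are at z 2 − z 0 = 0 and c + A; those of g(z 2 −
  -- z 0) are at −A and c.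
  have := VPoly.eq_of_generic (h.deg.vPoly.update 1 ht) (hG.update 1 ht) {0, c + A, -A, c}
    (fun z hz => ?_) z
  · rwa [← hz, Function.update_eq_self] at this
  · have w1 : ∀ a, Function.update z 1 a 1 = a := fun a => Function.update_self _ _ _
    have w2 : ∀ a, Function.update z 1 a 2 = z 2 := fun a => Function.update_of_ne n12 _ _
    have w0 : ∀ a, Function.update z 1 a 0 = z 0 := fun a => Function.update_of_ne zero_ne_one _ _
    refine h.node_one_of_ne hc (by rw [w1, w2]) ?_ ?_
    · rw [w1, w0, ne_eq, gFun_eq_zero, not_or]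
      exact ⟨fun e => hz 2 0 n02 0 (by simp) (by linear_combination e),
        fun e => hz 2 0 n02 (c + A) (by simp) (by linear_combination e)⟩
    · rw [w2, w0, ne_eq, gFun_eq_zero, not_or]
      exact ⟨hz 2 0 n02 (-A) (by simp), hz 2 0 n02 c (by simp)⟩

end NodeOne
end BrauerQKZ


namespace BrauerQKZ

open Equiv MvPolynomial

/-! ### The value at z last = z 0 + A − c -/

section OuterNode

variable {N : ℕ} {K : Type} [Field K] {A c : K} {Ψ' : (Fin N → K) → LinkPattern N →₀ K}
  {Ψ : (Fin (N + 2) → K) → LinkPattern (N + 2) →₀ K}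
  {L : (Fin (N + 4) → K) → LinkPattern (N + 4) →₀ K}

/-- The vector `Ψ'` on the inner places, surrounded by an arc. -/
noncomputable def outerVec (A c : K) (Ψ' : (Fin N → K) → LinkPattern N →₀ K)
    (z : Fin (N + 2) → K) : LinkPattern (N + 2) →₀ K :=
  (∏ k : Fin N, gFun A c (z 0 - z k.succ.castSucc)) •
    conjOp K (finRotate (N + 2))⁻¹ (arcOp K N (Ψ' fun k => z k.succ.castSucc))

/-- The value at the place where the last variable is `z 0 + A - c`. -/
def OuterNode (A c : K) (Ψ' : (Fin N → K) → LinkPattern N →₀ K)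
    (Ψ : (Fin (N + 2) → K) → LinkPattern (N + 2) →₀ K) : Prop :=
  ∀ z : Fin (N + 2) → K, z (Fin.last _) = z 0 + A - c → Ψ z = outerVec A c Ψ' z

theorem succ_castSucc_injective : Function.Injective fun k : Fin N => k.succ.castSucc :=
  fun _ _ h => Fin.succ_injective _ (Fin.castSucc_injective _ h)

theorem outerVec_exch {a b : Fin N} (hΨ : Exch A c Ψ' a b) :
    Exch A c (outerVec A c Ψ') a.succ.castSucc b.succ.castSucc := by
  intro z
  have hs : ∀ k : Fin N, swap a.succ.castSucc b.succ.castSucc k.succ.castSucc =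
      (swap a b k).succ.castSucc := fun k => succ_castSucc_injective.swap_apply a b k
  have h0 : swap a.succ.castSucc b.succ.castSucc (0 : Fin (N + 2)) = 0 := by
    rw [swap_apply_of_ne_of_ne] <;> rw [ne_eq, Fin.ext_iff] <;> simp
  have h1 := hΨ fun k => z k.succ.castSucc
  have h2 : (fun k : Fin N => z k.succ.castSucc) ∘ swap a b =
      fun k => z (swap a b k).succ.castSucc := rfl
  rw [h2] at h1
  unfold outerVec
  simp only [Function.comp_apply, hs, h0]
  have h3 := conjOp_rOp A c (finRotate (N + 2))⁻¹ a.succ.succ b.succ.succ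
    (z a.succ.castSucc - z b.succ.castSucc)
  rw [finRotate_inv_succ, finRotate_inv_succ] at h3
  have h4 : ∏ k : Fin N, gFun A c (z 0 - z (swap a b k).succ.castSucc) =
      ∏ k : Fin N, gFun A c (z 0 - z k.succ.castSucc) :=
    Fintype.prod_equiv (swap a b) _ _ fun k => rfl
  rw [h4, smul_comm, map_smul]
  congr 1
  rw [← map_smul, ← map_smul, h1, ← Module.End.mul_apply, ← h3, Module.End.mul_apply, rOp_arcOp]

theorem sum_single_le {ι σ : Type*} [Fintype ι] [DecidableEq ι] [DecidableEq σ] {e : ι → σ}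
    (he : Function.Injective e) (m : ℕ) (p : σ) : ∑ k, (Pi.single (e k) m : σ → ℕ) p ≤ m := by
  by_cases h : ∃ k, e k = p
  · obtain ⟨k, rfl⟩ := h
    simp [Pi.single_apply, he.eq_iff]
  · rw [Finset.sum_eq_zero]
    · exact Nat.zero_le _
    · intro k _
      rw [Pi.single_apply, if_neg]
      exact fun e => h ⟨k, e.symm⟩

theorem outerVec_vDeg {D : ℕ} (hD : VDeg Ψ' fun _ => D) :
    VDeg (outerVec A c Ψ') fun p => if p = 0 then 2 * N + 2 + D else 2 + D := by
  have h1 : ∀ k ∈ Finset.univ, HasDeg (fun z : Fin (N + 2) → K => gFun A c (z 0 - z k.succ.castSucc))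
      (Pi.single 0 2 + Pi.single (k : Fin N).succ.castSucc 2) := by
    intro k _
    have h2 : HasDeg (fun z : Fin (N + 2) → K => z 0 - z k.succ.castSucc)
        (Pi.single 0 1 + Pi.single k.succ.castSucc 1) :=
      ((HasDeg.proj 0).mono (by simp)).sub ((HasDeg.proj k.succ.castSucc).mono (by simp))
    refine (h2.gFun A c).mono fun p => ?_
    simp only [Pi.add_apply, Pi.single_apply]
    split_ifs <;> omega
  refine (VDeg.smul (HasDeg.prod h1) (((hD.comp_injective succ_castSucc_injective
    (d' := fun _ => D) fun _ => le_rfl).map _).map _)).mono fun p => ?_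
  have h3 := sum_single_le (succ_castSucc_injective (N := N)) 2 p
  simp only [Finset.sum_add_distrib, Pi.add_apply, Finset.sum_apply, Finset.sum_const,
    Finset.card_univ, Fintype.card_fin, Pi.smul_apply, smul_eq_mul, Pi.single_apply] at h3 ⊢
  split_ifs <;> omega

/-- The crossing symmetry of g, which matches the factors of the two arc ends in `outer_corner`. -/
theorem gFun_sub (A c v : K) : gFun A c (c - A - v) = gFun A c v := by
  unfold gFun
  ring

/-- Exchanges carry z last = z 1 + A to z last = z (N+2) + A, where the last-node formula contains
g(z 0 − z (N+2)) = g(c) = 0. -/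
theorem IsExchPair.eq_zero_of_outer (h : IsExchPair A c (N + 2) Ψ L) {z : Fin (N + 4) → K}
    (hz : GenericOn {-A, c} 1 (N + 2) z) (h1 : z 0 = z (Fin.last _) + c - A)
    (h2 : z (Fin.last _) = z 1 + A) : L z = 0 := by
  refine eq_of_exch_range (A := A) (c := c) (G := fun _ => 0) (lo := 1) (hi := N + 2) (S := {-A, c})
    (Q := fun z => z 0 = z (Fin.last _) + c - A) (p := Fin.last _) (δ := A)
    (k := (Fin.last (N + 2)).castSucc) (k' := 1) (fun i j _ hij _ => h.exch i j hij)
    (fun i j _ _ _ z => by simp) (by simp) (by simp) ?_ (Or.inr (by simp)) ⟨by simp, by simp⟩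
    ⟨by simp, by simp⟩ ?_ hz h1 h2
  · intro z i j h1 h2 h3 h4
    simp only [Function.comp_apply]
    rw [swap_apply_of_ne_of_ne, swap_apply_of_ne_of_ne, h4] <;> rw [ne_eq, Fin.ext_iff] <;>
    simp <;> omega
  · intro z _ h1 h2
    rw [h.node_last z h2, Finset.prod_eq_zero (i := 0) (Finset.mem_univ _), zero_smul]
    rw [gFun_eq_zero]
    right
    change z 0 - _ = c
    rw [h1, h2]
    ring

variable [Infinite K]

/-- At both specialisations each side becomes Ψ' with the arcs (1, 2) and (0, last): on the left by
`node_one` and then the outer formula for Ψ, on the right by the node formula inside `outerVec`. -/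
theorem IsExchPair.outer_corner (h0 : IsExchPair A c N Ψ' Ψ) (h : IsExchPair A c (N + 2) Ψ L)
    (ho : OuterNode A c Ψ' Ψ) (hc : c ≠ 0) {z : Fin (N + 4) → K} (h1 : z 1 = z 2 - A)
    (h2 : z (Fin.last _) = z 0 + A - c) : L z = outerVec A c Ψ z := by
  have e1 := ho (Fin.cons (z 0) fun k => z k.succ.succ.succ) h2
  have e2 := h0.node (fun k => z k.succ.castSucc) h1
  rw [h.node_one (N := N + 1) hc h0.deg.vPoly h1, e1]
  unfold outerVec
  rw [e2, map_smul, map_smul, map_smul, map_smul, smul_smul, smul_smul]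
  change _ • conjOp K (arcPerm (N + 2) 1) (arcOp K (N + 2) (conjOp K (finRotate (N + 2))⁻¹
    (arcOp K N (Ψ' fun k => z k.succ.succ.succ.castSucc)))) = _
  rw [conjOp_rotate_arcOp_arcOp]
  congr 1
  have e3 : z 2 - z (Fin.last _) = c - A - (z 0 - z 2) := by
    rw [h2]
    ring
  rw [Fin.prod_univ_castSucc (n := N), Fin.prod_univ_succ (n := N + 1), Fin.prod_univ_succ (n := N)]
  change gFun A c (z 0 - z 1) * ((∏ k : Fin N, gFun A c (z 2 - z k.succ.succ.succ.castSucc)) *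
      gFun A c (z 2 - z (Fin.last _))) *
      (∏ k : Fin N, gFun A c (z 0 - z k.succ.succ.succ.castSucc)) =
    (gFun A c (z 0 - z 1) * (gFun A c (z 0 - z 2) *
      ∏ k : Fin N, gFun A c (z 0 - z k.succ.succ.succ.castSucc))) *
      ∏ k : Fin N, gFun A c (z 2 - z k.succ.succ.succ.castSucc)
  rw [e3, gFun_sub]
  ring

/-- Interpolation in z 1, where both sides have degree at most N + 2. Both vanish at z 1 = z 0 + A
and z 1 = z 0 − c. At z 1 = z k − A with 2 ≤ k ≤ N + 2, exchanges reduce the claim to k = 2, which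
is `outer_corner`. -/
theorem IsExchPair.outerNode_next (h0 : IsExchPair A c N Ψ' Ψ) (h : IsExchPair A c (N + 2) Ψ L)
    (ho : OuterNode A c Ψ' Ψ) (hc : c ≠ 0) (hAc : A + c ≠ 0) : OuterNode A c Ψ L := by
  classical
  intro z hz
  have hT := outerVec_vDeg (A := A) (c := c) h0.deg
  have ht : IsPoly fun z : Fin (N + 4) → K => z 0 + A - c :=
    ((IsPoly.proj _).add (IsPoly.const _)).sub (IsPoly.const _)
  -- The excluded differences keep the nodes distinct and the exchange coefficients nonzero at each
  -- specialised point.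
  suffices H : ∀ z : Fin (N + 4) → K, (∀ i j, i ≠ j → ∀ δ ∈ ({0, A + A, A - c, -A, c, c - A, c + c,
      -A - c} : Finset K), z i - z j ≠ δ) → L (Function.update z (Fin.last _) (z 0 + A - c)) =
        outerVec A c Ψ (Function.update z (Fin.last _) (z 0 + A - c)) by
    have := VPoly.eq_of_generic (h.deg.vPoly.update (Fin.last _) ht)
      (hT.vPoly.update (Fin.last _) ht) _ H z
    rwa [← hz, Function.update_eq_self] at this
  clear hz z
  intro z hz
  set w := Function.update z (Fin.last _) (z 0 + A - c) with hw
  have hl0 : Fin.last (N + 3) ≠ 0 := Fin.ne_of_val_ne (by simp)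
  have hl1 : Fin.last (N + 3) ≠ 1 := Fin.ne_of_val_ne (by simp)
  have ws : ∀ k : Fin (N + 4), k ≠ Fin.last _ → w k = z k := fun k hk => Function.update_of_ne hk _ _
  have wl : w (Fin.last _) = w 0 + A - c := by rw [ws 0 hl0.symm, hw, Function.update_self]
  have w0 : w 0 = z 0 := ws 0 hl0.symm
  have wk : ∀ k : Fin (N + 1), w k.succ.succ.castSucc = z k.succ.succ.castSucc :=
    fun k => ws _ (Fin.castSucc_lt_last _).ne
  have nk : ∀ k : Fin (N + 1), k.succ.succ.castSucc ≠ 0 := fun k => Fin.ne_of_val_ne (by simp)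
  -- These are N + 3 nodes, one more than the degree; A + c ≠ 0 separates the first two.
  let t : Fin (N + 3) → K :=
    Fin.cons (w 0 + A) (Fin.cons (w 0 - c) fun k : Fin (N + 1) => w k.succ.succ.castSucc - A)
  have htinj : Function.Injective t := by
    refine Fin.cons_injective_iff.2 ⟨?_, Fin.cons_injective_iff.2 ⟨?_, ?_⟩⟩
    · rintro ⟨i, hi⟩
      revert hi
      refine Fin.cases (fun hi => ?_) (fun k hi => ?_) i
      · rw [Fin.cons_zero] at hi
        exact hAc (by linear_combination -hi)
      · rw [Fin.cons_succ, w0, wk] at hi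
        exact hz _ 0 (nk k) (A + A) (by simp) (by linear_combination hi)
    · rintro ⟨k, hi⟩
      simp only [w0, wk] at hi
      exact hz _ 0 (nk k) (A - c) (by simp) (by linear_combination hi)
    · intro i j hij
      by_contra hne
      simp only [wk] at hij
      exact hz i.succ.succ.castSucc j.succ.succ.castSucc (by simpa using hne) 0 (by simp)
        (by linear_combination hij)
  have hgen : ∀ i j : Fin (N + 4), i ≠ j → z i - z j ∉ ({-A, c} : Set K) := by
    rintro i j hij (hm | hm)
    · exact hz i j hij (-A) (by simp) hm
    · exact hz i j hij c (by simp) hm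
  refine VDeg.eq_of_node_family (d := fun p => if p = 0 then 2 * (N + 2) + 2 + N else 2 + N)
    (h.deg.mono fun p => ?_) hT w 1 Finset.univ t htinj.injOn ?_ ?_
  · split_ifs <;> omega
  · rw [if_neg one_ne_zero, Finset.card_univ, Fintype.card_fin]
    omega
  intro i _
  set v := Function.update w 1 (t i) with hv
  have vs : ∀ k : Fin (N + 4), k ≠ 1 → v k = w k := fun k hk => Function.update_of_ne hk _ _
  have v1 : v 1 = t i := Function.update_self _ _ _
  have v0 : v 0 = w 0 := vs 0 zero_ne_one
  have vl : v (Fin.last _) = v 0 + A - c := by rw [vs _ hl1, v0, wl]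
  have hzero : gFun A c (v 0 - v 1) = 0 → outerVec A c Ψ v = 0 := by
    intro h
    unfold outerVec
    rw [Finset.prod_eq_zero (i := 0) (Finset.mem_univ _), zero_smul]
    exact h
  clear_value v
  revert v1
  refine forall_fin_add_two (P := fun i => v 1 = t i → L v = outerVec A c Ψ v) ?_ ?_ ?_ i
  · intro (v1 : v 1 = w 0 + A)
    -- Here `outerVec` contains g(−A), and the node formula for L contains g(z 1 − z last) = g(c).
    rw [hzero, h.node v (by rw [v0, v1]; ring),
      Finset.prod_eq_zero (i := Fin.last _) (Finset.mem_univ _), zero_smul]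
    · rw [gFun_eq_zero]
      right
      change v 1 - v (Fin.last _) = c
      rw [vl, v1, v0]
      ring
    · rw [gFun_eq_zero, v0, v1]
      left
      ring
  · intro (v1 : v 1 = w 0 - c)
    rw [hzero, h.eq_zero_of_outer ?_ (by rw [vl]; ring) (by rw [vl, v1, v0]; ring)]
    swap
    · rw [gFun_eq_zero, v0, v1]
      right
      ring
    · have e1 : ∀ i : Fin (N + 4), 1 ≤ (i : ℕ) → (i : ℕ) ≤ N + 2 → i ≠ 1 → v i = z i := by
        intro i h1 h2 h3
        rw [vs i h3, ws i (Fin.ne_of_val_ne (by simp; omega))]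
      intro i j h1 h2 h3 h4 h5
      rcases eq_or_ne i 1 with rfl | hi
      · have hj0 : (0 : Fin (N + 4)) ≠ j := Fin.ne_of_val_ne (by rw [Fin.val_zero]; omega)
        rw [v1, e1 j h3 h4 h5.symm, w0]
        rintro (hm | hm)
        · exact hz 0 j hj0 (c - A) (by simp) (by linear_combination hm)
        · rw [Set.mem_singleton_iff] at hm
          exact hz 0 j hj0 (c + c) (by simp) (by linear_combination hm)
      · have hi0 : i ≠ (0 : Fin (N + 4)) := Fin.ne_of_val_ne (by rw [Fin.val_zero]; omega)
        rcases eq_or_ne j 1 with rfl | hj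
        · rw [v1, e1 i h1 h2 hi, w0]
          rintro (hm | hm)
          · exact hz i 0 hi0 (-A - c) (by simp) (by linear_combination hm)
          · rw [Set.mem_singleton_iff] at hm
            exact hz i 0 hi0 0 (by simp) (by linear_combination hm)
        · rw [e1 i h1 h2 hi, e1 j h3 h4 hj]
          exact hgen i j h5
  · intro k (v1 : v 1 = w k.succ.succ.castSucc - A)
    have hk1 : k.succ.succ.castSucc ≠ (1 : Fin (N + 4)) := Fin.ne_of_val_ne (by simp)
    have v2 : ((2 : Fin (N + 4)) : ℕ) = 2 := Nat.mod_eq_of_lt (show 2 < N + 4 by omega)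
    refine eq_of_exch_range (A := A) (c := c) (lo := 2) (hi := N + 2) (S := {-A, c})
      (Q := fun z => z (Fin.last _) = z 0 + A - c) (p := 1) (δ := -A) (k := 2)
      (k' := k.succ.succ.castSucc) (fun i j _ hij _ => h.exch i j hij) ?_ (by simp) (by simp) ?_
      (Or.inl (by simp)) ⟨by rw [v2], by rw [v2]; omega⟩ ⟨by simp, by simp; omega⟩ ?_ ?_ vl
      (by rw [v1, vs _ hk1, sub_eq_add_neg])
    · intro i j h1 h2 h3
      obtain ⟨a, rfl⟩ : ∃ a : Fin (N + 2), i = a.succ.castSucc :=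
        ⟨⟨i - 1, by omega⟩, Fin.ext (by simp; omega)⟩
      obtain ⟨b, rfl⟩ : ∃ b : Fin (N + 2), j = b.succ.castSucc :=
        ⟨⟨j - 1, by omega⟩, Fin.ext (by simp; omega)⟩
      exact outerVec_exch (h0.exch a b (by simpa using h2))
    · intro z i j h1 h2 h3 h4
      simp only [Function.comp_apply]
      rw [swap_apply_of_ne_of_ne, swap_apply_of_ne_of_ne, h4] <;> rw [ne_eq, Fin.ext_iff] <;>
      simp <;> omega
    · intro z _ h1 h2
      exact h0.outer_corner h ho hc (by rw [h2, sub_eq_add_neg]) h1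
    · have e1 : ∀ i : Fin (N + 4), 2 ≤ (i : ℕ) → (i : ℕ) ≤ N + 2 → v i = z i := by
        intro i h1 h2
        rw [vs i (Fin.ne_of_val_ne (by rw [Fin.val_one]; omega)),
          ws i (Fin.ne_of_val_ne (by simp; omega))]
      intro i j h1 h2 h3 h4 h5
      rw [e1 i h1 h2, e1 j h3 h4]
      exact hgen i j h5

end OuterNode
end BrauerQKZ


namespace BrauerQKZ

open Equiv MvPolynomial

/-! ### Cyclicity and the existence of solutions over a field -/

section Cyclic

variable {N : ℕ} {K : Type} [Field K] {A c : K} {Ψ' : (Fin N → K) → LinkPattern N →₀ K}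
  {Ψ : (Fin (N + 2) → K) → LinkPattern (N + 2) →₀ K}

/-- The cyclic shift of the variables, where the first one returns with `ε` added. -/
def rotPoint {n : ℕ} (ε : K) (z : Fin n → K) : Fin n → K :=
  fun k => z (finRotate n k) + if (k : ℕ) + 1 = n then ε else 0

theorem rotPoint_castSucc {n : ℕ} (ε : K) (z : Fin (n + 1) → K) (k : Fin n) :
    rotPoint ε z k.castSucc = z k.succ := by
  unfold rotPoint
  rw [finRotate_castSucc, if_neg (by simp; omega), add_zero]

theorem rotPoint_last {n : ℕ} (ε : K) (z : Fin (n + 1) → K) :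
    rotPoint ε z (Fin.last n) = z 0 + ε := by
  unfold rotPoint
  rw [finRotate_last, if_pos (by simp)]

theorem rotPoint_comp_swap {n : ℕ} (ε : K) (z : Fin (n + 1) → K) (a b : Fin n) :
    rotPoint ε (z ∘ swap a.succ b.succ) = rotPoint ε z ∘ swap a.castSucc b.castSucc := by
  funext k
  refine Fin.lastCases ?_ (fun k => ?_) k
  · rw [rotPoint_last, Function.comp_apply, Function.comp_apply,
      swap_apply_of_ne_of_ne (Fin.succ_ne_zero a).symm (Fin.succ_ne_zero b).symm,
      swap_apply_of_ne_of_ne (Fin.castSucc_lt_last a).ne' (Fin.castSucc_lt_last b).ne',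
      rotPoint_last]
  · rw [rotPoint_castSucc, Function.comp_apply, Function.comp_apply,
      (Fin.succ_injective _).swap_apply, (Fin.castSucc_injective _).swap_apply, rotPoint_castSucc]

/-- Both sides have degree N in z 0 and satisfy the exchange relations among the places ≥ 1, so they
need only be compared at z 0 = z 1 − A. There the left side is given by the node formula. On the
right, with ε = 2A − c, the new last variable is z 1 + A − c, so the outer formula applies and the
rotation opens its arc to the front. -/
theorem IsExchPair.cyclic [Infinite K] (h : IsExchPair A c N Ψ' Ψ) (ho : OuterNode A c Ψ' Ψ)
    (z : Fin (N + 2) → K) :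
    Ψ z = conjOp K (finRotate (N + 2)) (Ψ (rotPoint (A + A - c) z)) := by
  classical
  set G : (Fin (N + 2) → K) → LinkPattern (N + 2) →₀ K := fun z =>
    conjOp K (finRotate (N + 2)) (Ψ (rotPoint (A + A - c) z)) with hG
  have hGd : VDeg G fun _ => N := by
    refine VDeg.map (F := fun z => Ψ (rotPoint (A + A - c) z)) (fun π => ?_) _
    have := ((h.deg π).comp_affine 1 fun k => if (k : ℕ) + 1 = N + 2 then A + A - c else 0
      ).comp_injective (finRotate (N + 2)).injective (d' := fun _ => N) fun _ => le_rfl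
    simp only [Pi.one_apply, one_mul] at this
    exact this
  have hGe : ∀ i j : Fin (N + 2), 1 ≤ (i : ℕ) → (i : ℕ) + 1 = j → Exch A c G i j := by
    intro i j h1 h2 z
    obtain ⟨a, rfl⟩ := Fin.exists_succ_eq.2 (show i ≠ 0 by rintro rfl; simp at h1)
    obtain ⟨b, rfl⟩ := Fin.exists_succ_eq.2 (show j ≠ 0 by rintro rfl; simp at h2)
    have h3 := h.exch a.castSucc b.castSucc (by simpa using h2) (rotPoint (A + A - c) z)
    have h4 := conjOp_rOp A c (finRotate (N + 2)) a.castSucc b.castSucc (z a.succ - z b.succ)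
    rw [finRotate_castSucc, finRotate_castSucc] at h4
    rw [rotPoint_castSucc, rotPoint_castSucc, ← rotPoint_comp_swap] at h3
    simp only [hG]
    rw [← map_smul, h3, ← Module.End.mul_apply, h4, Module.End.mul_apply]
  change Ψ z = G z
  refine VPoly.eq_of_generic h.deg.vPoly hGd.vPoly {0, -A, c} (fun z hz => ?_) z
  refine h.deg.eq_of_node_family hGd z 0 Finset.univ
    (fun i : Fin (N + 1) => z i.succ - A) ?_ (by simp) ?_
  · intro i _ j _ e
    by_contra hne
    exact hz i.succ j.succ (by simpa using hne) 0 (by simp) (by linear_combination e)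
  intro i _
  set w := Function.update z 0 (z i.succ - A) with hw
  have ws : ∀ k : Fin (N + 2), k ≠ 0 → w k = z k := fun k hk => Function.update_of_ne hk _ _
  have w0 : w 0 = w i.succ + -A := by
    rw [ws _ (Fin.succ_ne_zero _), hw, Function.update_self, sub_eq_add_neg]
  refine eq_of_exch_range (A := A) (c := c) (lo := 1) (hi := N + 1) (S := {-A, c})
    (Q := fun z => True) (p := 0) (δ := -A) (k := 1)
    (k' := i.succ) (fun i j _ hij _ => h.exch i j hij) (fun i j h1 hij _ => hGe i j h1 hij)
    (by simp) (by simp) (fun _ _ _ _ _ _ _ => trivial) (Or.inl (by simp))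
    ⟨by simp, by simp⟩ ⟨by simp, by simp; omega⟩ ?_ ?_ trivial w0
  · intro z _ _ h2
    have r0 : rotPoint (A + A - c) z 0 = z 1 := rotPoint_castSucc _ z 0
    have e1 := ho (rotPoint (A + A - c) z) (by
      rw [rotPoint_last, r0, h2]
      ring)
    simp only [hG]
    rw [h.node z (by rw [h2, sub_eq_add_neg]), e1, outerVec, map_smul, ← Module.End.mul_apply,
      ← conjOp_mul, mul_inv_cancel, conjOp_one, Module.End.one_apply, r0]
    simp only [rotPoint_castSucc]
  · intro i j h1 h2 h3 h4 h5 hmem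
    rw [ws i (by rintro rfl; simp at h1), ws j (by rintro rfl; simp at h3)] at hmem
    rcases hmem with hm | hm
    · exact hz i j h5 (-A) (by simp) hm
    · exact hz i j h5 c (by simp) hm

theorem exists_eval_gFun_ne_zero [Infinite K] (A c : K) {n : ℕ} (z : Fin n → K) :
    ∃ t, ∀ k, gFun A c (t - z k) ≠ 0 := by
  classical
  obtain ⟨t, ht⟩ := Infinite.exists_notMem_finset
    (Finset.univ.image (fun k => z k - A) ∪ Finset.univ.image fun k => z k + c)
  simp only [Finset.mem_union, Finset.mem_image, Finset.mem_univ, true_and, not_or,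
    not_exists] at ht
  refine ⟨t, fun k hk => ?_⟩
  rcases gFun_eq_zero.1 hk with h | h
  · exact ht.1 k (by linear_combination -h)
  · exact ht.2 k (by linear_combination -h)

theorem exists_isExchPair [Infinite K] (h2 : (2 : K) ≠ 0) (hA : A ≠ 0) (hc : c ≠ 0)
    (hAc : A + c ≠ 0) (n : ℕ) :
    ∃ (Ψ' : (Fin (2 * n) → K) → LinkPattern (2 * n) →₀ K)
      (Ψ : (Fin (2 * n + 2) → K) → LinkPattern (2 * n + 2) →₀ K),
      IsExchPair A c (2 * n) Ψ' Ψ ∧ OuterNode A c Ψ' Ψ ∧ ∃ z, Ψ z ≠ 0 := by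
  induction n with
  | zero =>
    refine ⟨_, _, isExchPair_base hc, fun z _ => ?_, 0, ?_⟩
    · rw [outerVec, conjOp_of_subsingleton (N := 2)]
      simp
    · rw [ne_eq, map_eq_zero_iff _ arcOp_injective]
      simp
  | succ n ih =>
    obtain ⟨Ψ', Ψ, h, ho, z, hz⟩ := ih
    obtain ⟨L, hL⟩ := h.exists_next h2 hA hc
    refine ⟨Ψ, L, hL, h.outerNode_next hL ho hc hAc, ?_⟩
    obtain ⟨t, ht⟩ := exists_eval_gFun_ne_zero A c z
    -- A point of the first node at which no g-factor vanishes; nonvanishing thus passes from Ψ to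
    -- L.
    refine ⟨Fin.cons (t - A) (Fin.cons t z), ?_⟩
    rw [hL.node _ rfl]
    exact smul_ne_zero (Finset.prod_ne_zero_iff.2 fun k _ => ht k)
      ((map_ne_zero_iff _ arcOp_injective).2 hz)

end Cyclic
end BrauerQKZ


namespace BrauerQKZ

open Equiv MvPolynomial

/-! ### Exchange relations for components without the small arc -/

section WeakSolution

variable {N : ℕ} {K : Type} [Field K] {A c ε : K}

theorem conjOp_apply (s : Perm (Fin N)) (x : LinkPattern N →₀ K) (π : LinkPattern N) :
    conjOp K s x π = x (LinkPattern.conj s⁻¹ π) := by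
  classical
  have h : π = LinkPattern.conj s (LinkPattern.conj s⁻¹ π) := by
    rw [LinkPattern.conj_conj, mul_inv_cancel, LinkPattern.conj_one]
  induction x using Finsupp.induction_linear with
  | zero => simp
  | add x y hx hy => simp only [map_add, Finsupp.add_apply, hx, hy]
  | single ρ a =>
    rw [conjOp_single]
    conv_lhs => rw [h]
    rw [Finsupp.single_apply, Finsupp.single_apply]
    simp only [(LinkPattern.conj s).injective.eq_iff]

theorem eOp_apply_of_ne (β : K) {i j : Fin N} (hij : i ≠ j) {π : LinkPattern N} (h : π.1 i ≠ j)
    (x : LinkPattern N →₀ K) : eOp β i j x π = 0 := by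
  classical
  induction x using Finsupp.induction_linear with
  | zero => simp
  | add x y hx hy => simp only [map_add, Finsupp.add_apply, hx, hy, add_zero]
  | single ρ a =>
    rw [eOp_single, Finsupp.single_apply, if_neg]
    rintro rfl
    exact h (LinkPattern.join_left hij ρ)

theorem rOp_apply_of_ne (A c : K) {i j : Fin N} (hij : i ≠ j) {π : LinkPattern N} (h : π.1 i ≠ j)
    (u : K) (x : LinkPattern N →₀ K) :
    rOp A c i j u x π =
      (A - u) * (c * x π + u * x (LinkPattern.conj (swap i j) π)) := by
  rw [rOp_apply, Finsupp.add_apply, Finsupp.add_apply, Finsupp.smul_apply, Finsupp.smul_apply,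
    Finsupp.smul_apply, eOp_apply_of_ne _ hij h, conjOp_apply, swap_inv, smul_zero, smul_eq_mul,
    smul_eq_mul]
  ring

/-- Polynomial functions that satisfy the exchange relations without cups, and the cyclicity. -/
structure IsWeakSolution (A c ε : K) (f : LinkPattern N → (Fin N → K) → K) : Prop where
  isPoly : ∀ π, IsPoly (f π)
  exch : ∀ i j : Fin N, (i : ℕ) + 1 = j → ∀ π : LinkPattern N, π.1 i ≠ j → ∀ z : Fin N → K,
    gFun A c (z i - z j) * f π (z ∘ swap i j) =
      (A - (z i - z j)) * (c * f π z + (z i - z j) * f (LinkPattern.conj (swap i j) π) z)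
  cyc : ∀ π z, f π z = f (LinkPattern.conj (finRotate N)⁻¹ π) (rotPoint ε z)

variable {f : LinkPattern N → (Fin N → K) → K}

/-- At u = −A the left side vanishes and the relation reads c Ψ_π = A Ψ_σ, where σ is the conjugate
of π. The same holds with π and σ interchanged, so (c² − A²) Ψ_π = 0. -/
theorem IsWeakSolution.eq_zero_of_adjacent (h : IsWeakSolution A c ε f) (h2 : (2 : K) ≠ 0)
    (hA : A ≠ 0) (hcA : c ^ 2 ≠ A ^ 2) {i j : Fin N} (hij : (i : ℕ) + 1 = j) {π : LinkPattern N}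
    (hπ : π.1 i ≠ j) {z : Fin N → K} (hz : z j = z i + A) : f π z = 0 := by
  have hne : i ≠ j := by rintro rfl; omega
  have hu : z i - z j = -A := by rw [hz]; ring
  have hg : gFun A c (-A) = 0 := gFun_eq_zero.2 (Or.inl rfl)
  have key : ∀ π : LinkPattern N, π.1 i ≠ j →
      c * f π z = A * f (LinkPattern.conj (swap i j) π) z := by
    intro π hπ
    have h1 := h.exch i j hij π hπ z
    rw [hu, hg, zero_mul] at h1
    have h3 : A - -A ≠ 0 := by
      rw [sub_neg_eq_add, ← two_mul]
      exact mul_ne_zero h2 hA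
    linear_combination (mul_eq_zero.1 h1.symm).resolve_left h3
  have h1 := key π hπ
  have h4 : (LinkPattern.conj (swap i j) π).1 i ≠ j := by
    intro e
    have := LinkPattern.conj_apply_apply (swap i j) π j
    rw [swap_apply_right, e] at this
    have h5 : π.1 j = i := by
      have := congrArg (swap i j) this
      simpa using this.symm
    exact hπ (π.apply_eq_iff.1 h5)
  have h3 := key _ h4
  rw [LinkPattern.conj_conj, swap_mul_self, LinkPattern.conj_one] at h3
  have h5 : (c ^ 2 - A ^ 2) * f π z = 0 := by linear_combination c * h1 + A * h3
  exact (mul_eq_zero.1 h5).resolve_left (sub_ne_zero.2 hcA)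

/-- A component vanishes at `z j = z i + A` if its pattern has no arc between places from `i`
to `j`. -/
theorem IsWeakSolution.eq_zero_of_no_arc [Infinite K] (h : IsWeakSolution A c ε f)
    (h2 : (2 : K) ≠ 0) (hA : A ≠ 0) (hcA : c ^ 2 ≠ A ^ 2) (d : ℕ) (i j : Fin N)
    (hij : (i : ℕ) + 1 + d = j) (π : LinkPattern N)
    (hπ : ∀ k l : Fin N, i ≤ k → k ≤ j → i ≤ l → l ≤ j → π.1 k ≠ l) (z : Fin N → K)
    (hz : z j = z i + A) : f π z = 0 := by
  classical
  induction d generalizing j π z with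
  | zero =>
    exact h.eq_zero_of_adjacent h2 hA hcA hij
      (hπ i j le_rfl (Fin.le_def.2 (by omega)) (Fin.le_def.2 (by omega)) le_rfl) hz
  | succ d ih =>
    obtain ⟨m, hm⟩ : ∃ m : Fin N, (m : ℕ) + 1 = j := ⟨⟨j - 1, by omega⟩, by simp; omega⟩
    have him : i ≠ m := by rw [ne_eq, Fin.ext_iff]; omega
    have hij' : i ≠ j := by rw [ne_eq, Fin.ext_iff]; omega
    have hmj : m ≠ j := by rw [ne_eq, Fin.ext_iff]; omega
    have ht : IsPoly fun z : Fin N → K => z i + A := (IsPoly.proj _).add (IsPoly.const _)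
    have H := ((h.isPoly π).update j ht).eq_zero_of_generic {-A - A, c - A} (fun z hz => ?_) z
    · rwa [← hz, Function.update_eq_self] at H
    set w := Function.update z j (z i + A) with hw
    have wi : w i = z i := Function.update_of_ne hij' _ _
    have wm : w m = z m := Function.update_of_ne hmj _ _
    have wj : w j = z i + A := Function.update_self _ _ _
    set v := w ∘ swap m j with hv
    have vm : v m = z i + A := by simp [hv, wj]
    have vj : v j = z m := by simp [hv, wm]
    have vi : v i = z i := by simp [hv, swap_apply_of_ne_of_ne him hij', wi]
    have hs : ∀ l : Fin N, i ≤ l → l ≤ j → i ≤ swap m j l ∧ swap m j l ≤ j := by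
      intro l h1 h2
      rw [swap_apply_def]
      simp only [Fin.le_def] at *
      split_ifs <;> omega
    have hle : m ≤ j := Fin.le_def.2 (by omega)
    have hle' : i ≤ m := Fin.le_def.2 (by omega)
    have hπ' : ∀ k l : Fin N, i ≤ k → k ≤ m → i ≤ l → l ≤ m → π.1 k ≠ l := fun k l h1 h2 h3 h4 =>
      hπ k l h1 (h2.trans hle) h3 (h4.trans hle)
    have hπ'' : ∀ k l : Fin N, i ≤ k → k ≤ m → i ≤ l → l ≤ m →
        (LinkPattern.conj (swap m j) π).1 k ≠ l := by
      intro k l h1 h2 h3 h4 e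
      rw [LinkPattern.conj_apply, swap_inv] at e
      have h5 := hs k h1 (h2.trans hle)
      have h6 := hs l h3 (h4.trans hle)
      refine hπ _ _ h5.1 h5.2 h6.1 h6.2 ?_
      rw [← e]
      simp
    -- At v the place m = j − 1 carries the value z i + A, so the induction hypothesis kills both
    -- components on the right, and generically the coefficient g on the left is nonzero.
    have e1 := h.exch m j hm π (hπ m j hle' hle (hle'.trans hle) le_rfl) v
    rw [ih m (by omega) π hπ' v (by rw [vm, vi]),
      ih m (by omega) _ hπ'' v (by rw [vm, vi]), hv, comp_swap_comp_swap, ← hv, mul_zero, mul_zero,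
      add_zero, mul_zero, vm, vj] at e1
    refine (mul_eq_zero.1 e1).resolve_left ?_
    rw [gFun_eq_zero, not_or]
    exact ⟨fun e => hz i m him (-A - A) (by simp) (by linear_combination e),
      fun e => hz i m him (c - A) (by simp) (by linear_combination e)⟩

theorem rotPoint_of_succ (ε : K) (z : Fin N → K) {k l : Fin N} (h : (k : ℕ) + 1 = l) :
    rotPoint ε z k = z l := by
  obtain _ | N := N
  · exact k.elim0
  obtain ⟨m, rfl⟩ : ∃ m : Fin N, k = m.castSucc := ⟨⟨k, by omega⟩, rfl⟩
  rw [rotPoint_castSucc]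
  congr 1
  exact Fin.ext h

theorem rotPoint_of_last (ε : K) (z : Fin N → K) {k l : Fin N} (h : (k : ℕ) + 1 = N)
    (hl : (l : ℕ) = 0) : rotPoint ε z k = z l + ε := by
  obtain _ | N := N
  · exact k.elim0
  obtain rfl : k = Fin.last N := Fin.ext (by simp; omega)
  obtain rfl : l = 0 := Fin.ext hl
  rw [rotPoint_last]

end WeakSolution

/-! ### Zeros of the antipodal component -/

section Antipodal

variable {n : ℕ} {K : Type} [Field K] {A c ε : K}

theorem antipodal_involutive (n : ℕ) : Function.Involutive fun k : Fin (2 * n) =>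
    (⟨(k + n) % (2 * n), Nat.mod_lt _ (Nat.zero_lt_of_lt k.2)⟩ : Fin (2 * n)) := by
  intro k
  rw [Fin.ext_iff]
  simp only [Nat.mod_add_mod]
  rw [add_assoc, ← two_mul, Nat.add_mod_right, Nat.mod_eq_of_lt k.2]

/-- The link pattern that pairs opposite places. -/
def antipodal (n : ℕ) : LinkPattern (2 * n) :=
  ⟨(antipodal_involutive n).toPerm, antipodal_involutive n, fun k h => by
    have h1 : (k + n) % (2 * n) = k := congrArg Fin.val h
    have := k.2
    rcases Nat.lt_or_ge (k + n) (2 * n) with h2 | h2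
    · rw [Nat.mod_eq_of_lt h2] at h1
      omega
    · rw [Nat.mod_eq_sub_mod h2, Nat.mod_eq_of_lt (by omega)] at h1
      omega⟩

theorem antipodal_apply (k : Fin (2 * n)) : ((antipodal n).1 k : ℕ) = (k + n) % (2 * n) := rfl

theorem val_finRotate {N : ℕ} (k : Fin N) : (finRotate N k : ℕ) = (k + 1) % N := by
  obtain _ | N := N
  · exact k.elim0
  refine Fin.lastCases ?_ (fun k => ?_) k
  · simp
  · rw [finRotate_castSucc, Fin.val_succ, Fin.val_castSucc, Nat.mod_eq_of_lt (by omega)]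

/-- By this invariance, cyclicity relates the antipodal component to itself, so its zeros can be
rotated. -/
theorem conj_finRotate_antipodal :
    LinkPattern.conj (finRotate (2 * n))⁻¹ (antipodal n) = antipodal n := by
  apply LinkPattern.ext_apply
  intro k
  rw [LinkPattern.conj_apply, inv_inv, Perm.inv_eq_iff_eq, Fin.ext_iff, antipodal_apply,
    val_finRotate, val_finRotate, antipodal_apply, Nat.mod_add_mod, Nat.mod_add_mod,
    add_right_comm]

theorem antipodal_ne {k l : Fin (2 * n)} (h1 : (k : ℕ) < l + n) (h2 : (l : ℕ) < k + n) :
    (antipodal n).1 k ≠ l := by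
  intro h
  have h3 : (k + n) % (2 * n) = l := congrArg Fin.val h
  have := k.2
  rcases Nat.lt_or_ge (k + n) (2 * n) with h4 | h4
  · rw [Nat.mod_eq_of_lt h4] at h3
    omega
  · rw [Nat.mod_eq_sub_mod h4, Nat.mod_eq_of_lt (by omega)] at h3
    omega

variable [Infinite K] {f : LinkPattern (2 * n) → (Fin (2 * n) → K) → K}

theorem IsWeakSolution.antipodal_eq_zero (h : IsWeakSolution A c ε f) (h2 : (2 : K) ≠ 0)
    (hA : A ≠ 0) (hcA : c ^ 2 ≠ A ^ 2) {i j : Fin (2 * n)} (hij : i < j) (hd : (j : ℕ) < i + n)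
    {z : Fin (2 * n) → K} (hz : z j = z i + A) : f (antipodal n) z = 0 := by
  rw [Fin.lt_def] at hij
  refine h.eq_zero_of_no_arc h2 hA hcA (j - i - 1) i j (by omega) _ (fun k l h1 h2 h3 h4 => ?_) z hz
  rw [Fin.le_def] at h1 h2 h3 h4
  exact antipodal_ne (by omega) (by omega)

/-- After i + 1 rotations the variable z i has passed the end of the row and acquired ε. The
condition is then an ordinary one between two places at distance less than n. -/
theorem IsWeakSolution.antipodal_eq_zero_of_wrap (h : IsWeakSolution A c ε f) (h2 : (2 : K) ≠ 0)
    (hA : A ≠ 0) (hcA : c ^ 2 ≠ A ^ 2) {i j : Fin (2 * n)} (hd : (i : ℕ) + n < j)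
    {z : Fin (2 * n) → K} (hz : z i + ε = z j + A) : f (antipodal n) z = 0 := by
  obtain ⟨m, hm⟩ : ∃ m : ℕ, m = i := ⟨_, rfl⟩
  obtain ⟨j', hj⟩ : ∃ j' : Fin (2 * n), (j' : ℕ) + 1 = j := ⟨⟨j - 1, by omega⟩, by simp; omega⟩
  induction m generalizing i j j' z with
  | zero =>
    obtain ⟨i', hi⟩ : ∃ i' : Fin (2 * n), (i' : ℕ) + 1 = 2 * n :=
      ⟨⟨2 * n - 1, by omega⟩, by simp; omega⟩
    rw [h.cyc, conj_finRotate_antipodal]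
    refine h.antipodal_eq_zero h2 hA hcA (i := j') (j := i') (by rw [Fin.lt_def]; omega)
      (by omega) ?_
    rw [rotPoint_of_last ε z hi hm.symm, rotPoint_of_succ ε z hj, hz]
  | succ m ih =>
    obtain ⟨i', hi⟩ : ∃ i' : Fin (2 * n), (i' : ℕ) + 1 = i := ⟨⟨i - 1, by omega⟩, by simp; omega⟩
    rw [h.cyc, conj_finRotate_antipodal]
    obtain ⟨j'', hj''⟩ : ∃ j'' : Fin (2 * n), (j'' : ℕ) + 1 = j' :=
      ⟨⟨j' - 1, by omega⟩, by simp; omega⟩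
    refine ih (i := i') (j := j') (by omega) ?_ (by omega) j'' hj''
    rw [rotPoint_of_succ ε z hj, rotPoint_of_succ ε z hi, hz]

end Antipodal

/-! ### Transitivity on link patterns -/

section Transitive

variable {N : ℕ}

theorem LinkPattern.exists_conj_eq (π σ : LinkPattern N) :
    ∃ s : Perm (Fin N), LinkPattern.conj s π = σ := by
  have key : ∀ π : LinkPattern N, ∃ m, π.1.cycleType = Multiset.replicate m 2 ∧ 2 * m = N := by
    intro π
    have hsum : π.1.cycleType.sum = N := by
      rw [Perm.sum_cycleType]
      have : π.1.support = Finset.univ := by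
        ext k
        simp [π.2.2 k]
      rw [this, Finset.card_univ, Fintype.card_fin]
    have h2 : ∀ x ∈ π.1.cycleType, x = 2 := by
      intro x hx
      have h1 := Perm.two_le_of_mem_cycleType hx
      have h3 : π.1 ^ 2 = 1 := by
        ext k
        simp [pow_two, π.2.1]
      have h4 := (Perm.dvd_of_mem_cycleType hx).trans (orderOf_dvd_of_pow_eq_one h3)
      exact le_antisymm (Nat.le_of_dvd (by omega) h4) h1
    refine ⟨Multiset.card π.1.cycleType, Multiset.eq_replicate.2 ⟨rfl, h2⟩, ?_⟩
    rw [Multiset.eq_replicate.2 ⟨rfl, h2⟩, Multiset.sum_replicate] at hsum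
    rw [mul_comm]
    simpa using hsum
  obtain ⟨m, h1, h2⟩ := key π
  obtain ⟨m', h3, h4⟩ := key σ
  have h5 : IsConj π.1 σ.1 := by
    rw [Perm.isConj_iff_cycleType_eq, h1, h3, show m = m' by omega]
  obtain ⟨s, hs⟩ := isConj_iff.1 h5
  exact ⟨s, Subtype.ext hs⟩

/-- Exchanges of adjacent places act transitively on link patterns. -/
theorem LinkPattern.induction_swap {P : LinkPattern N → Prop} {π : LinkPattern N} (h0 : P π)
    (h : ∀ (i j : Fin N), (i : ℕ) + 1 = j → ∀ σ : LinkPattern N, σ.1 i ≠ j → P σ →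
      P (LinkPattern.conj (swap i j) σ)) (σ : LinkPattern N) : P σ := by
  obtain ⟨s, rfl⟩ := LinkPattern.exists_conj_eq π σ
  obtain _ | N := N
  · rwa [Subsingleton.elim (LinkPattern.conj s π) π]
  have hs : s ∈ Submonoid.closure (Set.range fun i : Fin N => swap i.castSucc i.succ) := by
    rw [Perm.mclosure_swap_castSucc_succ]
    trivial
  induction hs using Submonoid.closure_induction_left with
  | one => rwa [LinkPattern.conj_one]
  | mul_left x hx y hy ih =>
    obtain ⟨i, rfl⟩ := hx
    rw [← LinkPattern.conj_conj]
    -- The case excluded from the hypothesis is harmless: the swap fixes a pattern with the arc (i,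
    -- i + 1).
    by_cases hi : (LinkPattern.conj y π).1 i.castSucc = i.succ
    · rw [LinkPattern.conj_swap_of_apply hi]
      exact ih
    · exact h _ _ (by simp) _ hi ih

/-- If Ψ_σ vanishes identically, the exchange relation reduces to u (A − u) Ψ = 0 for the conjugated
component; transitivity does the rest. -/
theorem IsWeakSolution.eq_zero_of_component {K : Type} [Field K] [Infinite K] {A c ε : K}
    {f : LinkPattern N → (Fin N → K) → K} (h : IsWeakSolution A c ε f) {π : LinkPattern N}
    (h0 : ∀ z, f π z = 0) (σ : LinkPattern N) (z : Fin N → K) : f σ z = 0 := by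
  classical
  refine LinkPattern.induction_swap (P := fun σ => ∀ z, f σ z = 0) h0
    (fun i j hij σ hσ h1 z => ?_) σ z
  have hne : i ≠ j := by rintro rfl; omega
  refine (h.isPoly _).eq_zero_of_generic {0, A} (fun z hz => ?_) z
  have h2 := h.exch i j hij σ hσ z
  rw [h1, h1, mul_zero, mul_zero, zero_add] at h2
  have h3 := (mul_eq_zero.1 h2.symm).resolve_left
    (sub_ne_zero.2 (hz i j hne A (by simp)).symm)
  exact (mul_eq_zero.1 h3).resolve_left (hz i j hne 0 (by simp))

end Transitive
end BrauerQKZ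


namespace BrauerQKZ

open Equiv MvPolynomial

/-! ### The linear factors of the antipodal component -/

section LinearFactors

variable {n : ℕ}

/-- The place that is `d + 1` steps after `p` in the cyclic order, for `e = (p, d)`. -/
def target (e : Fin (2 * n) × Fin (n - 1)) : Fin (2 * n) :=
  if h : (e.1 : ℕ) + e.2 + 1 < 2 * n then ⟨e.1 + e.2 + 1, h⟩
  else ⟨e.1 + e.2 + 1 - 2 * n, by omega⟩

theorem val_target (e : Fin (2 * n) × Fin (n - 1)) : (target e : ℕ) =
    if (e.1 : ℕ) + e.2 + 1 < 2 * n then (e.1 : ℕ) + e.2 + 1 else e.1 + e.2 + 1 - 2 * n := by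
  unfold target
  split_ifs <;> rfl

theorem target_ne (e : Fin (2 * n) × Fin (n - 1)) : target e ≠ e.1 := by
  have := val_target e
  rw [ne_eq, Fin.ext_iff]
  split_ifs at this <;> omega

/-- Distinct indices have distinct pairs of ends: the steps d + 1 are less than n, so no two of them
add up to a full turn 2n. -/
theorem exists_separating {e e' : Fin (2 * n) × Fin (n - 1)} (h : e ≠ e') :
    (e'.1 ≠ e.1 ∧ e'.1 ≠ target e) ∨ (target e' ≠ e.1 ∧ target e' ≠ target e) := by
  by_contra hcon
  have h1 := val_target e
  have h2 := val_target e'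
  have h3 : ¬ ((e.1 : ℕ) = e'.1 ∧ (e.2 : ℕ) = e'.2) := fun h4 =>
    h (Prod.ext (Fin.ext h4.1) (Fin.ext h4.2))
  simp only [ne_eq, Fin.ext_iff] at hcon
  have := e.2.2
  have := e'.2.2
  split_ifs at h1 h2 <;> omega

/-- The index of a linear factor passes the end of the row. -/
def Wraps (e : Fin (2 * n) × Fin (n - 1)) : Prop := 2 * n ≤ (e.1 : ℕ) + e.2 + 1

instance (e : Fin (2 * n) × Fin (n - 1)) : Decidable (Wraps e) :=
  inferInstanceAs (Decidable (2 * n ≤ (e.1 : ℕ) + e.2 + 1))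

section Values

variable {K : Type} [Field K] {A c ε : K}

/-- The linear form of index `e` at a point. -/
def linVal (A ε : K) (e : Fin (2 * n) × Fin (n - 1)) (z : Fin (2 * n) → K) : K :=
  z (target e) - (z e.1 + (A - if Wraps e then ε else 0))

theorem IsWeakSolution.antipodal_eq_zero_of_linVal [Infinite K]
    {f : LinkPattern (2 * n) → (Fin (2 * n) → K) → K} (h : IsWeakSolution A c ε f)
    (h2 : (2 : K) ≠ 0) (hA : A ≠ 0) (hcA : c ^ 2 ≠ A ^ 2) {e : Fin (2 * n) × Fin (n - 1)}
    {z : Fin (2 * n) → K} (hz : linVal A ε e z = 0) : f (antipodal n) z = 0 := by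
  have ht := val_target e
  unfold linVal at hz
  have := e.2.2
  by_cases hw : Wraps e
  · rw [if_pos hw] at hz
    unfold Wraps at hw
    rw [if_neg (by omega)] at ht
    exact h.antipodal_eq_zero_of_wrap h2 hA hcA (i := target e) (j := e.1) (by omega)
      (by linear_combination hz)
  · rw [if_neg hw] at hz
    unfold Wraps at hw
    rw [if_pos (by omega)] at ht
    exact h.antipodal_eq_zero h2 hA hcA (i := e.1) (j := target e) (by rw [Fin.lt_def]; omega)
      (by omega) (by linear_combination hz)

/-- Starting from a zero of the first form, a coordinate that occurs only in the second form can be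
varied freely. -/
theorem exists_linVal_separating (A ε : K) {e e' : Fin (2 * n) × Fin (n - 1)} (h : e ≠ e') :
    ∃ z, linVal A ε e z = 0 ∧ linVal A ε e' z ≠ 0 := by
  set z : Fin (2 * n) → K := Pi.single (target e) (A - if Wraps e then ε else 0) with hz
  have h0 : ∀ m t, e.1 ≠ m → target e ≠ m → linVal A ε e (Function.update z m t) = 0 := by
    intro m t h1 h2
    unfold linVal
    rw [Function.update_of_ne h1, Function.update_of_ne h2, hz, Pi.single_eq_same,
      Pi.single_eq_of_ne (target_ne e).symm]
    ring
  by_contra hcon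
  push Not at hcon
  rcases exists_separating h with ⟨h1, h2⟩ | ⟨h1, h2⟩
  · have a := hcon _ (h0 e'.1 0 h1.symm h2.symm)
    have b := hcon _ (h0 e'.1 1 h1.symm h2.symm)
    unfold linVal at a b
    rw [Function.update_self, Function.update_of_ne (target_ne e')] at a b
    exact one_ne_zero (α := K) (by linear_combination a - b)
  · have a := hcon _ (h0 (target e') 0 h1.symm h2.symm)
    have b := hcon _ (h0 (target e') 1 h1.symm h2.symm)
    unfold linVal at a b
    rw [Function.update_self, Function.update_of_ne (target_ne e').symm] at a b
    exact one_ne_zero (α := K) (by linear_combination b - a)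

/-- Pairwise distinct linear factors that divide `p` divide it together. -/
theorem prod_linear_dvd {R : Type*} [CommRing R] [IsDomain R] (A ε : K)
    (ev : (Fin (2 * n) → K) → R →+* K) {ℓ : Fin (2 * n) × Fin (n - 1) → R}
    (hev : ∀ e z, ev z (ℓ e) = linVal A ε e z) (hℓ : ∀ e, Prime (ℓ e)) {p : R}
    (hp : ∀ e, ℓ e ∣ p) : ∏ e, ℓ e ∣ p := by
  refine prod_dvd_of_prime (fun e _ => hℓ e) (fun e _ e' _ hne hd => ?_) fun e _ => hp e
  obtain ⟨z, h1, h2⟩ := exists_linVal_separating A ε hne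
  obtain ⟨r, hr⟩ := hd
  apply h2
  rw [← hev, hr, map_mul, hev, h1, zero_mul]

end Values

section OverField

variable {K : Type} [Field K] {A c ε : K}

theorem degreeOf_prod_eq_sum {σ ι : Type*} {s : Finset ι} {p : ι → MvPolynomial σ K}
    (hp : ∀ i ∈ s, p i ≠ 0) (k : σ) :
    degreeOf k (∏ i ∈ s, p i) = ∑ i ∈ s, degreeOf k (p i) := by
  classical
  induction s using Finset.induction_on with
  | empty => simp
  | insert a s ha ih =>
    rw [Finset.prod_insert ha, Finset.sum_insert ha, degreeOf_mul_eq (hp a (by simp))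
      (Finset.prod_ne_zero_iff.2 fun i hi => hp i (by simp [hi])), ih fun i hi => hp i (by simp [hi])]

/-- The linear form of index `e` as a polynomial in the variables `z`. -/
noncomputable def linPoly (A ε : K) (e : Fin (2 * n) × Fin (n - 1)) : MvPolynomial (Fin (2 * n)) K :=
  X (target e) - (X e.1 + C (A - if Wraps e then ε else 0))

theorem eval_linPoly (e : Fin (2 * n) × Fin (n - 1)) (z : Fin (2 * n) → K) :
    eval z (linPoly A ε e) = linVal A ε e z := by
  simp [linPoly, linVal]

theorem linPoly_hq (A ε : K) (e : Fin (2 * n) × Fin (n - 1)) :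
    aeval (Function.update X (target e) (X e.1 + C (A - if Wraps e then ε else 0)))
      (X e.1 + C (A - if Wraps e then ε else 0) : MvPolynomial (Fin (2 * n)) K) =
      X e.1 + C (A - if Wraps e then ε else 0) := by
  rw [map_add, aeval_update_X_of_ne (target_ne e), ← algebraMap_eq, AlgHom.commutes]

theorem coeff_linPoly_target (e : Fin (2 * n) × Fin (n - 1)) :
    coeff (Finsupp.single (target e) 1) (linPoly A ε e) = 1 := by
  classical
  have h : Finsupp.single e.1 1 ≠ (Finsupp.single (target e) 1 : Fin (2 * n) →₀ ℕ) := fun h =>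
    target_ne e (Finsupp.single_left_injective one_ne_zero h).symm
  simp [linPoly, coeff_X, coeff_C, h, (Finsupp.single_ne_zero.2 one_ne_zero).symm]

theorem coeff_linPoly_source (e : Fin (2 * n) × Fin (n - 1)) :
    coeff (Finsupp.single e.1 1) (linPoly A ε e) = -1 := by
  classical
  have h : Finsupp.single (target e) 1 ≠ (Finsupp.single e.1 1 : Fin (2 * n) →₀ ℕ) := fun h =>
    target_ne e (Finsupp.single_left_injective one_ne_zero h)
  simp [linPoly, coeff_X, coeff_C, h, (Finsupp.single_ne_zero.2 one_ne_zero).symm]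

theorem linPoly_ne_zero (e : Fin (2 * n) × Fin (n - 1)) : linPoly A ε e ≠ 0 := by
  intro h
  have := coeff_linPoly_target (A := A) (ε := ε) e
  rw [h, coeff_zero] at this
  exact zero_ne_one this

theorem le_degreeOf_linPoly (e : Fin (2 * n) × Fin (n - 1)) (k : Fin (2 * n)) :
    (if e.1 = k then 1 else 0) + (if target e = k then 1 else 0) ≤ degreeOf k (linPoly A ε e) := by
  have key : ∀ a, coeff (Finsupp.single a 1) (linPoly A ε e) ≠ 0 →
      1 ≤ degreeOf a (linPoly A ε e) := fun a ha => by
    simpa using monomial_le_degreeOf a (mem_support_iff.2 ha)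
  have h1 := key e.1 (by rw [coeff_linPoly_source]; simp)
  have h2 := key (target e) (by rw [coeff_linPoly_target]; simp)
  have h3 := target_ne e
  split_ifs with h4 h5 h5
  · exact absurd (h5.trans h4.symm) h3
  · rw [← h4]
    exact h1
  · rw [← h5]
    simpa using h2
  · exact Nat.zero_le _

/-- For each of the n − 1 steps, k is the source of one factor and the target of another. -/
theorem le_degreeOf_prod_linPoly (k : Fin (2 * n)) :
    2 * n - 2 ≤ degreeOf k (∏ e, linPoly (n := n) A ε e) := by
  rw [degreeOf_prod_eq_sum fun e _ => linPoly_ne_zero e]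
  refine le_trans ?_ (Finset.sum_le_sum fun e _ => le_degreeOf_linPoly e k)
  rw [Finset.sum_add_distrib, Fintype.sum_prod_type_right, Fintype.sum_prod_type_right]
  have h1 : ∀ d : Fin (n - 1), 1 ≤ ∑ p : Fin (2 * n), if (p, d).1 = k then 1 else 0 := by
    intro d
    simp
  have h2 : ∀ d : Fin (n - 1), 1 ≤ ∑ p : Fin (2 * n), if target (p, d) = k then 1 else 0 := by
    intro d
    obtain ⟨p, hp⟩ : ∃ p : Fin (2 * n), target (p, d) = k := by
      have hd := d.2
      rcases Nat.lt_or_ge d k with h | h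
      · refine ⟨⟨k - d - 1, by omega⟩, Fin.ext ?_⟩
        rw [val_target]
        simp only
        rw [if_pos (by omega)]
        omega
      · refine ⟨⟨k + 2 * n - d - 1, by omega⟩, Fin.ext ?_⟩
        rw [val_target]
        simp only
        rw [if_neg (by omega)]
        omega
    refine le_trans ?_ (Finset.single_le_sum (fun _ _ => Nat.zero_le _) (Finset.mem_univ p))
    rw [if_pos hp]
  have h3 := Finset.sum_le_sum fun d (_ : d ∈ Finset.univ) => h1 d
  have h4 := Finset.sum_le_sum fun d (_ : d ∈ Finset.univ) => h2 d
  simp only [Finset.sum_const, Finset.card_univ, Fintype.card_fin, smul_eq_mul, mul_one] at h3 h4 ⊢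
  omega

theorem eq_C_of_degreeOf_eq_zero {σ : Type*} {p : MvPolynomial σ K} (h : ∀ k, degreeOf k p = 0) :
    p = C (coeff 0 p) := by
  rw [← totalDegree_eq_zero_iff_eq_C, totalDegree_eq_zero_iff]
  intro m hm x
  have := monomial_le_degreeOf x hm
  rw [h x] at this
  omega

/-- The component of the antipodal pattern is determined up to a factor. -/
theorem IsWeakSolution.antipodal_eq [Infinite K] {f : LinkPattern (2 * n) → (Fin (2 * n) → K) → K}
    (h : IsWeakSolution A c ε f) (h2 : (2 : K) ≠ 0) (hA : A ≠ 0) (hcA : c ^ 2 ≠ A ^ 2)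
    (hd : HasDeg (f (antipodal n)) fun _ => 2 * n - 2) :
    ∃ κ : K, ∀ z, f (antipodal n) z = κ * ∏ e, linVal A ε e z := by
  obtain ⟨p, hp, hdeg⟩ := hd
  have hdvd : ∏ e, linPoly (n := n) A ε e ∣ p := by
    refine prod_linear_dvd A ε (fun z => eval z) (fun e z => eval_linPoly e z)
      (fun e => prime_X_sub (linPoly_hq A ε e) (sub_ne_zero.1 (linPoly_ne_zero e)))
      fun e => dvd_of_forall_eval (linPoly_hq A ε e) fun z hz => ?_
    rw [← hp]
    refine h.antipodal_eq_zero_of_linVal h2 hA hcA (e := e) ?_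
    rw [← eval_linPoly, linPoly, map_sub, eval_X, hz, sub_self]
  obtain ⟨q, rfl⟩ := hdvd
  rcases eq_or_ne q 0 with rfl | hq
  · exact ⟨0, fun z => by rw [hp]; simp⟩
  -- The linear factors already use up the whole degree 2n − 2 in each variable, so the cofactor is
  -- a constant of K.
  have hq0 : ∀ k, degreeOf k q = 0 := by
    intro k
    have h1 : _ ≤ 2 * n - 2 := hdeg k
    have h3 := le_degreeOf_prod_linPoly (A := A) (ε := ε) k
    rw [degreeOf_mul_eq (Finset.prod_ne_zero_iff.2 fun e _ => linPoly_ne_zero e) hq] at h1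
    omega
  refine ⟨coeff 0 q, fun z => ?_⟩
  rw [hp, map_mul, map_prod, eq_C_of_degreeOf_eq_zero hq0, eval_C, coeff_C, if_pos rfl, mul_comm]
  simp only [eval_linPoly]

end OverField
end LinearFactors
end BrauerQKZ


namespace BrauerQKZ

open Equiv MvPolynomial

/-! ### Cofactors of homogeneous polynomials -/

section Homogeneous

variable {σ R : Type*} [CommRing R]

theorem homogeneousComponent_mul_of_isHomogeneous {a b : MvPolynomial σ R} {i : ℕ}
    (ha : a.IsHomogeneous i) (m : ℕ) :
    homogeneousComponent (m + i) (a * b) = a * homogeneousComponent m b := by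
  let := gradedAlgebra (σ := σ) (R := R)
  have := DirectSum.coe_decompose_mul_of_left_mem_of_le (homogeneousSubmodule σ R) (b := b)
    ((mem_homogeneousSubmodule i a).2 ha) (Nat.le_add_left i m)
  rw [Nat.add_sub_cancel] at this
  exact ((decomposition.decompose'_apply _ _).symm.trans this).trans
    (congrArg (a * ·) (decomposition.decompose'_apply _ _))

theorem IsHomogeneous.of_mul_left [IsDomain R] {a b : MvPolynomial σ R} {i n : ℕ}
    (ha : a.IsHomogeneous i) (ha0 : a ≠ 0) (hab : (a * b).IsHomogeneous (n + i)) :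
    b.IsHomogeneous n := by
  classical
  have key : ∀ m, m ≠ n → homogeneousComponent m b = 0 := by
    intro m hm
    have h1 := homogeneousComponent_mul_of_isHomogeneous (b := b) ha m
    rw [homogeneousComponent_of_mem ((mem_homogeneousSubmodule _ _).2 hab),
      if_neg (by omega)] at h1
    exact (mul_eq_zero.1 h1.symm).resolve_left ha0
  intro d hd
  by_contra hne
  have h1 := congrArg (coeff d) (key d.degree (by rwa [Finsupp.degree_eq_weight_one]))
  rw [coeff_homogeneousComponent, if_pos rfl, coeff_zero] at h1
  exact hd h1

end Homogeneous

/-! ### Polynomials in A, ε and z evaluated at points over K -/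

section EvalPt

noncomputable instance (N : ℕ) : DecidableEq (Var N) := Classical.decEq _

variable {N : ℕ} {K : Type} [Field K]

/-- The values of the variables at a point. -/
def varPt (A ε : K) (z : Fin N → K) : Var N → K
  | Var.A => A
  | Var.eps => ε
  | Var.z k => z k

/-- Evaluation of polynomials in `A`, `ε` and the `z k`. -/
noncomputable def evalPt (R : Type) [CommRing R] [Algebra R K] (A ε : K) (z : Fin N → K) :
    MvPolynomial (Var N) R →ₐ[R] K := aeval (varPt A ε z)

variable {R : Type} [CommRing R] [Algebra R K] {A ε : K}

theorem evalPt_A (z : Fin N → K) : evalPt R A ε z (X Var.A) = A := aeval_X _ _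

theorem evalPt_eps (z : Fin N → K) : evalPt R A ε z (X Var.eps) = ε := aeval_X _ _

theorem evalPt_z (z : Fin N → K) (k : Fin N) : evalPt R A ε z (X (Var.z k)) = z k := aeval_X _ _

theorem isPoly_evalPt (p : MvPolynomial (Var N) R) : IsPoly fun z : Fin N → K => evalPt R A ε z p := by
  induction p using MvPolynomial.induction_on with
  | C r =>
    have h : ∀ z : Fin N → K, evalPt R A ε z (C r) = algebraMap R K r := fun z => aeval_C _ _
    simpa only [h] using IsPoly.const _
  | add p q hp hq => simpa only [map_add] using hp.add hq
  | mul_X p v hp =>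
    simp only [map_mul]
    refine hp.mul ?_
    cases v with
    | A => simpa only [evalPt_A] using IsPoly.const _
    | eps => simpa only [evalPt_eps] using IsPoly.const _
    | z k => simpa only [evalPt_z] using IsPoly.proj k

theorem evalPt_aeval_update (z : Fin N → K) (a : Fin N) (q p : MvPolynomial (Var N) R) :
    evalPt R A ε z (aeval (Function.update X (Var.z a) q) p) =
      evalPt R A ε (Function.update z a (evalPt R A ε z q)) p := by
  unfold evalPt
  rw [← AlgHom.comp_apply, comp_aeval]
  congr 2
  funext v
  rcases eq_or_ne v (Var.z a) with rfl | hv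
  · simp [varPt]
  · rw [Function.update_of_ne hv, aeval_X]
    cases v with
    | A => rfl
    | eps => rfl
    | z k =>
      have : k ≠ a := fun e => hv (by rw [e])
      simp [varPt, Function.update_of_ne this]

/-- Injectivity of evaluation at one point `zg` turns vanishing of values in K into a polynomial
identity over R. This allows R = ℤ even though the functions live over K. -/
theorem dvd_of_forall_evalPt {zg : Fin N → K} (hinj : Function.Injective (evalPt R A ε zg))
    {a : Fin N} {q p : MvPolynomial (Var N) R}
    (hq : aeval (Function.update X (Var.z a) q) q = q)
    (h : ∀ z : Fin N → K, z a = evalPt R A ε z q → evalPt R A ε z p = 0) :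
    X (Var.z a) - q ∣ p := by
  rw [X_sub_dvd_iff hq]
  apply hinj
  rw [evalPt_aeval_update, map_zero]
  apply h
  rw [Function.update_self, ← evalPt_aeval_update, hq]

/-- The exchange of two variables `z i` and `z j`. -/
def swapVar (i j : Fin N) : Var N → Var N
  | Var.A => Var.A
  | Var.eps => Var.eps
  | Var.z k => Var.z (swap i j k)

theorem evalPt_rename_swapVar (i j : Fin N) (z : Fin N → K) (p : MvPolynomial (Var N) R) :
    evalPt R A ε z (rename (swapVar i j) p) = evalPt R A ε (z ∘ swap i j) p := by
  unfold evalPt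
  rw [aeval_rename]
  congr 2
  funext v
  cases v <;> rfl

end EvalPt

/-! ### The linear factors as polynomials in all variables -/

section LinearFactorsVar

variable {n : ℕ} {K : Type} [Field K] {R : Type} [CommRing R] [Algebra R K] {A ε : K}

/-- The constant part of a linear factor. -/
noncomputable def linConst (R : Type) [CommRing R] (e : Fin (2 * n) × Fin (n - 1)) :
    MvPolynomial (Var (2 * n)) R := X Var.A - if Wraps e then X Var.eps else 0

/-- The linear form of index `e` as a polynomial in all variables. -/
noncomputable def linVar (R : Type) [CommRing R] (e : Fin (2 * n) × Fin (n - 1)) :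
    MvPolynomial (Var (2 * n)) R :=
  X (Var.z (target e)) - (X (Var.z e.1) + linConst R e)

theorem evalPt_linVar (e : Fin (2 * n) × Fin (n - 1)) (z : Fin (2 * n) → K) :
    evalPt R A ε z (linVar R e) = linVal A ε e z := by
  unfold linVar linVal linConst
  split_ifs <;> simp [evalPt_A, evalPt_eps, evalPt_z]

theorem linVar_hq (e : Fin (2 * n) × Fin (n - 1)) :
    aeval (Function.update X (Var.z (target e)) (X (Var.z e.1) + linConst R e))
      (X (Var.z e.1) + linConst R e : MvPolynomial (Var (2 * n)) R) =
      X (Var.z e.1) + linConst R e := by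
  have h1 : ∀ v : Var (2 * n), v ≠ Var.z (target e) →
      aeval (Function.update X (Var.z (target e)) (X (Var.z e.1) + linConst R e))
        (X v : MvPolynomial (Var (2 * n)) R) = X v := fun v hv => by
    rw [aeval_X, Function.update_of_ne hv]
  have h2 : Var.z e.1 ≠ Var.z (target e) := fun h => target_ne e (Var.z.inj h).symm
  unfold linConst at h1 ⊢
  split_ifs at h1 ⊢ <;> simp only [map_add, map_sub, map_zero, h1 _ h2, h1 Var.A (by simp), h1 Var.eps (by simp)]

theorem linVar_isHomogeneous (e : Fin (2 * n) × Fin (n - 1)) : (linVar R e).IsHomogeneous 1 := by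
  unfold linVar linConst
  refine (isHomogeneous_X _ _).sub ((isHomogeneous_X _ _).add ((isHomogeneous_X _ _).sub ?_))
  split_ifs
  · exact isHomogeneous_X _ _
  · exact isHomogeneous_zero _ _ _

theorem prod_linVar_isHomogeneous :
    (∏ e, linVar (n := n) R e).IsHomogeneous (2 * n * (n - 1)) := by
  have := IsHomogeneous.prod Finset.univ (linVar (n := n) R) (fun _ => 1)
    fun e _ => linVar_isHomogeneous e
  simpa using this

theorem linVar_ne_zero [Nontrivial R] (e : Fin (2 * n) × Fin (n - 1)) : linVar R e ≠ 0 := by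
  intro h
  have h2 : Var.z e.1 ≠ Var.z (target e) := fun h => target_ne e (Var.z.inj h).symm
  have := congrArg (aeval (Pi.single (Var.z (target e)) (1 : R))) h
  unfold linVar linConst at this
  split_ifs at this <;> simp [h2] at this

theorem prod_linVar_dvd [IsDomain R] {zg : Fin (2 * n) → K}
    (hinj : Function.Injective (evalPt R A ε zg)) {p : MvPolynomial (Var (2 * n)) R}
    (hp : ∀ e z, linVal A ε e z = 0 → evalPt R A ε z p = 0) :
    ∏ e, linVar (n := n) R e ∣ p := by
  refine prod_linear_dvd A ε (fun z => (evalPt R A ε z).toRingHom) (fun e z => evalPt_linVar e z)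
    (fun e => prime_X_sub (linVar_hq e) (sub_ne_zero.1 (linVar_ne_zero e)))
    fun e => dvd_of_forall_evalPt hinj (linVar_hq e) fun z hz => hp e z ?_
  rw [← evalPt_linVar (R := R), linVar, map_sub, evalPt_z, hz, sub_self]

end LinearFactorsVar
end BrauerQKZ


namespace BrauerQKZ

open Equiv MvPolynomial

/-! ### Differences of weak solutions, and weak solutions from exchange relations -/

section WeakSolution

variable {K : Type} [Field K] {A ε : K}

theorem IsWeakSolution.sub_smul {N : ℕ} {c : K} {f g : LinkPattern N → (Fin N → K) → K}
    (hf : IsWeakSolution A c ε f) (hg : IsWeakSolution A c ε g) (κ : K) :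
    IsWeakSolution A c ε fun π z => f π z - κ * g π z where
  isPoly π := (hf.isPoly π).sub ((IsPoly.const κ).mul (hg.isPoly π))
  exch i j hij π hπ z := by
    linear_combination hf.exch i j hij π hπ z - κ * hg.exch i j hij π hπ z
  cyc π z := by rw [hf.cyc, hg.cyc]

theorem isWeakSolution_of_exch {N : ℕ} {c : K}
    {Ψ : (Fin N → K) → LinkPattern N →₀ K} (hP : VPoly Ψ)
    (hΨ : ∀ i j : Fin N, (i : ℕ) + 1 = j → Exch A c Ψ i j)
    (hcyc : ∀ z, Ψ z = conjOp K (finRotate N) (Ψ (rotPoint ε z))) :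
    IsWeakSolution A c ε fun π z => Ψ z π where
  isPoly := hP
  exch i j hij π hπ z := by
    have hne : i ≠ j := by rintro rfl; omega
    have := congrArg (fun x => x π) (hΨ i j hij z)
    simp only [rOp_apply_of_ne A c hne hπ] at this
    exact this
  cyc π z := by
    conv_lhs => rw [hcyc z]
    rw [conjOp_apply]

end WeakSolution

/-! ### Integrality and homogeneity pass to conjugate components -/

section Integrality

variable {N : ℕ} {K : Type} [Field K] [Infinite K] {R : Type} [CommRing R] [IsDomain R]
  [Algebra R K] {A ε : K} {f : LinkPattern N → (Fin N → K) → K}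

/-- The exchange relation gives u (A − u) times the new component as an expression in the old one.
Divisibility holds because the new component is a polynomial function of z; up to sign, both
divisors are monic in z i, so the division stays over R. -/
theorem IsWeakSolution.exists_polynomial_conj (h : IsWeakSolution A (A + A - ε) ε f) (hA : A ≠ 0)
    {zg : Fin N → K} (hinj : Function.Injective (evalPt R A ε zg)) {d : ℕ} {i j : Fin N}
    (hij : (i : ℕ) + 1 = j) {σ : LinkPattern N} (hσ : σ.1 i ≠ j)
    (hp : ∃ p : MvPolynomial (Var N) R, p.IsHomogeneous d ∧ ∀ z, f σ z = evalPt R A ε z p) :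
    ∃ p : MvPolynomial (Var N) R, p.IsHomogeneous d ∧
      ∀ z, f (LinkPattern.conj (swap i j) σ) z = evalPt R A ε z p := by
  classical
  obtain ⟨p, hhom, hp⟩ := hp
  have hne : i ≠ j := by rintro rfl; omega
  have hvne : Var.z j ≠ Var.z i := fun e => hne (Var.z.inj e).symm
  set a : MvPolynomial (Var N) R := X Var.A with ha
  set u : MvPolynomial (Var N) R := X (Var.z i) - X (Var.z j) with hu
  set c : MvPolynomial (Var N) R := a + a - X Var.eps with hc
  -- The exchange relation solved for the term u (A − u) times the component sought.
  set r : MvPolynomial (Var N) R :=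
    (a + u) * (c - u) * rename (swapVar i j) p - (a - u) * c * p with hr
  have haH : a.IsHomogeneous 1 := isHomogeneous_X _ _
  have huH : u.IsHomogeneous 1 := (isHomogeneous_X _ _).sub (isHomogeneous_X _ _)
  have hcH : c.IsHomogeneous 1 := (haH.add haH).sub (isHomogeneous_X _ _)
  have hrH : r.IsHomogeneous (d + 1 + 1) := by
    have e : d + 1 + 1 = 1 + 1 + d := by ring
    rw [e]
    exact (((haH.add huH).mul (hcH.sub huH)).mul hhom.rename_isHomogeneous).sub
      (((haH.sub huH).mul hcH).mul hhom)
  have hru : ∀ z : Fin N → K, evalPt R A ε z u = z i - z j := fun z => by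
    rw [hu, map_sub, evalPt_z, evalPt_z]
  have hrz : ∀ z : Fin N → K, evalPt R A ε z r =
      gFun A (A + A - ε) (z i - z j) * f σ (z ∘ swap i j) -
        (A - (z i - z j)) * (A + A - ε) * f σ z := by
    intro z
    rw [hr, hp, hp, ← evalPt_rename_swapVar, hc]
    simp only [map_sub, map_mul, map_add, hru, ha, evalPt_A, evalPt_eps, gFun]
  have hrf : ∀ z : Fin N → K, evalPt R A ε z r = (A - (z i - z j)) * ((z i - z j) *
      f (LinkPattern.conj (swap i j) σ) z) := by
    intro z
    rw [hrz, h.exch i j hij σ hσ z]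
    ring
  have hX : ∀ q : MvPolynomial (Var N) R, aeval (Function.update X (Var.z i) q)
      (X (Var.z j) : MvPolynomial (Var N) R) = X (Var.z j) := fun q => by
    rw [aeval_X, Function.update_of_ne hvne]
  have hXA : ∀ q : MvPolynomial (Var N) R, aeval (Function.update X (Var.z i) q)
      (X Var.A : MvPolynomial (Var N) R) = X Var.A := fun q => by
    rw [aeval_X, Function.update_of_ne (by simp)]
  obtain ⟨r1, hr1⟩ : u ∣ r := by
    refine dvd_of_forall_evalPt hinj (hX _) fun z hz => ?_
    rw [evalPt_z] at hz
    rw [hrf, hz]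
    ring
  obtain ⟨r2, hr2⟩ : X (Var.z i) - (X (Var.z j) + a) ∣ r1 := by
    refine dvd_of_forall_evalPt hinj (by rw [map_add, hX, ha, hXA]) fun z hz => ?_
    rw [map_add, evalPt_z, ha, evalPt_A] at hz
    have h1 := hrf z
    rw [hr1, map_mul, hru, hz] at h1
    have h3 : A * evalPt R A ε z r1 = 0 := by linear_combination h1
    exact (mul_eq_zero.1 h3).resolve_left hA
  have e2 : X (Var.z i) - (X (Var.z j) + a) = u - a := by rw [hu]; ring
  rw [e2] at hr2
  have hu0 : u ≠ 0 := by
    intro h0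
    have := congrArg (aeval (Pi.single (Var.z i) (1 : R))) h0
    simp [hu, hvne] at this
  have hua0 : u - a ≠ 0 := by
    intro h0
    have := congrArg (aeval (Pi.single (Var.z i) (1 : R))) h0
    simp [hu, ha, hvne] at this
  have hr2H : r2.IsHomogeneous d := by
    refine IsHomogeneous.of_mul_left (huH.sub haH) hua0 (n := d) ?_
    rw [← hr2]
    refine IsHomogeneous.of_mul_left huH hu0 (n := d + 1) ?_
    rw [← hr1]
    exact hrH
  -- The sign accounts for having divided by u − A instead of A − u.
  refine ⟨-r2, hr2H.neg, fun z => ?_⟩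
  refine sub_eq_zero.1 (((h.isPoly _).sub (isPoly_evalPt (-r2))).eq_zero_of_generic {0, A}
    (fun z hz => ?_) z)
  have h1 := hrf z
  rw [hr1, hr2, map_mul, map_mul, map_sub (evalPt R A ε z) u a, hru, ha, evalPt_A] at h1
  have h2 : z i - z j ≠ 0 := hz i j hne 0 (by simp)
  have h3 : A - (z i - z j) ≠ 0 := sub_ne_zero.2 (hz i j hne A (by simp)).symm
  have h4 : (A - (z i - z j)) * (z i - z j) *
      (f (LinkPattern.conj (swap i j) σ) z - evalPt R A ε z (-r2)) = 0 := by
    rw [map_neg]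
    linear_combination -h1
  exact (mul_eq_zero.1 h4).resolve_left (mul_ne_zero h3 h2)

end Integrality

section Polynomials

variable {n : ℕ} {K : Type} [Field K] [Infinite K] {R : Type} [CommRing R] [IsDomain R]
  [Algebra R K] {A ε : K}

theorem IsWeakSolution.exists_polynomial {f : LinkPattern (2 * n) → (Fin (2 * n) → K) → K}
    (h : IsWeakSolution A (A + A - ε) ε f) (hA : A ≠ 0) {zg : Fin (2 * n) → K}
    (hinj : Function.Injective (evalPt R A ε zg))
    (hf : ∀ z, f (antipodal n) z = ∏ e, linVal A ε e z) (π : LinkPattern (2 * n)) :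
    ∃ p : MvPolynomial (Var (2 * n)) R, p.IsHomogeneous (2 * n * (n - 1)) ∧
      ∀ z, f π z = evalPt R A ε z p := by
  refine LinkPattern.induction_swap (P := fun π => ∃ p : MvPolynomial (Var (2 * n)) R,
    p.IsHomogeneous (2 * n * (n - 1)) ∧ ∀ z, f π z = evalPt R A ε z p) (π := antipodal n)
    ⟨∏ e, linVar R e, prod_linVar_isHomogeneous, fun z => ?_⟩
    (fun i j hij σ hσ hp => h.exists_polynomial_conj hA hinj hij hσ hp) π
  rw [hf, map_prod]
  simp only [evalPt_linVar]

end Polynomials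
end BrauerQKZ


namespace BrauerQKZ

open Equiv MvPolynomial

/-! ### The generic point and the special value of β -/

section Generic

variable {N : ℕ}

/-- The point whose coordinates are the variables `z k`. -/
noncomputable def genericPt (N : ℕ) : Fin N → RatFun N := fun k => ratVar (Var.z k)

theorem evalPt_genericPt (p : Poly N) :
    evalPt ℂ (ratVar Var.A) (ratVar Var.eps) (genericPt N) p = algebraMap (Poly N) (RatFun N) p := by
  have : evalPt ℂ (ratVar Var.A) (ratVar Var.eps) (genericPt N) =
      IsScalarTower.toAlgHom ℂ (Poly N) (RatFun N) := by
    apply algHom_ext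
    intro v
    rw [evalPt, aeval_X]
    cases v <;> rfl
  rw [this]
  rfl

theorem evalPt_genericPt_injective :
    Function.Injective (evalPt ℂ (ratVar Var.A) (ratVar Var.eps) (genericPt N)) := fun p q h => by
  rw [evalPt_genericPt, evalPt_genericPt] at h
  exact IsFractionRing.injective (Poly N) (RatFun N) h

variable {K : Type} [Field K] [Algebra ℂ K] {A ε : K}

theorem evalPt_map_int [Algebra ℤ K] (z : Fin N → K) (p : MvPolynomial (Var N) ℤ) :
    evalPt ℂ A ε z (map (Int.castRingHom ℂ) p) = evalPt ℤ A ε z p := by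
  unfold evalPt
  rw [aeval_def, eval₂_map, aeval_def]
  congr 1
  exact RingHom.ext_int _ _

theorem evalPt_int_genericPt_injective :
    Function.Injective (evalPt ℤ (ratVar Var.A) (ratVar Var.eps) (genericPt N)) := fun p q h => by
  rw [← evalPt_map_int, ← evalPt_map_int] at h
  exact map_injective _ (RingHom.injective_int _) (evalPt_genericPt_injective h)

theorem evalPt_substZ (z : Fin N → K) (w : Fin N → Poly N) (p : Poly N) :
    evalPt ℂ A ε z (substZ w p) = evalPt ℂ A ε (fun k => evalPt ℂ A ε z (w k)) p := by
  unfold substZ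
  conv_lhs => rw [evalPt, ← AlgHom.comp_apply, comp_aeval]
  conv_rhs => rw [evalPt]
  congr 2
  funext v
  cases v with
  | A => exact aeval_X _ _
  | eps => exact aeval_X _ _
  | z k => rfl

theorem evalPt_tau (z : Fin N → K) (i j : Fin N) (p : Poly N) :
    evalPt ℂ A ε z (tau i j p) = evalPt ℂ A ε (z ∘ swap i j) p := by
  unfold tau
  rw [evalPt_substZ]
  simp only [evalPt_z]
  rfl

theorem evalPt_shift (z : Fin N → K) (p : Poly N) :
    evalPt ℂ A ε z (shift N p) = evalPt ℂ A ε (rotPoint ε z) p := by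
  unfold shift
  rw [evalPt_substZ]
  congr 2
  funext k
  rw [map_add, evalPt_z, rotPoint]
  split_ifs
  · rw [evalPt_eps]
  · rw [map_zero]

theorem algebraMap_ne_zero_of_eval {p : Poly N}
    (h : eval (varPt (N := N) (1 : ℂ) 0 0) p ≠ 0) : algebraMap (Poly N) (RatFun N) p ≠ 0 := by
  rw [ne_eq, map_eq_zero_iff _ (IsFractionRing.injective (Poly N) (RatFun N))]
  rintro rfl
  simp at h

/-- The parameter `2 A - ε`. -/
noncomputable def ratC (N : ℕ) : RatFun N := ratVar Var.A + ratVar Var.A - ratVar Var.eps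

theorem ratA_ne_zero : (ratVar Var.A : RatFun N) ≠ 0 :=
  algebraMap_ne_zero_of_eval (by simp [varPt])

theorem ratC_ne_zero : ratC N ≠ 0 := by
  have := algebraMap_ne_zero_of_eval (p := (X Var.A + X Var.A - X Var.eps : Poly N))
    (by simp [varPt])
  simpa [ratC, ratVar] using this

theorem ratA_add_ratC_ne_zero : ratVar Var.A + ratC N ≠ 0 := by
  have := algebraMap_ne_zero_of_eval
    (p := (X Var.A + (X Var.A + X Var.A - X Var.eps) : Poly N)) (by simp [varPt]; norm_num)
  simpa [ratC, ratVar] using this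

theorem ratC_sq_ne : ratC N ^ 2 ≠ (ratVar Var.A) ^ 2 := by
  have := algebraMap_ne_zero_of_eval
    (p := ((X Var.A + X Var.A - X Var.eps) ^ 2 - X Var.A ^ 2 : Poly N)) (by simp [varPt]; norm_num)
  rw [← sub_ne_zero]
  simpa [ratC, ratVar] using this

theorem gFun_genericPt_ne_zero (i j : Fin N) :
    gFun (ratVar Var.A) (ratC N) (genericPt N i - genericPt N j) ≠ 0 := by
  have := algebraMap_ne_zero_of_eval
    (p := ((X Var.A + (X (Var.z i) - X (Var.z j))) * (X Var.A + X Var.A - X Var.eps -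
      (X (Var.z i) - X (Var.z j))) : Poly N)) (by simp [varPt])
  simpa only [gFun, ratC, ratVar, genericPt, map_mul, map_add, map_sub] using this

/-- For c = 2A − ε the special β is 2(c − A)/c, so 1 − β/2 = A/c, and this factor cancels between
numerator and denominator. -/
theorem Rcheck_betaSpecial (u : RatFun N) (i j : Fin N) :
    Rcheck (ratVar Var.A) (betaSpecial N) u i j =
      (gFun (ratVar Var.A) (ratC N) u)⁻¹ • rOp (ratVar Var.A) (ratC N) i j u := by
  have hA := ratA_ne_zero (N := N)
  have hc := ratC_ne_zero (N := N)
  have hβ : betaSpecial N = loopWeight (ratVar Var.A) (ratC N) := by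
    unfold betaSpecial loopWeight ratC
    congr 1 <;> ring
  have hq : 1 - betaSpecial N / 2 = ratVar Var.A / ratC N := by
    rw [hβ, loopWeight]
    field_simp
    ring
  unfold Rcheck rOp
  rw [hq, hβ, fOp_eq]
  have e1 : (ratVar Var.A + u) * (ratVar Var.A - ratVar Var.A / ratC N * u) =
      ratVar Var.A / ratC N * gFun (ratVar Var.A) (ratC N) u := by
    unfold gFun
    field_simp
  rw [e1, mul_inv, mul_comm, mul_smul]
  congr 1
  have hq0 : ratVar Var.A / ratC N ≠ 0 := div_ne_zero hA hc
  rw [inv_smul_eq_iff₀ hq0]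
  simp only [smul_add, smul_smul]
  have e2 : ratVar Var.A / ratC N * (ratC N * (ratVar Var.A - u)) =
      ratVar Var.A * (ratVar Var.A - u) := by field_simp
  have e3 : ratVar Var.A / ratC N * (u * (ratVar Var.A - u)) =
      ratVar Var.A / ratC N * u * (ratVar Var.A - u) := by ring
  have e4 : ratVar Var.A / ratC N * (u * ratC N) = ratVar Var.A * u := by field_simp
  rw [e2, e3, e4, add_right_comm]
  rfl

end Generic
end BrauerQKZ


namespace BrauerQKZ

open Equiv MvPolynomial

/-! ### Existence, integrality and uniqueness -/

section Solutions

variable {N : ℕ}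

instance : CharZero (RatFun N) :=
  charZero_of_injective_algebraMap (FaithfulSMul.algebraMap_injective ℂ (RatFun N))

instance : Infinite (RatFun N) :=
  Infinite.of_injective _ (Nat.cast_injective (R := RatFun N))

theorem rot_symm_apply (K : Type) [CommRing K] (x : LinkPattern N →₀ K) (π : LinkPattern N) :
    (rot N K).symm x π = x (LinkPattern.conj (finRotate N) π) := rfl

theorem evalPt_cyclic {Φ : LinkPattern N →₀ Poly N}
    (h : (rot N (Poly N)).symm Φ = Φ.mapRange (shift N) (map_zero _)) (π : LinkPattern N)
    (z : Fin N → RatFun N) :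
    evalPt ℂ (ratVar Var.A) (ratVar Var.eps) z (Φ π) =
      evalPt ℂ (ratVar Var.A) (ratVar Var.eps) (rotPoint (ratVar Var.eps) z)
        (Φ (LinkPattern.conj (finRotate N)⁻¹ π)) := by
  have h1 := congrArg (fun x => x (LinkPattern.conj (finRotate N)⁻¹ π)) h
  simp only [rot_symm_apply, Finsupp.mapRange_apply] at h1
  rw [LinkPattern.conj_conj, mul_inv_cancel, LinkPattern.conj_one] at h1
  rw [h1, evalPt_shift]

theorem IsQKZSolution.isWeakSolution {Φ : LinkPattern N →₀ Poly N}
    (h : IsQKZSolution (betaSpecial N) Φ) :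
    IsWeakSolution (ratVar Var.A) (ratC N) (ratVar Var.eps)
      fun π z => evalPt ℂ (ratVar Var.A) (ratVar Var.eps) z (Φ π) where
  isPoly π := isPoly_evalPt _
  exch i j hij π hπ z := by
    have hne : i ≠ j := by rintro rfl; omega
    have h1 := congrArg (fun x => x π) (h.exchange i j hij)
    have hg := gFun_genericPt_ne_zero i j
    unfold genericPt at hg
    simp only [Rcheck_betaSpecial, LinearMap.smul_apply, Finsupp.smul_apply, smul_eq_mul,
      rOp_apply_of_ne _ _ hne hπ, Finsupp.mapRange_apply] at h1
    rw [inv_mul_eq_iff_eq_mul₀ hg] at h1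
    -- The equation at the generic point, cleared of denominators, is a polynomial identity and can
    -- be evaluated at any point.
    have h2 : (X Var.A - (X (Var.z i) - X (Var.z j))) *
        ((X Var.A + X Var.A - X Var.eps) * Φ π +
          (X (Var.z i) - X (Var.z j)) * Φ (LinkPattern.conj (swap i j) π)) =
        (X Var.A + (X (Var.z i) - X (Var.z j))) *
          (X Var.A + X Var.A - X Var.eps - (X (Var.z i) - X (Var.z j))) * tau i j (Φ π) := by
      apply IsFractionRing.injective (Poly N) (RatFun N)
      simpa only [map_mul, map_add, map_sub, gFun, ratC, ratVar] using h1
    have h3 := congrArg (evalPt ℂ (ratVar Var.A) (ratVar Var.eps) z) h2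
    simp only [map_mul, map_add, map_sub, evalPt_A, evalPt_eps, evalPt_z, evalPt_tau] at h3
    exact h3.symm
  cyc := evalPt_cyclic h.cyclic

theorem isQKZSolution_of_exch {Ψ : (Fin N → RatFun N) → LinkPattern N →₀ RatFun N}
    {Φ : LinkPattern N →₀ Poly N}
    (hΦ : ∀ π z, Ψ z π = evalPt ℂ (ratVar Var.A) (ratVar Var.eps) z (Φ π))
    (hΨ : ∀ i j : Fin N, (i : ℕ) + 1 = j → Exch (ratVar Var.A) (ratC N) Ψ i j)
    (hcyc : ∀ z, Ψ z = conjOp _ (finRotate N) (Ψ (rotPoint (ratVar Var.eps) z))) :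
    IsQKZSolution (betaSpecial N) Φ where
  exchange i j hij := by
    have h1 : Φ.mapRange (algebraMap (Poly N) (RatFun N)) (map_zero _) = Ψ (genericPt N) := by
      ext π
      rw [Finsupp.mapRange_apply, hΦ, evalPt_genericPt]
    have h2 : (Φ.mapRange (tau i j) (map_zero _)).mapRange (algebraMap (Poly N) (RatFun N))
        (map_zero _) = Ψ (genericPt N ∘ swap i j) := by
      ext π
      rw [Finsupp.mapRange_apply, Finsupp.mapRange_apply, hΦ, ← evalPt_genericPt, evalPt_tau]
    rw [h1, h2, Rcheck_betaSpecial, LinearMap.smul_apply]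
    refine (inv_smul_eq_iff₀ (gFun_genericPt_ne_zero i j)).2 ?_
    exact (hΨ i j hij (genericPt N)).symm
  cyclic := by
    ext1 π
    apply evalPt_genericPt_injective
    rw [rot_symm_apply, Finsupp.mapRange_apply, evalPt_shift, ← hΦ, ← hΦ, hcyc, conjOp_apply,
      LinkPattern.conj_conj, inv_mul_cancel, LinkPattern.conj_one]

variable {n : ℕ}

/-- The product of the linear factors already has the full degree in all variables, including A and
ε, so the cofactor is homogeneous of degree 0, a complex number. -/
theorem IsQKZSolution.antipodal_eq {Φ : LinkPattern (2 * n) →₀ Poly (2 * n)}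
    (h : IsQKZSolution (betaSpecial (2 * n)) Φ)
    (hΦ : (Φ (antipodal n)).IsHomogeneous (2 * n * (n - 1))) :
    ∃ κ : ℂ, Φ (antipodal n) = C κ * ∏ e, linVar ℂ e := by
  have hdvd : ∏ e, linVar (n := n) ℂ e ∣ Φ (antipodal n) :=
    prod_linVar_dvd evalPt_genericPt_injective fun e z hz =>
      h.isWeakSolution.antipodal_eq_zero_of_linVal two_ne_zero ratA_ne_zero ratC_sq_ne hz
  obtain ⟨q, hq⟩ := hdvd
  have hne : ∏ e, linVar (n := n) ℂ e ≠ 0 := Finset.prod_ne_zero_iff.2 fun e _ => linVar_ne_zero e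
  rw [hq, ← zero_add (2 * n * (n - 1))] at hΦ
  have hq0 := IsHomogeneous.of_mul_left prod_linVar_isHomogeneous hne hΦ
  refine ⟨coeff 0 q, ?_⟩
  rw [hq, mul_comm _ q]
  congr 1
  exact totalDegree_eq_zero_iff_eq_C.1 (Nat.le_zero.1 hq0.totalDegree_le)

/-- The recursion fixes the solution only up to a scalar in K that may involve A and ε; dividing by
it makes the antipodal component the explicit product, from which integrality starts. -/
theorem exists_normalised_solution (hn : 0 < n) :
    ∃ Ψ : (Fin (2 * n) → RatFun (2 * n)) → LinkPattern (2 * n) →₀ RatFun (2 * n),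
      VPoly Ψ ∧
      (∀ i j : Fin (2 * n), (i : ℕ) + 1 = j → Exch (ratVar Var.A) (ratC (2 * n)) Ψ i j) ∧
      (∀ z, Ψ z = conjOp _ (finRotate (2 * n)) (Ψ (rotPoint (ratVar Var.eps) z))) ∧
      ∀ z, Ψ z (antipodal n) = ∏ e, linVal (ratVar Var.A) (ratVar Var.eps) e z := by
  obtain ⟨m, rfl⟩ : ∃ m, n = m + 1 := ⟨n - 1, by omega⟩
  obtain ⟨Ψ', Ψ, hΨ, ho, z₀, hz₀⟩ := exists_isExchPair (K := RatFun (2 * (m + 1))) two_ne_zero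
    ratA_ne_zero ratC_ne_zero ratA_add_ratC_ne_zero m
  have hε : ratVar Var.A + ratVar Var.A - ratC (2 * (m + 1)) = ratVar Var.eps := by
    rw [ratC, sub_sub_cancel]
  have hcyc : ∀ z, Ψ z = conjOp _ (finRotate (2 * m + 2)) (Ψ (rotPoint (ratVar Var.eps) z)) := by
    intro z
    rw [← hε]
    exact hΨ.cyclic ho z
  have hw := isWeakSolution_of_exch hΨ.deg.vPoly hΨ.exch hcyc
  obtain ⟨κ, hκ⟩ := IsWeakSolution.antipodal_eq (n := m + 1) hw two_ne_zero ratA_ne_zero ratC_sq_ne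
    (hΨ.deg _)
  -- Otherwise the antipodal component, and with it every component, would vanish.
  have hκ0 : κ ≠ 0 := by
    rintro rfl
    refine hz₀ (Finsupp.ext fun π => ?_)
    exact hw.eq_zero_of_component (π := antipodal (m + 1)) (fun z => by rw [hκ, zero_mul]) π z₀
  refine ⟨fun z => κ⁻¹ • Ψ z, fun π => (IsPoly.const κ⁻¹).mul (hΨ.deg.vPoly π), ?_, ?_, ?_⟩
  · intro i j hij z
    rw [map_smul, ← hΨ.exch i j hij z, smul_comm]
  · intro z
    rw [map_smul]
    exact congrArg (κ⁻¹ • ·) (hcyc z)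
  · intro z
    rw [Finsupp.smul_apply, smul_eq_mul, hκ, inv_mul_cancel_left₀ hκ0]

theorem exists_integral_solution (hn : 0 < n) :
    ∃ Ψ : LinkPattern (2 * n) →₀ MvPolynomial (Var (2 * n)) ℤ,
      (∀ π, Ψ π ≠ 0 ∧ (Ψ π).IsHomogeneous (2 * n * (n - 1))) ∧
      IsQKZSolution (betaSpecial (2 * n)) (ofInt Ψ) ∧
      ofInt Ψ (antipodal n) = ∏ e, linVar ℂ e := by
  obtain ⟨Ψ, hP, hex, hcyc, hanti⟩ := exists_normalised_solution hn
  have hw := isWeakSolution_of_exch hP hex hcyc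
  choose p hhom hp using hw.exists_polynomial (R := ℤ) ratA_ne_zero
    evalPt_int_genericPt_injective hanti
  have hΦ : ∀ π z, Ψ z π = evalPt ℂ (ratVar Var.A) (ratVar Var.eps) z
      (ofInt (Finsupp.equivFunOnFinite.symm p) π) := by
    intro π z
    rw [ofInt, Finsupp.mapRange_apply, evalPt_map_int]
    exact hp π z
  have hant : ofInt (Finsupp.equivFunOnFinite.symm p) (antipodal n) = ∏ e, linVar ℂ e := by
    apply evalPt_genericPt_injective
    rw [← hΦ, hanti, map_prod]
    simp only [evalPt_linVar]
  refine ⟨Finsupp.equivFunOnFinite.symm p, fun π => ⟨fun h0 => ?_, hhom π⟩,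
    isQKZSolution_of_exch hΦ hex hcyc, hant⟩
  have hne : ∏ e, linVar (n := n) ℂ e ≠ 0 := Finset.prod_ne_zero_iff.2 fun e _ => linVar_ne_zero e
  rw [← hant] at hne
  apply hne
  apply evalPt_genericPt_injective
  rw [← hΦ, map_zero]
  refine hw.eq_zero_of_component (π := π) (fun z => ?_) _ _
  rw [hΦ, ofInt, Finsupp.mapRange_apply, h0, map_zero, map_zero]

/-- For the constant κ found in the antipodal component, Φ − κΨ satisfies the weak relations with
zero antipodal component, hence vanishes. -/
theorem IsQKZSolution.eq_smul {Φ Ψ : LinkPattern (2 * n) →₀ Poly (2 * n)}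
    (hΦ : IsQKZSolution (betaSpecial (2 * n)) Φ)
    (hhom : ∀ π, (Φ π).IsHomogeneous (2 * n * (n - 1)))
    (hΨ : IsQKZSolution (betaSpecial (2 * n)) Ψ) (hanti : Ψ (antipodal n) = ∏ e, linVar ℂ e) :
    ∃ κ : ℂ, Φ = κ • Ψ := by
  obtain ⟨κ, hκ⟩ := hΦ.antipodal_eq (hhom _)
  refine ⟨κ, Finsupp.ext fun π => ?_⟩
  have hw := hΦ.isWeakSolution.sub_smul hΨ.isWeakSolution (algebraMap ℂ _ κ)
  have h0 := hw.eq_zero_of_component (π := antipodal n) (fun z => ?_) π (genericPt _)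
  · apply evalPt_genericPt_injective
    rw [Finsupp.smul_apply, map_smul, Algebra.smul_def, ← sub_eq_zero]
    exact h0
  · rw [hκ, hanti, map_mul, sub_eq_zero]
    congr 1
    exact aeval_C _ _

end Solutions
end BrauerQKZ

theorem mainTheorem2 (n : ℕ) (hn : 0 < n) :
    ∃ Ψ : BrauerQKZ.LinkPattern (2 * n) →₀ MvPolynomial (BrauerQKZ.Var (2 * n)) ℤ,
      (∀ π, Ψ π ≠ 0 ∧ (Ψ π).IsHomogeneous (2 * n * (n - 1))) ∧
      BrauerQKZ.IsQKZSolution (BrauerQKZ.betaSpecial (2 * n)) (BrauerQKZ.ofInt Ψ) ∧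
      ∀ Φ : BrauerQKZ.LinkPattern (2 * n) →₀ BrauerQKZ.Poly (2 * n),
        (∀ π, (Φ π).IsHomogeneous (2 * n * (n - 1))) →
        BrauerQKZ.IsQKZSolution (BrauerQKZ.betaSpecial (2 * n)) Φ →
        ∃ c : ℂ, Φ = c • BrauerQKZ.ofInt Ψ := by
  obtain ⟨Ψ, h, hsol, hanti⟩ := BrauerQKZ.exists_integral_solution hn
  exact ⟨Ψ, h, hsol, fun Φ hhom hΦ => hΦ.eq_smul hhom hsol hanti⟩
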